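/- **Setting.** A two-way transducer $\mathcal T$ has a finite state set $Q$, an input alphabet containing two distinct end markers $\vdash,\dashv$, initial and final states, and finitely many rules $(q,a,w,q',d)$ with $d\in\{\mathsf{left},\mathsf{right}\}$, where $w$ is the word that the rule outputs (no left rule reads $\vdash$). An input is $u=a_1\cdots a_n$ with $a_1=\vdash$, $a_n=\dashv$ and no other markers. A run is *successful* if it leads from an initial state before $a_1$ to a final state after $a_n$. Let $\mathsf c_{\max}$ be the maximal length of the output of a rule and $\mathsf h_{\max}=2|Q|-1$. $\mathcal T$ is *sweeping* if its successful runs reverse direction only when reading $a_1$ or $a_n$. The *position* of a configuration of a run is the cut ($0,\dots,n$) just crossed by the head: the number of letters to the left of the head at the start and after a right move, and this number plus $1$ after a left move. The *location* of the configuration is $(x,y)$, where $x$ is its position and $y$ (the *level*) is the number of earlier configurations at position $x$. Locations are ordered by the run ($\trianglelefteq$). The run is *normalized* if no two locations have the same position, the same state and levels of the same parity. The *crossing sequence* at $x$ is the sequence of states at the locations $(x,0),(x,1),\dots$. For a set $Z$ of locations, $\mathrm{out}(\rho|Z)$ is the concatenated output of the transitions with source and target in $Z$. A factor is *intercepted*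 by an interval $[x_1,x_2]$ with $x_1<x_2$ if it is a maximal nonempty factor whose transitions only read letters among $a_{x_1+1},\dots,a_{x_2}$. A *loop* is an interval $[x_1,x_2]$, $x_1<x_2$, with equal crossing sequences at $x_1$ and $x_2$. **Anchor points, traces.** *Sweeping case:* an anchor point $\ell$ of a loop $L$ is the first location of a factor intercepted by $L$, and this factor is its trace $\mathrm{tr}(\ell)$. A factor from $(x,y)$ to $(x',y)$ is output-minimal if every loop strictly included in the interval spanned by $x,x'$ produces empty output at level $y$. *Two-way case:* the flow $F_L$ of $L$ is the graph on levels with an edge $y\to y'$ for each intercepted factor from level $y$ to level $y'$. Write $F_{LR},F_{RL},F_{LL},F_{RR}$ for its edges even→even, odd→odd, even→odd, odd→even. The product $F\circ F'$ has $LR$-edges $F_{LR}(F'_{LL}F_{RR})^*F'_{LR}$, $RL$-edges $F'_{RL}(F_{RR}F'_{LL})^*F_{RL}$, $LL$-edges $F_{LL}\cup F_{LR}(F'_{LL}F_{RR})^*F'_{LL}F_{RL}$, and $RR$-edges $F'_{RR}\cup F'_{RL}(F_{RR}F'_{LL})^*F_{RR}F'_{LR}$. A loop is idempotent if $F_L\circ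 F_L=F_L$. A component $C$ of $L$ is a strongly connected component of $F_L$. Its anchor point in $L=[x_1,x_2]$ is $(x_1,\max C)$ if $\min C$ is even, and $(x_2,\max C)$ otherwise. The trace of this anchor point is the concatenation of the intercepted factors along the simple cycle of $C$ from $\max C$ to $\max C$. **Inversions.** An inversion of $\rho$ is $(L_1,\ell_1,L_2,\ell_2)$ where each $\ell_i=(x_i,y_i)$ is an anchor point of the loop $L_i$, $\ell_1\triangleleft\ell_2$, $x_1>x_2$, and each $\mathrm{tr}(\ell_i)$ has nonempty output. In the sweeping case the traces must moreover be output-minimal, and in the two-way case the loops must be idempotent. $\rho$ *satisfies P2* (with bound $B$) if for every inversion the word $\mathrm{out}(\mathrm{tr}(\ell_1))\,\mathrm{out}(\rho[\ell_1,\ell_2])\,\mathrm{out}(\mathrm{tr}(\ell_2))$ has a period $p$ with $1\le p\le B$ that divides both $|\mathrm{out}(\mathrm{tr}(\ell_1))|$ and $|\mathrm{out}(\mathrm{tr}(\ell_2))|$. Let $\simeq$ be the reflexive transitive closure of the relation "$\ell_1\trianglelefteq\ell,\ell'\trianglelefteq\ell_2$ for some inversion $(L_1,\ell_1,L_2,\ell_2)$"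 on locations $\ell,\ell'$. For a non-singleton $\simeq$-class $K$ with first location $\ell$ and last location $\ell'$, let $\tilde x\le\tilde x'$ be the extreme positions of the locations of $K$ that are anchor points occurring in some inversion. Then $\mathrm{block}(K)=[\tilde\ell,\tilde\ell']$, where $\tilde\ell$ is the latest location $\trianglelefteq\ell$ at position $\tilde x$ and $\tilde\ell'$ is the earliest location $\trianglerighteq\ell'$ at position $\tilde x'$. The factors $\rho[\tilde\ell,\tilde\ell']$ are the *$\simeq$-blocks*. Two factors *overlap* if they share a location and neither ends where the other starts. **Diagonals, blocks.** A word is almost periodic with bound $p$ if it is $w_0w_1w_2$ with $|w_0|,|w_2|\le p$ and $w_1$ of some period between $1$ and $p$. Let $\ell=(x,y)\trianglelefteq\ell'=(x',y')$ with $x\le x'$. *Sweeping case.* $\rho[\ell,\ell']$ is a *floor* if it lies on a single even level. It is a *$B$-diagonal* if there are $\ell=\ell_0\trianglelefteq\dots\trianglelefteq\ell_{2n+1}=\ell'$ such that each $\rho[\ell_{2i+1},\ell_{2i+2}]$ is a floor, and each $\rho[\ell_{2i},\ell_{2i+1}]$ has output of length at most $2\mathsf h_{\max}B$, the position of $\ell_{2i}$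 being at most that of $\ell_{2i+1}$. It is a *$B$-block* if its output is almost periodic with bound $2B$ and $|\mathrm{out}(\rho|Z)|\le 2\mathsf h_{\max}B$ for $Z=[\ell,\ell']\setminus([x,x']\times[y,y'])$. *Two-way case.* $\rho[\ell,\ell']$ is a *$B$-diagonal* if for every $z\in[x,x']$ there is a location $\ell_z\in[\ell,\ell']$ at position $z$ such that $\mathrm{out}(\rho|([\ell_z,\ell']\cap[0,z]\times\mathbb N))$ and $\mathrm{out}(\rho|([\ell,\ell_z]\cap[z,n]\times\mathbb N))$ have length at most $B$. It is a *$B$-block* if its output is almost periodic with bound $B$ and $\mathrm{out}(\rho|([\ell,\ell']\cap[0,x]\times\mathbb N))$ and $\mathrm{out}(\rho|([\ell,\ell']\cap[x',n]\times\mathbb N))$ have length at most $B$. A *$B$-decomposition* of $\rho$ is a factorization of $\rho$ into $B$-diagonals and $B$-blocks. **Theorem.** Let $\rho$ be a normalized successful run of a two-way transducer $\mathcal T$. 1. *(Sweeping case.)* Let $\mathcal T$ be sweeping, $B=\mathsf c_{\max}|Q|^{\mathsf h_{\max}}+1$, and suppose that $\rho$ satisfies P2 (with the sweeping notions). Then for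 every non-singleton $\simeq$-class $K$, $\mathrm{block}(K)$ exists and is a $B$-block. Moreover $\rho$ has a $B$-decomposition in which every $\simeq$-block occurs as a factor, and each factor is either a $\simeq$-block or a $B$-diagonal that overlaps no $\simeq$-block. 2. *(Two-way case.)* Let $B=\mathsf c_{\max}\mathsf h_{\max}(2^{3\mathsf e_{\max}}+4)+4\mathsf c_{\max}$ with $\mathsf e_{\max}=(2|Q|)^{2\mathsf h_{\max}}$, and suppose that $\rho$ satisfies P2 (with the two-way notions). Then for every non-singleton $\simeq$-class $K$, $\mathrm{block}(K)$ exists and is a $B$-block. Every factor $\rho[(x,y),(x',y')]$ with $x\le x'$ that overlaps no $\simeq$-block is a $B$-diagonal. Moreover $\rho$ has a $B$-decomposition in which every $\simeq$-block occurs as a factor, and each factor is either a $\simeq$-block or a $B$-diagonal that overlaps no $\simeq$-block. -/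

import Mathlib

/-! Two-way transducers, their runs, inversions and decompositions of runs. -/

/-- The two directions in which the head may move. -/
inductive HeadDir where
  | left
  | right

/-- A transition rule `(q, a, w, q', d)`. -/
structure TransitionRule (Q A Γ : Type*) where
  source : Q
  letter : A
  output : List Γ
  target : Q
  dir : HeadDir

/-- A (nondeterministic) two-way transducer over the input alphabet `A`, which contains the two
end markers. Left transitions on the left marker are not allowed. -/
structure TwoWayTransducer (Q A Γ : Type*) where
  leftMark : A
  rightMark : A
  marks_ne : leftMark ≠ rightMark
  rules : Finset (TransitionRule Q A Γ)
  no_left_on_leftMark : ∀ r ∈ rules, r.letter = leftMark → r.dir = HeadDir.right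
  initial : Set Q
  final : Set Q

/-- `w` has period `p`. -/
def HasPeriod {Γ : Type*} (w : List Γ) (p : ℕ) : Prop :=
  0 < p ∧ ∀ i, i + p < w.length → w[i]? = w[i + p]?

/-- `w = w₀ w₁ w₂` with `|w₀|, |w₂| ≤ p` and `w₁` of period at most `p`. -/
def AlmostPeriodic {Γ : Type*} (p : ℕ) (w : List Γ) : Prop :=
  ∃ w₀ w₁ w₂ : List Γ, w = w₀ ++ w₁ ++ w₂ ∧ w₀.length ≤ p ∧ w₂.length ≤ p ∧
    ∃ q ≤ p, HasPeriod w₁ q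

namespace TwoWayTransducer

variable {Q A Γ : Type*}

/-- Input words: a word without markers, enclosed between the two markers. -/
def IsInput (T : TwoWayTransducer Q A Γ) (u : List A) : Prop :=
  ∃ w : List A, (∀ a ∈ w, a ≠ T.leftMark ∧ a ≠ T.rightMark) ∧
    u = T.leftMark :: (w ++ [T.rightMark])

/-- The maximal length of an output on a single transition. -/
def capacity (T : TwoWayTransducer Q A Γ) : ℕ :=
  T.rules.sup fun r => r.output.length

/-- `2|Q| - 1`, the maximal length of a crossing sequence of a normalized run. -/
def hmax (_T : TwoWayTransducer Q A Γ) [Fintype Q] : ℕ :=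
  2 * Fintype.card Q - 1

/-- The constant `B` of the sweeping case. -/
def sweepingBound (T : TwoWayTransducer Q A Γ) [Fintype Q] : ℕ :=
  T.capacity * Fintype.card Q ^ T.hmax + 1

/-- The bound `(2|Q|)^(2 hmax)` on the size of the effect semigroup. -/
def emax (T : TwoWayTransducer Q A Γ) [Fintype Q] : ℕ :=
  (2 * Fintype.card Q) ^ (2 * T.hmax)

/-- The constant `B` of the two-way case. -/
def twoWayBound (T : TwoWayTransducer Q A Γ) [Fintype Q] : ℕ :=
  T.capacity * T.hmax * (2 ^ (3 * T.emax) + 4) + 4 * T.capacity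

/-- A run of `T` on `u` with `len` transitions. Its configurations are indexed by the times
`0, …, len` (values of the functions outside of this range are irrelevant). `head t` is the number
of letters to the left of the head at time `t`, so the letter that is read next is `u[head t]`,
and `rule t` is the rule used between the times `t` and `t + 1`. -/
structure Run (T : TwoWayTransducer Q A Γ) (u : List A) where
  len : ℕ
  state : ℕ → Q
  head : ℕ → ℕ
  rule : ℕ → TransitionRule Q A Γ
  valid : ∀ t < len, rule t ∈ T.rules ∧ (rule t).source = state t ∧
    (rule t).target = state (t + 1) ∧ u[head t]? = some (rule t).letter ∧
    match (rule t).dir with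
    | HeadDir.right => head (t + 1) = head t + 1
    | HeadDir.left => head t = head (t + 1) + 1

namespace Run

variable {T : TwoWayTransducer Q A Γ} {u : List A} (ρ : T.Run u)

/-- The run goes from an initial to a final configuration. -/
def IsSuccessful : Prop :=
  ρ.head 0 = 0 ∧ ρ.state 0 ∈ T.initial ∧ ρ.head ρ.len = u.length ∧ ρ.state ρ.len ∈ T.final

/-! ### Locations

Locations of the run are identified with the times `t ≤ len`: the location at time `t` is
`(ρ.pos t, ρ.level t)`, and the run order on locations is the order on times. -/

/-- The position (a cut between two letters) of the configuration at time `t`. -/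
def pos : ℕ → ℕ
  | 0 => ρ.head 0
  | t + 1 =>
    match (ρ.rule t).dir with
    | HeadDir.right => ρ.head (t + 1)
    | HeadDir.left => ρ.head (t + 1) + 1

/-- The level at time `t`: the number of earlier visits of the same position. -/
def level (t : ℕ) : ℕ :=
  ((Finset.range t).filter fun s => ρ.pos s = ρ.pos t).card

/-- The crossing sequence at position `x`. -/
def crossing (x : ℕ) : List Q :=
  ((List.range (ρ.len + 1)).filter fun t => ρ.pos t = x).map ρ.state

/-- No two locations have the same position, the same state and levels of the same parity. -/
def IsNormalized : Prop :=
  ∀ s t, s < t → t ≤ ρ.len → ρ.pos s = ρ.pos t → ρ.state s = ρ.state t →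
    ρ.level s % 2 ≠ ρ.level t % 2

/-- Reversals of the head happen only when one of the two extremal letters is read. -/
def ReversesOnlyAtBorders : Prop :=
  ∀ t, t + 1 < ρ.len → (ρ.rule t).dir ≠ (ρ.rule (t + 1)).dir →
    ρ.head (t + 1) = 0 ∨ ρ.head (t + 1) + 1 = u.length

/-- The output of the factor of the run between the times `s` and `e`. -/
def factorOut (s e : ℕ) : List Γ :=
  (List.range' s (e - s)).flatMap fun t => (ρ.rule t).output

/-- The output of the subsequence of the run induced by a set `Z` of locations: the transitions
that count are those whose source and target are both in `Z`. -/
def outOn (Z : Finset ℕ) : List Γ :=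
  ((List.range ρ.len).filter fun t => t ∈ Z ∧ t + 1 ∈ Z).flatMap fun t => (ρ.rule t).output

/-! ### Loops and intercepted factors

An interval `[x₁, x₂]` of positions is given by the pair `L = (x₁, x₂)`. -/

/-- The factor from time `s` to time `e` is intercepted by `[L.1, L.2]`: it is a maximal (nonempty)
factor all of whose transitions read letters that lie between the cuts `L.1` and `L.2`. -/
def Intercepted (L : ℕ × ℕ) (s e : ℕ) : Prop :=
  s < e ∧ e ≤ ρ.len ∧ (∀ t, s ≤ t → t < e → L.1 ≤ ρ.head t ∧ ρ.head t < L.2) ∧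
    (∀ t, t + 1 = s → ¬ (L.1 ≤ ρ.head t ∧ ρ.head t < L.2)) ∧
    (e < ρ.len → ¬ (L.1 ≤ ρ.head e ∧ ρ.head e < L.2))

/-- `[L.1, L.2]` is a loop: the crossing sequences at its extremities coincide. -/
def IsLoop (L : ℕ × ℕ) : Prop :=
  L.1 < L.2 ∧ L.2 ≤ u.length ∧ ρ.crossing L.1 = ρ.crossing L.2

/-! ### Anchor points and traces: sweeping case -/

/-- The factor between the times `s` and `e` is output-minimal: its endpoints are on the same
level `y`, and all loops strictly included in the interval spanned by the positions of its
endpoints produce an empty output at level `y`. -/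
def OutputMinimal (s e : ℕ) : Prop :=
  ρ.level s = ρ.level e ∧
    ∀ L : ℕ × ℕ, ρ.IsLoop L →
      min (ρ.pos s) (ρ.pos e) ≤ L.1 → L.2 ≤ max (ρ.pos s) (ρ.pos e) →
      L ≠ (min (ρ.pos s) (ρ.pos e), max (ρ.pos s) (ρ.pos e)) →
      ∀ s' e', ρ.Intercepted L s' e' → ρ.level s' = ρ.level s → ρ.factorOut s' e' = []

/-- The location at time `t` is an anchor point inside the loop `L`, i.e. the first location of a
factor intercepted by `L`; this factor (the trace) is output-minimal and has output `w`, which is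
nonempty. -/
def SweepingAnchor (L : ℕ × ℕ) (t : ℕ) (w : List Γ) : Prop :=
  ρ.IsLoop L ∧ ∃ e, ρ.Intercepted L t e ∧ ρ.OutputMinimal t e ∧ w = ρ.factorOut t e ∧ w ≠ []

/-! ### Anchor points and traces: two-way case -/

/-- The edges of the flow of the interval `L`: `y → z` if some factor intercepted by `L` goes
from level `y` to level `z` (such factors start and end at the borders of the interval). -/
def flow (L : ℕ × ℕ) (y z : ℕ) : Prop :=
  ∃ s e, ρ.Intercepted L s e ∧ ρ.level s = y ∧ ρ.level e = z

end Run

/-- The edges of a flow between two even nodes. -/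
def flowLR (F : ℕ → ℕ → Prop) (y z : ℕ) : Prop := F y z ∧ Even y ∧ Even z
/-- The edges of a flow between two odd nodes. -/
def flowRL (F : ℕ → ℕ → Prop) (y z : ℕ) : Prop := F y z ∧ Odd y ∧ Odd z
/-- The edges of a flow from an even to an odd node. -/
def flowLL (F : ℕ → ℕ → Prop) (y z : ℕ) : Prop := F y z ∧ Even y ∧ Odd z
/-- The edges of a flow from an odd to an even node. -/
def flowRR (F : ℕ → ℕ → Prop) (y z : ℕ) : Prop := F y z ∧ Odd y ∧ Even z

/-- The edges of the product of two flows; in the order of the disjuncts, these are the edges of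
types left-right, right-left, left-left (twice) and right-right (twice). -/
def flowMul (F G : ℕ → ℕ → Prop) (y z : ℕ) : Prop :=
  Relation.Comp (flowLR F) (Relation.Comp
    (Relation.ReflTransGen (Relation.Comp (flowLL G) (flowRR F))) (flowLR G)) y z ∨
  Relation.Comp (flowRL G) (Relation.Comp
    (Relation.ReflTransGen (Relation.Comp (flowRR F) (flowLL G))) (flowRL F)) y z ∨
  flowLL F y z ∨
  Relation.Comp (flowLR F) (Relation.Comp
    (Relation.ReflTransGen (Relation.Comp (flowLL G) (flowRR F)))
    (Relation.Comp (flowLL G) (flowRL F))) y z ∨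
  flowRR G y z ∨
  Relation.Comp (flowRL G) (Relation.Comp
    (Relation.ReflTransGen (Relation.Comp (flowRR F) (flowLL G)))
    (Relation.Comp (flowRR F) (flowLR G))) y z

namespace Run

variable {T : TwoWayTransducer Q A Γ} {u : List A} (ρ : T.Run u)

/-- `L` is an idempotent loop. The effect of an interval consists of its flow and of the crossing
sequences at its extremities; as the latter coincide for a loop, the effect of a loop is
idempotent if and only if its flow is. -/
def IsIdempotentLoop (L : ℕ × ℕ) : Prop :=
  ρ.IsLoop L ∧ ∀ y y', flowMul (ρ.flow L) (ρ.flow L) y y' ↔ ρ.flow L y y'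

/-- `C` is a component of `L`: a strongly connected component of the flow of `L`. -/
def IsComponent (L : ℕ × ℕ) (C : Set ℕ) : Prop :=
  ∃ y < (ρ.crossing L.1).length,
    C = {z | Relation.ReflTransGen (ρ.flow L) y z ∧ Relation.ReflTransGen (ρ.flow L) z y}

/-- The location at time `t` is the anchor point of the component `C` inside `L = [x₁, x₂]`: it is
`(x₁, max C)` if `min C` is even and `(x₂, max C)` if `min C` is odd. -/
def IsAnchorOf (L : ℕ × ℕ) (C : Set ℕ) (t : ℕ) : Prop :=
  t ≤ ρ.len ∧ IsGreatest C (ρ.level t) ∧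
    ∃ m, IsLeast C m ∧ (Even m ∧ ρ.pos t = L.1 ∨ Odd m ∧ ρ.pos t = L.2)

/-- The list `fs` of factors (given by their first and last times) is the trace of the anchor point
of level `M`: it consists of the factors intercepted by `L` that correspond to the edges of a
simple cycle of the flow, starting and ending in node `M`. -/
def IsTrace (L : ℕ × ℕ) (M : ℕ) (fs : List (ℕ × ℕ)) : Prop :=
  (∀ f ∈ fs, ρ.Intercepted L f.1 f.2) ∧
    List.IsChain (fun f g => ρ.level f.2 = ρ.level g.1) fs ∧
    (fs.map fun f => ρ.level f.1).Nodup ∧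
    (fs.map fun f => ρ.level f.1).head? = some M ∧
    (fs.map fun f => ρ.level f.2).getLast? = some M

/-- The location at time `t` is an anchor point inside the idempotent loop `L`, and its trace has
output `w`, which is nonempty. -/
def TwoWayAnchor (L : ℕ × ℕ) (t : ℕ) (w : List Γ) : Prop :=
  ρ.IsIdempotentLoop L ∧ (∃ C, ρ.IsComponent L C ∧ ρ.IsAnchorOf L C t) ∧
    ∃ fs, ρ.IsTrace L (ρ.level t) fs ∧ w = (fs.flatMap fun f => ρ.factorOut f.1 f.2) ∧ w ≠ []

/-! ### Inversions, their overlaps and the blocks they generate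

The following notions are common to the two settings; `P` is either `ρ.SweepingAnchor` or
`ρ.TwoWayAnchor`. -/

/-- `(L₁, t₁, L₂, t₂)` is an inversion, and the traces of its anchor points `t₁` and `t₂` have
outputs `w₁` and `w₂`. -/
def IsInversion (P : ℕ × ℕ → ℕ → List Γ → Prop)
    (L₁ : ℕ × ℕ) (t₁ : ℕ) (w₁ : List Γ) (L₂ : ℕ × ℕ) (t₂ : ℕ) (w₂ : List Γ) : Prop :=
  P L₁ t₁ w₁ ∧ P L₂ t₂ w₂ ∧ t₁ < t₂ ∧ ρ.pos t₂ < ρ.pos t₁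

/-- The property P2 of a run, with bound `B`. -/
def SatisfiesP2 (P : ℕ × ℕ → ℕ → List Γ → Prop) (B : ℕ) : Prop :=
  ∀ L₁ t₁ w₁ L₂ t₂ w₂, ρ.IsInversion P L₁ t₁ w₁ L₂ t₂ w₂ →
    ∃ p ≤ B, p ∣ w₁.length ∧ p ∣ w₂.length ∧ HasPeriod (w₁ ++ ρ.factorOut t₁ t₂ ++ w₂) p

/-- The locations `a` and `b` occur within the same inversion. -/
def InSameInversion (P : ℕ × ℕ → ℕ → List Γ → Prop) (a b : ℕ) : Prop :=
  ∃ L₁ t₁ w₁ L₂ t₂ w₂, ρ.IsInversion P L₁ t₁ w₁ L₂ t₂ w₂ ∧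
    t₁ ≤ a ∧ a ≤ t₂ ∧ t₁ ≤ b ∧ b ≤ t₂

/-- `K` is a non-singleton equivalence class of locations, for the reflexive and transitive closure
of the (symmetric) relation of occurring within the same inversion. -/
def IsInversionClass (P : ℕ × ℕ → ℕ → List Γ → Prop) (K : Set ℕ) : Prop :=
  K.Nontrivial ∧ ∃ t ≤ ρ.len,
    K = {s | s ≤ ρ.len ∧ Relation.ReflTransGen (ρ.InSameInversion P) t s}

/-- The locations of `K` that are anchor points occurring in some inversion. -/
def anchorsIn (P : ℕ × ℕ → ℕ → List Γ → Prop) (K : Set ℕ) : Set ℕ :=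
  {t ∈ K | ∃ L₁ t₁ w₁ L₂ t₂ w₂, ρ.IsInversion P L₁ t₁ w₁ L₂ t₂ w₂ ∧ (t = t₁ ∨ t = t₂)}

/-- `[s, e] = block(K)`: if `a`, `b` are the first and last locations of `K` and `x`, `x'` are the
leftmost and rightmost positions of anchor points in `K`, then `s` is the latest location at
position `x` not after `a`, and `e` is the earliest location at position `x'` not before `b`. -/
def IsBlockOf (P : ℕ × ℕ → ℕ → List Γ → Prop) (K : Set ℕ) (s e : ℕ) : Prop :=
  ∃ a b x x', IsLeast K a ∧ IsGreatest K b ∧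
    IsLeast (ρ.pos '' ρ.anchorsIn P K) x ∧ IsGreatest (ρ.pos '' ρ.anchorsIn P K) x' ∧
    IsGreatest {t | t ≤ a ∧ ρ.pos t = x} s ∧
    IsLeast {t | b ≤ t ∧ t ≤ ρ.len ∧ ρ.pos t = x'} e

/-- The factor from `s` to `e` is the block generated by some non-singleton equivalence class. -/
def IsInversionBlock (P : ℕ × ℕ → ℕ → List Γ → Prop) (s e : ℕ) : Prop :=
  ∃ K, ρ.IsInversionClass P K ∧ ρ.IsBlockOf P K s e

/-- The factor from `s` to `e` does not overlap any block generated by an equivalence class, where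
two factors overlap if they share a location and neither ends where the other one starts. -/
def AvoidsInversionBlocks (P : ℕ × ℕ → ℕ → List Γ → Prop) (s e : ℕ) : Prop :=
  ∀ s' e', ρ.IsInversionBlock P s' e' →
    ¬ ((Set.Icc s e ∩ Set.Icc s' e').Nonempty ∧ e ≠ s' ∧ s ≠ e')

/-! ### Diagonals, blocks and decompositions -/

/-- `s` and `e` delimit a factor of the run whose last location is not to the left of its first
location. -/
def IsForwardFactor (s e : ℕ) : Prop :=
  s ≤ e ∧ e ≤ ρ.len ∧ ρ.pos s ≤ ρ.pos e

/-- A floor: a rightward factor that lies entirely on one even level. -/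
def IsFloor (s e : ℕ) : Prop :=
  ρ.IsForwardFactor s e ∧ Even (ρ.level s) ∧ ∀ t, s ≤ t → t ≤ e → ρ.level t = ρ.level s

/-- `B`-diagonals (sweeping case), delimited by `ℓ 0 ≤ ℓ 1 ≤ … ≤ ℓ (2n + 1)`. -/
def IsSweepingDiagonal [Fintype Q] (B s e : ℕ) : Prop :=
  ρ.IsForwardFactor s e ∧
    ∃ (n : ℕ) (ℓ : ℕ → ℕ), ℓ 0 = s ∧ ℓ (2 * n + 1) = e ∧
      (∀ i < 2 * n + 1, ℓ i ≤ ℓ (i + 1)) ∧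
      (∀ i < n, ρ.IsFloor (ℓ (2 * i + 1)) (ℓ (2 * i + 2))) ∧
      ∀ i ≤ n, (ρ.factorOut (ℓ (2 * i)) (ℓ (2 * i + 1))).length ≤ 2 * T.hmax * B ∧
        ρ.pos (ℓ (2 * i)) ≤ ρ.pos (ℓ (2 * i + 1))

/-- `B`-blocks (sweeping case). -/
def IsSweepingBlock [Fintype Q] (B s e : ℕ) : Prop :=
  ρ.IsForwardFactor s e ∧ AlmostPeriodic (2 * B) (ρ.factorOut s e) ∧
    (ρ.outOn ((Finset.Icc s e).filter fun t =>
      ¬ ((ρ.pos s ≤ ρ.pos t ∧ ρ.pos t ≤ ρ.pos e) ∧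
        (ρ.level s ≤ ρ.level t ∧ ρ.level t ≤ ρ.level e)))).length ≤ 2 * T.hmax * B

/-- `B`-diagonals (two-way case). -/
def IsTwoWayDiagonal (B s e : ℕ) : Prop :=
  ρ.IsForwardFactor s e ∧
    ∀ z, ρ.pos s ≤ z → z ≤ ρ.pos e → ∃ t, s ≤ t ∧ t ≤ e ∧ ρ.pos t = z ∧
      (ρ.outOn ((Finset.Icc t e).filter fun r => ρ.pos r ≤ z)).length ≤ B ∧
      (ρ.outOn ((Finset.Icc s t).filter fun r => z ≤ ρ.pos r)).length ≤ B

/-- `B`-blocks (two-way case). -/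
def IsTwoWayBlock (B s e : ℕ) : Prop :=
  ρ.IsForwardFactor s e ∧ AlmostPeriodic B (ρ.factorOut s e) ∧
    (ρ.outOn ((Finset.Icc s e).filter fun r => ρ.pos r ≤ ρ.pos s)).length ≤ B ∧
    (ρ.outOn ((Finset.Icc s e).filter fun r => ρ.pos e ≤ ρ.pos r)).length ≤ B

/-- The times `τ 0 < τ 1 < … < τ k` factorize the whole run into diagonals and blocks. -/
def IsDecomposition (Diag Block : ℕ → ℕ → Prop) (k : ℕ) (τ : ℕ → ℕ) : Prop :=
  τ 0 = 0 ∧ τ k = ρ.len ∧ (∀ i < k, τ i < τ (i + 1)) ∧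
    ∀ i < k, Diag (τ i) (τ (i + 1)) ∨ Block (τ i) (τ (i + 1))

end Run

/-- A transducer is sweeping if its successful runs perform reversals only at the borders of the
input word. -/
def IsSweeping (T : TwoWayTransducer Q A Γ) : Prop :=
  ∀ u, T.IsInput u → ∀ ρ : T.Run u, ρ.IsSuccessful → ρ.ReversesOnlyAtBorders

end TwoWayTransducer

/-! Normalized runs with property P2 decompose into diagonals and blocks. -/

/-! P2 speaks of single inversions; the work consists in globalizing it. Repeating the output of a
trace periodically turns an anchor point into a bi-infinite word aligned with the output of the run
(`aligned`). By P2, both anchor points of an inversion give the same word, this word has a period at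
most `B`, and the output between them is a piece of it. If two inversions overlap in time, comparing
positions shows that pairing the first anchor of one with the second anchor of the other gives a
third inversion, so the words of overlapping inversions agree and no Fine-Wilf argument is needed.
Hence the output over a whole class has a period at most `B` (`IsInversionClass.hasPeriod`).

The geometry of blocks comes from the same kind of argument. An anchor point before a class but to
the right of its leftmost anchor would form an inversion with the latter, and would thus belong to
the class. So anchor points outside a class lie on the expected side of its block
(`IsBlockOf.data`), blocks of different classes are ordered consistently in time and in position,
and cutting the run at their ends leaves gaps that contain no inversion (`exists_isDecomposition`).

The rest is quantitative: a large output in a region forces an anchor point there. For two-way runs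
this is `exists_twoWayAnchor_of_outOn`. Many positions contribute output, and a Ramsey theorem for
finite monoids (`exists_homogeneous`) selects four of them with equal crossing sequences whose
visits are interleaved in the same way for all pairs. The flow between any two of them is a disjoint
union of cycles and therefore idempotent, and output in the three consecutive intervals leaves room
for an anchor point in between. For sweeping runs the pigeonhole principle on crossing sequences
suffices (`ReversesOnlyAtBorders.sum_output_le`).

Excessive output at the wrong place of a block then produces an anchor point where none can be, and
excessive output in a gap produces an inversion. -/

namespace TwoWayTransducer

namespace Run

variable {Q A Γ : Type*} {T : TwoWayTransducer Q A Γ} {u : List A} (ρ : T.Run u)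

/-! ### Basic facts about runs -/

/-- Every transition moves the head by one; the position reached is the larger of the two. -/
theorem step {t : ℕ} (ht : t < ρ.len) :
    ((ρ.rule t).dir = HeadDir.right ∧ ρ.head (t + 1) = ρ.head t + 1 ∧
        ρ.pos (t + 1) = ρ.head t + 1) ∨
      ((ρ.rule t).dir = HeadDir.left ∧ ρ.head t = ρ.head (t + 1) + 1 ∧
        ρ.pos (t + 1) = ρ.head t) := by
  have h := (ρ.valid t ht).2.2.2.2
  cases hd : (ρ.rule t).dir with
  | left =>
    right
    simp only [hd] at h
    refine ⟨rfl, h, ?_⟩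
    simp only [pos, hd]; omega
  | right =>
    left
    simp only [hd] at h
    refine ⟨rfl, h, ?_⟩
    simp only [pos, hd]; omega

theorem head_lt {t : ℕ} (ht : t < ρ.len) : ρ.head t < u.length := by
  have h := (ρ.valid t ht).2.2.2.1
  exact (List.getElem?_eq_some_iff.1 h).1

theorem capacity_le {t : ℕ} (ht : t < ρ.len) : (ρ.rule t).output.length ≤ T.capacity :=
  Finset.le_sup (f := fun r : TransitionRule Q A Γ => r.output.length) (ρ.valid t ht).1

theorem pos_eq_or {t : ℕ} (ht : t ≤ ρ.len) :
    ρ.pos t = ρ.head t ∨ ρ.pos t = ρ.head t + 1 := by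
  cases t with
  | zero => left; rfl
  | succ t => have := ρ.step (t := t) (by omega); omega

theorem pos_step {t : ℕ} (ht : t < ρ.len) :
    ρ.pos (t + 1) = ρ.pos t ∨ ρ.pos (t + 1) = ρ.pos t + 1 ∨ ρ.pos t = ρ.pos (t + 1) + 1 := by
  have h1 := ρ.step ht
  have h2 := ρ.pos_eq_or ht.le
  omega

theorem pos_le (hs : ρ.IsSuccessful) {t : ℕ} (ht : t ≤ ρ.len) : ρ.pos t ≤ u.length := by
  cases t with
  | zero => have : ρ.pos 0 = ρ.head 0 := rfl
            have := hs.1; omega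
  | succ t => have := ρ.step (t := t) (by omega)
              have := ρ.head_lt (t := t) (by omega); omega

theorem pos_zero (hs : ρ.IsSuccessful) : ρ.pos 0 = 0 := hs.1

theorem pos_len (hs : ρ.IsSuccessful) : ρ.pos ρ.len = u.length := by
  have h1 := ρ.pos_eq_or le_rfl
  have h2 := ρ.pos_le hs le_rfl
  have := hs.2.2.1
  omega

theorem exists_pos_eq_up {s t x : ℕ} (hst : s ≤ t) (ht : t ≤ ρ.len)
    (h1 : ρ.pos s ≤ x) (h2 : x ≤ ρ.pos t) : ∃ r, s ≤ r ∧ r ≤ t ∧ ρ.pos r = x := by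
  induction t, hst using Nat.le_induction with
  | base => exact ⟨s, le_rfl, le_rfl, by omega⟩
  | succ t hst ih =>
    by_cases h : x ≤ ρ.pos t
    · obtain ⟨r, hr⟩ := ih (by omega) h
      exact ⟨r, hr.1, by omega, hr.2.2⟩
    · have := ρ.pos_step (t := t) (by omega)
      exact ⟨t + 1, by omega, le_rfl, by omega⟩

theorem exists_pos_eq_down {s t x : ℕ} (hst : s ≤ t) (ht : t ≤ ρ.len)
    (h1 : x ≤ ρ.pos s) (h2 : ρ.pos t ≤ x) : ∃ r, s ≤ r ∧ r ≤ t ∧ ρ.pos r = x := by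
  induction t, hst using Nat.le_induction with
  | base => exact ⟨s, le_rfl, le_rfl, by omega⟩
  | succ t hst ih =>
    by_cases h : ρ.pos t ≤ x
    · obtain ⟨r, hr⟩ := ih (by omega) h
      exact ⟨r, hr.1, by omega, hr.2.2⟩
    · have := ρ.pos_step (t := t) (by omega)
      exact ⟨t + 1, by omega, le_rfl, by omega⟩

/-! ### Visits and levels -/

/-- The number of visits of the position `x` before time `t`. -/
def visits (t x : ℕ) : ℕ := ((Finset.range t).filter fun s => ρ.pos s = x).card

theorem level_eq_visits (t : ℕ) : ρ.level t = ρ.visits t (ρ.pos t) := rfl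

theorem visits_succ (t x : ℕ) :
    ρ.visits (t + 1) x = ρ.visits t x + if ρ.pos t = x then 1 else 0 := by
  unfold visits
  rw [Finset.range_add_one, Finset.filter_insert]
  split_ifs <;> simp

theorem visits_succ_pos (t : ℕ) : ρ.visits (t + 1) (ρ.pos t) = ρ.level t + 1 := by
  rw [visits_succ, if_pos rfl, level_eq_visits]

theorem visits_mono {s t : ℕ} (h : s ≤ t) (x : ℕ) : ρ.visits s x ≤ ρ.visits t x := by
  apply Finset.card_le_card
  apply Finset.filter_subset_filter
  exact Finset.range_mono h

theorem level_lt {s t : ℕ} (hst : s < t) (h : ρ.pos s = ρ.pos t) : ρ.level s < ρ.level t := by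
  have h1 := ρ.visits_mono (Nat.succ_le_of_lt hst) (ρ.pos s)
  have h2 := ρ.visits_succ_pos s
  have h3 := ρ.level_eq_visits t
  rw [← h] at h3
  simp only [Nat.succ_eq_add_one] at h1
  omega

theorem level_le {s t : ℕ} (hst : s ≤ t) (h : ρ.pos s = ρ.pos t) : ρ.level s ≤ ρ.level t := by
  rcases hst.eq_or_lt with rfl | h'
  · exact le_rfl
  · exact (ρ.level_lt h' h).le

theorem eq_of_level_eq {s t : ℕ} (h : ρ.pos s = ρ.pos t) (h' : ρ.level s = ρ.level t) :
    s = t := by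
  rcases lt_trichotomy s t with h1 | h1 | h1
  · have := ρ.level_lt h1 h; omega
  · exact h1
  · have := ρ.level_lt h1 h.symm; omega

theorem exists_visit {t x y : ℕ} (h : y < ρ.visits t x) :
    ∃ s < t, ρ.pos s = x ∧ ρ.level s = y := by
  induction t with
  | zero => simp [visits] at h
  | succ t ih =>
    by_cases h' : y < ρ.visits t x
    · obtain ⟨s, hs, h1⟩ := ih h'
      exact ⟨s, by omega, h1⟩
    · rw [visits_succ] at h
      split_ifs at h with hx
      · refine ⟨t, by omega, hx, ?_⟩
        rw [level_eq_visits, hx]; omega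
      · omega

theorem level_lt_visits {s t : ℕ} (h : s < t) : ρ.level s < ρ.visits t (ρ.pos s) := by
  have := ρ.visits_mono (Nat.succ_le_of_lt h) (ρ.pos s)
  have := ρ.visits_succ_pos s
  simp only [Nat.succ_eq_add_one] at *
  omega

/-- A cut has been visited an odd number of times if and only if it is not to the right of the
head. -/
theorem odd_visits_iff (h0 : ρ.head 0 = 0) {t : ℕ} (ht : t ≤ ρ.len) (x : ℕ) :
    Odd (ρ.visits (t + 1) x) ↔ x ≤ ρ.head t := by
  induction t with
  | zero =>
    rw [visits_succ]
    have : ρ.pos 0 = ρ.head 0 := rfl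
    have h : ρ.visits 0 x = 0 := by simp [visits]
    rw [h, this, h0]
    split_ifs with hx
    · simp [← hx]
    · simp only [add_zero, Nat.not_odd_zero, false_iff]; omega
  | succ t ih =>
    have ih := ih (by omega)
    have h1 := ρ.step (t := t) (by omega)
    rw [visits_succ]
    split_ifs with hx
    · rw [Nat.odd_add_one, ih]
      omega
    · rw [add_zero, ih]; omega

/-- Counting the current visit, the position has been visited `level t + 1` times, so
`odd_visits_iff` decides the parity. Even levels are thus those where the cut was crossed
rightwards. -/
theorem even_level_iff (h0 : ρ.head 0 = 0) {t : ℕ} (ht : t ≤ ρ.len) :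
    Even (ρ.level t) ↔ ρ.head t = ρ.pos t := by
  have h1 := ρ.odd_visits_iff h0 ht (ρ.pos t)
  rw [visits_succ_pos, Nat.odd_add_one, Nat.not_odd_iff_even] at h1
  rw [h1]
  have := ρ.pos_eq_or ht
  omega

theorem odd_level_iff (h0 : ρ.head 0 = 0) {t : ℕ} (ht : t ≤ ρ.len) :
    Odd (ρ.level t) ↔ ρ.pos t = ρ.head t + 1 := by
  rw [← Nat.not_even_iff_odd, ρ.even_level_iff h0 ht]
  have := ρ.pos_eq_or ht
  omega

/-- The total number of visits of a position. -/
def width (x : ℕ) : ℕ := ρ.visits (ρ.len + 1) x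

theorem odd_width (hs : ρ.IsSuccessful) {x : ℕ} (hx : x ≤ u.length) : Odd (ρ.width x) := by
  rw [width, ρ.odd_visits_iff hs.1 le_rfl, hs.2.2.1]
  exact hx

theorem level_lt_width {t : ℕ} (ht : t ≤ ρ.len) : ρ.level t < ρ.width (ρ.pos t) :=
  ρ.level_lt_visits (by omega)

theorem length_crossing (x : ℕ) : (ρ.crossing x).length = ρ.width x := by
  rw [crossing, List.length_map, width, visits]
  rw [Finset.card_def, Finset.filter_val, Finset.range_val, Multiset.range,
    Multiset.filter_coe, Multiset.coe_card]

theorem crossing_getElem {t : ℕ} (ht : t ≤ ρ.len) :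
    (ρ.crossing (ρ.pos t))[ρ.level t]? = some (ρ.state t) := by
  have h : List.range (ρ.len + 1) = List.range t ++ t :: List.range' (t + 1) (ρ.len - t) := by
    rw [List.range_eq_range', List.range_eq_range', ← List.range'_succ]
    have := List.range'_append_1 (s := 0) (m := t) (n := ρ.len - t + 1)
    rw [Nat.zero_add] at this
    rw [this]; congr 1; omega
  have hl : ρ.level t = ((List.range t).filter fun s => ρ.pos s = ρ.pos t).length := by
    rw [level, Finset.card_def, Finset.filter_val, Finset.range_val, Multiset.range,
      Multiset.filter_coe, Multiset.coe_card]
  rw [crossing, h, List.filter_append, List.filter_cons_of_pos (by simp), List.map_append,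
    List.map_cons, hl]
  rw [List.getElem?_append_right (by simp)]
  simp

/-- The levels of the visits of a position are mapped injectively to states, on each parity. -/
theorem width_le [Fintype Q] (hs : ρ.IsSuccessful) (hn : ρ.IsNormalized) {x : ℕ}
    (hx : x ≤ u.length) : ρ.width x ≤ 2 * Fintype.card Q - 1 := by
  classical
  obtain ⟨m, hm⟩ := ρ.odd_width hs hx
  -- The width is `2 * m + 1`, so there are `m + 1` even levels. Normalization makes their states
  -- distinct, whence `m + 1 ≤ |Q|`.
  have hex : ∀ i : Fin (m + 1), ∃ t, t ≤ ρ.len ∧ ρ.pos t = x ∧ ρ.level t = 2 * i := by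
    intro i
    obtain ⟨t, h1, h2, h3⟩ := ρ.exists_visit (t := ρ.len + 1) (x := x) (y := 2 * i)
      (by change _ < ρ.width x; omega)
    exact ⟨t, by omega, h2, h3⟩
  choose f hf1 hf2 hf3 using hex
  have hinj : Function.Injective fun i => ρ.state (f i) := by
    intro i j hij
    by_contra hne
    have hne' : f i ≠ f j := by
      intro h
      apply hne
      have := hf3 i
      rw [h, hf3 j] at this
      exact Fin.ext (by omega)
    have key : ∀ i j, f i < f j → ρ.state (f i) = ρ.state (f j) → False := by
      intro i j hlt he
      have := hn (f i) (f j) hlt (hf1 j) (by rw [hf2, hf2]) he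
      rw [hf3, hf3] at this
      omega
    rcases lt_or_gt_of_ne hne' with h | h
    · exact key i j h hij
    · exact key j i h hij.symm
  have := Fintype.card_le_of_injective _ hinj
  simp only [Fintype.card_fin] at this
  omega

/-- A letter is read at most `2|Q| - 1` times. -/
theorem card_readings_le [Fintype Q] (hs : ρ.IsSuccessful) (hn : ρ.IsNormalized) (x : ℕ) :
    ((Finset.range ρ.len).filter fun t => ρ.head t = x).card ≤ T.hmax := by
  classical
  by_cases hx : x < u.length
  swap
  · rw [Finset.card_eq_zero.2]
    · omega
    · rw [Finset.filter_eq_empty_iff]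
      intro t ht h
      have := ρ.head_lt (Finset.mem_range.1 ht)
      omega
  obtain ⟨a, ha⟩ := ρ.odd_width hs (x := x) hx.le
  obtain ⟨b, hb⟩ := ρ.odd_width hs (x := x + 1) hx
  have h1 := ρ.width_le hs hn (x := x) hx.le
  have h2 := ρ.width_le hs hn (x := x + 1) hx
  -- The letter is read either from cut `x` on an even level (`a + 1` of them) or from cut `x + 1`
  -- on an odd level (`b` of them). Counting both cuts by parity gives `a + 1 + b` instead of the
  -- sum of the two widths.
  have hsub : ((Finset.range ρ.len).filter fun t => ρ.head t = x).card ≤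
      ((Finset.range (a + 1)).disjSum (Finset.range b)).card := by
    refine Finset.card_le_card_of_injOn
      (fun t => if ρ.pos t = x then Sum.inl (ρ.level t / 2) else Sum.inr (ρ.level t / 2)) ?_ ?_
    · intro t ht
      simp only [Finset.mem_coe, Finset.mem_filter, Finset.mem_range] at ht
      have h3 := ρ.level_lt_width (t := t) (by omega)
      dsimp only
      split_ifs with hp
      · rw [hp] at h3
        simp only [Finset.mem_coe, Finset.inl_mem_disjSum, Finset.mem_range]; omega
      · have h4 := ρ.pos_eq_or (t := t) (by omega)
        have h5 : ρ.pos t = x + 1 := by omega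
        rw [h5] at h3
        have h6 := (ρ.odd_level_iff hs.1 (t := t) (by omega)).2 (by omega)
        obtain ⟨c, hc⟩ := h6
        simp only [Finset.mem_coe, Finset.inr_mem_disjSum, Finset.mem_range]; omega
    · intro s hs' t ht h
      simp only [Finset.mem_coe, Finset.mem_filter, Finset.mem_range] at hs' ht
      have h3 := ρ.pos_eq_or (t := t) (by omega)
      have h4 := ρ.pos_eq_or (t := s) (by omega)
      dsimp only at h
      split_ifs at h with hp hq hq
      · have e1 := (ρ.even_level_iff hs.1 (t := s) (by omega)).2 (by omega)
        have e2 := (ρ.even_level_iff hs.1 (t := t) (by omega)).2 (by omega)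
        obtain ⟨c, hc⟩ := e1
        obtain ⟨d, hd⟩ := e2
        have := Sum.inl.inj h
        exact ρ.eq_of_level_eq (by omega) (by omega)
      · have e1 := (ρ.odd_level_iff hs.1 (t := s) (by omega)).2 (by omega)
        have e2 := (ρ.odd_level_iff hs.1 (t := t) (by omega)).2 (by omega)
        obtain ⟨c, hc⟩ := e1
        obtain ⟨d, hd⟩ := e2
        have := Sum.inr.inj h
        exact ρ.eq_of_level_eq (by omega) (by omega)
  rw [Finset.card_disjSum, Finset.card_range, Finset.card_range] at hsub
  unfold hmax
  omega

/-! ### Outputs -/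

theorem factorOut_append {s m e : ℕ} (h1 : s ≤ m) (h2 : m ≤ e) :
    ρ.factorOut s e = ρ.factorOut s m ++ ρ.factorOut m e := by
  unfold factorOut
  rw [← List.flatMap_append]
  congr 1
  have : m = s + (m - s) := by omega
  conv_rhs => rw [this]
  rw [Nat.add_sub_cancel_left, List.range'_append_1]
  congr 1; omega

theorem factorOut_succ (s : ℕ) : ρ.factorOut s (s + 1) = (ρ.rule s).output := by
  simp [factorOut]

theorem length_factorOut (s e : ℕ) :
    (ρ.factorOut s e).length = ∑ t ∈ Finset.Ico s e, (ρ.rule t).output.length := by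
  rw [factorOut, List.length_flatMap, Finset.sum_eq_multiset_sum]
  rfl

theorem length_outOn (Z : Finset ℕ) :
    (ρ.outOn Z).length = ∑ t ∈ (Finset.range ρ.len).filter (fun t => t ∈ Z ∧ t + 1 ∈ Z),
      (ρ.rule t).output.length := by
  rw [outOn, List.length_flatMap, Finset.sum_eq_multiset_sum, Finset.filter_val, Finset.range_val,
    Multiset.range, Multiset.filter_coe, Multiset.map_coe, Multiset.sum_coe]

theorem output_mem_factorOut_ne_nil {s e t : ℕ} (h1 : s ≤ t) (h2 : t < e)
    (h : (ρ.rule t).output ≠ []) : ρ.factorOut s e ≠ [] := by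
  rw [ρ.factorOut_append h1 (by omega : t ≤ e), ρ.factorOut_append (by omega : t ≤ t + 1) h2,
    factorOut_succ]
  simp [h]

/-- A set of transitions with more than `N` units of output, with at most `c` of them for each
transition, contains many transitions with nonempty output. -/
theorem sum_output_le {X : Finset ℕ} {N : ℕ} (hX : ∀ t ∈ X, t < ρ.len)
    (h : (X.filter fun t => (ρ.rule t).output ≠ []).card ≤ N) :
    ∑ t ∈ X, (ρ.rule t).output.length ≤ T.capacity * N := by
  classical
  rw [← Finset.sum_filter_add_sum_filter_not X fun t => (ρ.rule t).output ≠ []]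
  have h1 : ∑ t ∈ X.filter (fun t => ¬ (ρ.rule t).output ≠ []), (ρ.rule t).output.length = 0 := by
    apply Finset.sum_eq_zero
    intro t ht
    simp only [Finset.mem_filter, not_not] at ht
    simp [ht.2]
  rw [h1, add_zero]
  calc _ ≤ (X.filter fun t => (ρ.rule t).output ≠ []).card • T.capacity := by
        apply Finset.sum_le_card_nsmul
        intro t ht
        exact ρ.capacity_le (hX t (Finset.mem_filter.1 ht).1)
    _ ≤ T.capacity * N := by
        rw [smul_eq_mul, mul_comm]
        exact Nat.mul_le_mul_left _ h

end Run

end TwoWayTransducer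

/-! ### Periodic words -/

/-- The bi-infinite word obtained by repeating `w`, an occurrence of `w` starting at index `o`. -/
def periodicExtension {Γ : Type*} (w : List Γ) (o i : ℤ) : Option Γ :=
  w[((i - o) % w.length).toNat]?

theorem HasPeriod.getElem?_mod {Γ : Type*} {w : List Γ} {p : ℕ} (h : HasPeriod w p) {i : ℕ}
    (hi : i < w.length) : w[i]? = w[i % p]? := by
  induction i using Nat.strong_induction_on with
  | _ i ih =>
    by_cases hip : i < p
    · rw [Nat.mod_eq_of_lt hip]
    · have hp := h.1
      have h1 := h.2 (i - p) (by omega)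
      rw [Nat.sub_add_cancel (by omega)] at h1
      rw [← h1, ih (i - p) (by omega) (by omega), ← Nat.mod_eq_sub_mod (by omega)]

/-- As `p` divides the lengths of `w₁` and `w₂`, repeating either word continues the `p`-periodic
pattern of the whole word; the phases match because `f` starts at a multiple of `p`. Both traces and
the word between them thus determine one bi-infinite word, in which `f` occurs at index `o`. -/
theorem HasPeriod.of_periodicExtension {Γ : Type*} {w₁ f w₂ : List Γ} {p : ℕ}
    (h : HasPeriod (w₁ ++ f ++ w₂) p) (h1 : p ∣ w₁.length) (h2 : p ∣ w₂.length)
    (hw₁ : w₁ ≠ []) (hw₂ : w₂ ≠ []) (o : ℤ) :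
    (∀ i, periodicExtension w₁ o i = (w₁ ++ f ++ w₂)[((i - o) % p).toNat]?) ∧
      (∀ i, periodicExtension w₂ (o + f.length) i = (w₁ ++ f ++ w₂)[((i - o) % p).toNat]?) ∧
      ∀ j < f.length, f[j]? = periodicExtension w₁ o (o + j) := by
  have hl₁ := List.length_pos_iff.2 hw₁
  have hl₂ := List.length_pos_iff.2 hw₂
  have hp := h.1
  have hA : ∀ i, periodicExtension w₁ o i = (w₁ ++ f ++ w₂)[((i - o) % p).toNat]? := by
    intro i
    have hk := Int.emod_nonneg (i - o) (b := w₁.length) (by omega)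
    have hk' := Int.emod_lt_of_pos (i - o) (b := w₁.length) (by omega)
    unfold periodicExtension
    rw [← List.getElem?_append_left (l₂ := f ++ w₂) (by omega), ← List.append_assoc,
      h.getElem?_mod (by simp only [List.length_append]; omega)]
    congr 1
    zify
    rw [Int.toNat_of_nonneg hk, Int.toNat_of_nonneg (Int.emod_nonneg _ (by omega)),
      Int.emod_emod_of_dvd _ (by exact_mod_cast h1)]
  refine ⟨hA, ?_, ?_⟩
  · intro i
    have hk := Int.emod_nonneg (i - (o + f.length)) (b := w₂.length) (by omega)
    have hk' := Int.emod_lt_of_pos (i - (o + f.length)) (b := w₂.length) (by omega)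
    unfold periodicExtension
    have h3 : w₂[((i - (o + f.length)) % w₂.length).toNat]? =
        (w₁ ++ f ++ w₂)[(w₁ ++ f).length + ((i - (o + f.length)) % w₂.length).toNat]? := by
      rw [List.getElem?_append_right (by omega)]
      congr 1; omega
    rw [h3, h.getElem?_mod (by simp only [List.length_append]; omega)]
    congr 1
    zify
    rw [Int.toNat_of_nonneg hk, Int.toNat_of_nonneg (Int.emod_nonneg _ (by omega))]
    rw [List.length_append]
    have h4 : (i - (o + f.length)) % w₂.length % p = (i - (o + f.length)) % p :=
      Int.emod_emod_of_dvd _ (by exact_mod_cast h2)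
    obtain ⟨c, hc⟩ := h1
    rw [Int.add_emod, h4, ← Int.add_emod, hc]
    push_cast
    have : (p : ℤ) * c + f.length + (i - (o + f.length)) = (i - o) + p * c := by ring
    rw [this, Int.add_mul_emod_self_left]
  · intro j hj
    rw [hA]
    have h3 : f[j]? = (w₁ ++ f ++ w₂)[w₁.length + j]? := by
      rw [List.append_assoc, List.getElem?_append_right (by omega),
        List.getElem?_append_left (by omega)]
      congr 1; omega
    rw [h3, h.getElem?_mod (by simp only [List.length_append]; omega)]
    congr 1
    zify
    rw [Int.toNat_of_nonneg (Int.emod_nonneg _ (by omega))]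
    obtain ⟨c, hc⟩ := h1
    rw [hc]
    push_cast
    rw [add_sub_cancel_left, add_comm, Int.add_mul_emod_self_left]

/-- A predicate on natural numbers cuts an interval whose endpoints satisfy it into
subintervals. -/
theorem exists_enumeration (p : ℕ → Prop) (h0 : p 0) (n : ℕ) (hn : p n) :
    ∃ (k : ℕ) (τ : ℕ → ℕ), τ 0 = 0 ∧ τ k = n ∧
      (∀ i < k, τ i < τ (i + 1) ∧ p (τ i) ∧ p (τ (i + 1)) ∧
        ∀ c, τ i < c → c < τ (i + 1) → ¬ p c) ∧
      ∀ c ≤ n, p c → ∃ i ≤ k, τ i = c := by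
  classical
  induction n using Nat.strong_induction_on with
  | _ n ih =>
    rcases Nat.eq_zero_or_pos n with rfl | hpos
    · refine ⟨0, fun _ => 0, rfl, rfl, by simp, ?_⟩
      intro c hc _
      exact ⟨0, le_rfl, (Nat.le_zero.1 hc).symm⟩
    · have hm := Nat.findGreatest_spec (P := p) (Nat.zero_le (n - 1)) h0
      have hm' := Nat.findGreatest_le (P := p) (n - 1)
      have hm'' : ∀ c, Nat.findGreatest p (n - 1) < c → c ≤ n - 1 → ¬ p c :=
        fun c h h' => Nat.findGreatest_is_greatest h h'
      generalize Nat.findGreatest p (n - 1) = m at hm hm' hm''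
      obtain ⟨k, τ, h1, h2, h3, h4⟩ := ih m (by omega) hm
      refine ⟨k + 1, fun i => if i ≤ k then τ i else n, by simp [h1], by simp, ?_, ?_⟩
      · intro i hi
        rcases Nat.lt_succ_iff_lt_or_eq.1 hi with hi' | rfl
        · have := h3 i hi'
          simp only [hi'.le, if_true, Nat.succ_le_of_lt hi']
          exact this
        · simp only [le_refl, if_true, Nat.not_succ_le_self, if_false, h2]
          exact ⟨by omega, hm, hn, fun c hc hc' => hm'' c hc (by omega)⟩
      · intro c hc hpc
        rcases hc.eq_or_lt with rfl | hc'
        · exact ⟨k + 1, le_rfl, by simp⟩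
        · obtain ⟨i, hi, h5⟩ := h4 c (by by_contra h; exact hm'' c (by omega) (by omega) hpc) hpc
          exact ⟨i, by omega, by simp [hi, h5]⟩

namespace TwoWayTransducer

namespace Run

variable {Q A Γ : Type*} {T : TwoWayTransducer Q A Γ} {u : List A} {ρ : T.Run u}
  {P : ℕ × ℕ → ℕ → List Γ → Prop} {B : ℕ}

/-! ### Inversions and their classes -/

/-- The anchors described by `P` are locations of the run, and they have nonempty traces. -/
def ProperAnchors (ρ : T.Run u) (P : ℕ × ℕ → ℕ → List Γ → Prop) : Prop :=
  ∀ L t w, P L t w → t ≤ ρ.len ∧ w ≠ []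

theorem getElem?_factorOut (ρ : T.Run u) {s e : ℕ} (h : s ≤ e) (i : ℕ) :
    (ρ.factorOut 0 e)[(ρ.factorOut 0 s).length + i]? = (ρ.factorOut s e)[i]? := by
  rw [ρ.factorOut_append (Nat.zero_le s) h, List.getElem?_append_right (by omega)]
  congr 1; omega

/-- The bi-infinite repetition of the output `w` of a trace at an anchor point, aligned with the
output of the run. -/
def aligned (ρ : T.Run u) (t : ℕ) (w : List Γ) (i : ℤ) : Option Γ :=
  periodicExtension w (ρ.factorOut 0 t).length i

/-- This is P2 in a form that no longer ties the words to a particular `p`: words of different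
inversions can be compared even if their periods differ. -/
theorem IsInversion.aligned_eq {L₁ L₂ : ℕ × ℕ} {t₁ t₂ : ℕ} {w₁ w₂ : List Γ}
    (hP : ρ.ProperAnchors P) (h2 : ρ.SatisfiesP2 P B)
    (hI : ρ.IsInversion P L₁ t₁ w₁ L₂ t₂ w₂) :
    ρ.aligned t₁ w₁ = ρ.aligned t₂ w₂ ∧
      (∃ p ≤ B, 0 < p ∧ ∀ i, ρ.aligned t₁ w₁ (i + p) = ρ.aligned t₁ w₁ i) ∧
      ∀ i, (ρ.factorOut 0 t₁).length ≤ i → i < (ρ.factorOut 0 t₂).length →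
        (ρ.factorOut 0 t₂)[i]? = ρ.aligned t₁ w₁ i := by
  obtain ⟨p, hpB, hp1, hp2, hp⟩ := h2 _ _ _ _ _ _ hI
  obtain ⟨hA1, hA2, hlt, -⟩ := hI
  have key := hp.of_periodicExtension hp1 hp2 (hP _ _ _ hA1).2 (hP _ _ _ hA2).2
    (ρ.factorOut 0 t₁).length
  have hlen : (ρ.factorOut 0 t₂).length =
      (ρ.factorOut 0 t₁).length + (ρ.factorOut t₁ t₂).length := by
    rw [ρ.factorOut_append (Nat.zero_le t₁) hlt.le, List.length_append]
  refine ⟨?_, ⟨p, hpB, hp.1, ?_⟩, ?_⟩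
  · funext i
    have h3 := key.2.1 i
    unfold aligned
    rw [key.1, hlen, ← h3]
    push_cast; rfl
  · intro i
    unfold aligned
    rw [key.1, key.1]
    have : i + (p : ℤ) - ((ρ.factorOut 0 t₁).length : ℤ) =
        i - (ρ.factorOut 0 t₁).length + p * 1 := by ring
    rw [this, Int.add_mul_emod_self_left]
  · intro i h3 h4
    obtain ⟨j, rfl⟩ := Nat.exists_eq_add_of_le h3
    rw [getElem?_factorOut ρ hlt.le, key.2.2 j (by omega)]
    unfold aligned
    push_cast; rfl

/-- If `t₄` is not to the left of `t₁`, then `pos t₂ < pos t₁ ≤ pos t₄ < pos t₃`. So one of the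
mixed pairs `(t₁, t₄)`, `(t₃, t₂)` is an inversion, and it links the two given ones. -/
theorem IsInversion.aligned_eq_of_overlap {L₁ L₂ L₃ L₄ : ℕ × ℕ} {t₁ t₂ t₃ t₄ : ℕ}
    {w₁ w₂ w₃ w₄ : List Γ} (hP : ρ.ProperAnchors P) (h2 : ρ.SatisfiesP2 P B)
    (hI : ρ.IsInversion P L₁ t₁ w₁ L₂ t₂ w₂) (hJ : ρ.IsInversion P L₃ t₃ w₃ L₄ t₄ w₄)
    (h14 : t₁ ≤ t₄) (h32 : t₃ ≤ t₂) : ρ.aligned t₁ w₁ = ρ.aligned t₃ w₃ := by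
  by_cases h : ρ.pos t₄ < ρ.pos t₁
  · have hne : t₁ ≠ t₄ := by rintro rfl; omega
    have h1 : ρ.IsInversion P L₁ t₁ w₁ L₄ t₄ w₄ := ⟨hI.1, hJ.2.1, by omega, h⟩
    rw [(h1.aligned_eq hP h2).1, (hJ.aligned_eq hP h2).1]
  · have h3 := hI.2.2.2
    have h4 := hJ.2.2.2
    have hne : t₃ ≠ t₂ := by rintro rfl; omega
    have h1 : ρ.IsInversion P L₃ t₃ w₃ L₂ t₂ w₂ := ⟨hJ.1, hI.2.1, by omega, by omega⟩
    rw [(h1.aligned_eq hP h2).1, (hI.aligned_eq hP h2).1]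

theorem InSameInversion.symm {a b : ℕ} (h : ρ.InSameInversion P a b) :
    ρ.InSameInversion P b a := by
  obtain ⟨L₁, t₁, w₁, L₂, t₂, w₂, hI, h1, h2, h3, h4⟩ := h
  exact ⟨L₁, t₁, w₁, L₂, t₂, w₂, hI, h3, h4, h1, h2⟩

theorem reflTransGen_inSameInversion_symm {a b : ℕ}
    (h : Relation.ReflTransGen (ρ.InSameInversion P) a b) :
    Relation.ReflTransGen (ρ.InSameInversion P) b a := by
  induction h with
  | refl => exact Relation.ReflTransGen.refl
  | tail _ h ih => exact Relation.ReflTransGen.head h.symm ih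

theorem IsInversionClass.mem_iff {K : Set ℕ} (hK : ρ.IsInversionClass P K) {c r : ℕ} (hc : c ∈ K) :
    r ∈ K ↔ r ≤ ρ.len ∧ Relation.ReflTransGen (ρ.InSameInversion P) c r := by
  obtain ⟨-, t, ht, rfl⟩ := hK
  constructor
  · rintro ⟨h1, h2⟩
    exact ⟨h1, (reflTransGen_inSameInversion_symm hc.2).trans h2⟩
  · rintro ⟨h1, h2⟩
    exact ⟨h1, hc.2.trans h2⟩

theorem IsInversionClass.le_len {K : Set ℕ} (hK : ρ.IsInversionClass P K) {c : ℕ} (hc : c ∈ K) :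
    c ≤ ρ.len := ((hK.mem_iff hc).1 hc).1

theorem IsInversionClass.mem_of_isInversion {K : Set ℕ} (hK : ρ.IsInversionClass P K)
    (hP : ρ.ProperAnchors P) {L₁ L₂ : ℕ × ℕ}
    {t₁ t₂ : ℕ} {w₁ w₂ : List Γ} (hI : ρ.IsInversion P L₁ t₁ w₁ L₂ t₂ w₂) {c r : ℕ} (hc : c ∈ K)
    (h1 : t₁ ≤ c) (h2 : c ≤ t₂) (h3 : t₁ ≤ r) (h4 : r ≤ t₂) : r ∈ K := by
  rw [hK.mem_iff hc]
  have := (hP _ _ _ hI.2.1).1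
  exact ⟨by omega, Relation.ReflTransGen.single ⟨_, _, _, _, _, _, hI, h1, h2, h3, h4⟩⟩

theorem IsInversionClass.exists_isInversion {K : Set ℕ} (hK : ρ.IsInversionClass P K) {c : ℕ}
    (hc : c ∈ K) :
    ∃ L₁ t₁ w₁ L₂ t₂ w₂, ρ.IsInversion P L₁ t₁ w₁ L₂ t₂ w₂ ∧ t₁ ≤ c ∧ c ≤ t₂ := by
  obtain ⟨d, hd, hne⟩ := hK.1.exists_ne c
  have := ((hK.mem_iff hc).1 hd).2
  rcases Relation.ReflTransGen.cases_head this with h | ⟨d', h, -⟩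
  · exact absurd h.symm hne
  · obtain ⟨L₁, t₁, w₁, L₂, t₂, w₂, hI, h1, h2, -⟩ := h
    exact ⟨L₁, t₁, w₁, L₂, t₂, w₂, hI, h1, h2⟩

theorem IsInversionClass.exists_isLeast {K : Set ℕ} (hK : ρ.IsInversionClass P K) :
    ∃ a, IsLeast K a := by
  classical
  obtain ⟨c, hc⟩ := hK.1.nonempty
  exact ⟨sInf K, Nat.sInf_mem ⟨c, hc⟩, fun d hd => Nat.sInf_le hd⟩

theorem IsInversionClass.exists_isGreatest {K : Set ℕ} (hK : ρ.IsInversionClass P K) :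
    ∃ b, IsGreatest K b := by
  obtain ⟨c, hc⟩ := hK.1.nonempty
  have hb : BddAbove K := ⟨ρ.len, fun d hd => hK.le_len hd⟩
  exact ⟨sSup K, Nat.sSup_mem ⟨c, hc⟩ hb, fun d hd => le_csSup hb hd⟩

/-- The first anchor of an inversion covering `a` belongs to the class as well, so it cannot precede
`a`. -/
theorem IsInversionClass.least_mem_anchorsIn {K : Set ℕ} (hK : ρ.IsInversionClass P K)
    (hP : ρ.ProperAnchors P) {a : ℕ}
    (ha : IsLeast K a) : a ∈ ρ.anchorsIn P K := by
  obtain ⟨L₁, t₁, w₁, L₂, t₂, w₂, hI, h1, h2⟩ := hK.exists_isInversion ha.1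
  have := ha.2 (hK.mem_of_isInversion hP hI ha.1 h1 h2 le_rfl hI.2.2.1.le)
  exact ⟨ha.1, L₁, t₁, w₁, L₂, t₂, w₂, hI, Or.inl (by omega)⟩

theorem IsInversionClass.greatest_mem_anchorsIn {K : Set ℕ} (hK : ρ.IsInversionClass P K)
    (hP : ρ.ProperAnchors P) {b : ℕ}
    (hb : IsGreatest K b) : b ∈ ρ.anchorsIn P K := by
  obtain ⟨L₁, t₁, w₁, L₂, t₂, w₂, hI, h1, h2⟩ := hK.exists_isInversion hb.1
  have := hb.2 (hK.mem_of_isInversion hP hI hb.1 h1 h2 hI.2.2.1.le le_rfl)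
  exact ⟨hb.1, L₁, t₁, w₁, L₂, t₂, w₂, hI, Or.inr (by omega)⟩

theorem IsInversionClass.least_lt_greatest {K : Set ℕ} (hK : ρ.IsInversionClass P K) {a b : ℕ}
    (ha : IsLeast K a) (hb : IsGreatest K b) :
    a < b := by
  obtain ⟨d, hd, hne⟩ := hK.1.exists_ne a
  have := ha.2 hd
  have := hb.2 hd
  omega

/-- Any transition between two locations of a class is covered by an inversion. -/
theorem exists_covering_isInversion {a c t : ℕ} (hac : Relation.ReflTransGen
    (ρ.InSameInversion P) a c) (h1 : a ≤ t) (h2 : t < c) :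
    ∃ L₁ t₁ w₁ L₂ t₂ w₂, ρ.IsInversion P L₁ t₁ w₁ L₂ t₂ w₂ ∧ t₁ ≤ t ∧ t < t₂ ∧
      Relation.ReflTransGen (ρ.InSameInversion P) a t₁ := by
  induction hac with
  | refl => omega
  | @tail c c' hac hstep ih =>
    by_cases h : t < c
    · exact ih h
    · obtain ⟨L₁, t₁, w₁, L₂, t₂, w₂, hI, h3, h4, h5, h6⟩ := hstep
      refine ⟨L₁, t₁, w₁, L₂, t₂, w₂, hI, by omega, by omega, hac.tail ?_⟩
      exact ⟨L₁, t₁, w₁, L₂, t₂, w₂, hI, h3, h4, le_rfl, hI.2.2.1.le⟩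

theorem IsInversionClass.mem_of_le_of_le {K : Set ℕ} (hK : ρ.IsInversionClass P K)
    (hP : ρ.ProperAnchors P) {a b t : ℕ} (ha : a ∈ K)
    (hb : b ∈ K) (h1 : a ≤ t) (h2 : t ≤ b) : t ∈ K := by
  rcases h2.eq_or_lt with rfl | h2
  · exact hb
  obtain ⟨L₁, t₁, w₁, L₂, t₂, w₂, hI, h3, h4, h5⟩ :=
    exists_covering_isInversion ((hK.mem_iff ha).1 hb).2 h1 h2
  have h6 := (hP _ _ _ hI.2.1).1
  have h7 := hI.2.2.1
  exact hK.mem_of_isInversion hP hI ((hK.mem_iff ha).2 ⟨by omega, h5⟩) le_rfl h7.le h3 h4.le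

/-- One aligned word serves all inversions of the class, by transport along chains of overlapping
inversions (`hW`). Every transition between `a` and `b` is covered by some inversion, so the output
reads this word throughout. -/
theorem IsInversionClass.hasPeriod {K : Set ℕ} (hK : ρ.IsInversionClass P K)
    (hP : ρ.ProperAnchors P) (h2 : ρ.SatisfiesP2 P B) {a b : ℕ}
    (ha : IsLeast K a) (hb : IsGreatest K b) : ∃ p ≤ B, HasPeriod (ρ.factorOut a b) p := by
  obtain ⟨L₁, t₁, w₁, L₂, t₂, w₂, hI, h3, h4⟩ := hK.exists_isInversion ha.1
  obtain ⟨p, hpB, hp0, hp⟩ := (hI.aligned_eq hP h2).2.1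
  have hW : ∀ c, Relation.ReflTransGen (ρ.InSameInversion P) a c →
      ∀ L₃ t₃ w₃ L₄ t₄ w₄, ρ.IsInversion P L₃ t₃ w₃ L₄ t₄ w₄ → t₃ ≤ c → c ≤ t₄ →
        ρ.aligned t₃ w₃ = ρ.aligned t₁ w₁ := by
    intro c hc
    induction hc with
    | refl =>
      intro L₃ t₃ w₃ L₄ t₄ w₄ hJ h5 h6
      exact hJ.aligned_eq_of_overlap hP h2 hI (by omega) (by omega)
    | tail hac hstep ih =>
      intro L₃ t₃ w₃ L₄ t₄ w₄ hJ h5 h6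
      obtain ⟨L₅, t₅, w₅, L₆, t₆, w₆, hJ', g1, g2, g3, g4⟩ := hstep
      rw [hJ.aligned_eq_of_overlap hP h2 hJ' (by omega) (by omega),
        ih _ _ _ _ _ _ hJ' g1 g2]
  have hab := hK.least_lt_greatest ha hb
  -- Induction over the transitions: the output of the transition at time `a + n` is read off the
  -- aligned word of an inversion covering it.
  have hv : ∀ n, ∀ i, a + n ≤ b → (ρ.factorOut 0 a).length ≤ i →
      i < (ρ.factorOut 0 (a + n)).length →
      (ρ.factorOut 0 b)[i]? = ρ.aligned t₁ w₁ i := by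
    intro n
    induction n with
    | zero => intro i _ h5 h6; simp only [add_zero] at h6; omega
    | succ n ih =>
      intro i h5 h6 h7
      by_cases h8 : i < (ρ.factorOut 0 (a + n)).length
      · exact ih i (by omega) h6 h8
      obtain ⟨L₃, t₃, w₃, L₄, t₄, w₄, hJ, h9, h10, h11⟩ :=
        exists_covering_isInversion (t := a + n) ((hK.mem_iff ha.1).1 hb.1).2 (by omega) (by omega)
      have hlen := (hP _ _ _ hJ.2.1).1
      have hlt := hJ.2.2.1
      have hmem := (hK.mem_iff ha.1).2 ⟨by omega, h11⟩
      have ht₄ := hb.2 (hK.mem_of_isInversion hP hJ hmem le_rfl hlt.le hlt.le le_rfl)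
      rw [← hW _ h11 _ _ _ _ _ _ hJ le_rfl hlt.le]
      have e1 : (ρ.factorOut 0 (a + n)).length =
          (ρ.factorOut 0 t₃).length + (ρ.factorOut t₃ (a + n)).length := by
        rw [ρ.factorOut_append (Nat.zero_le t₃) h9, List.length_append]
      have e2 : (ρ.factorOut 0 t₄).length =
          (ρ.factorOut 0 (a + (n + 1))).length + (ρ.factorOut (a + (n + 1)) t₄).length := by
        rw [ρ.factorOut_append (Nat.zero_le (a + (n + 1))) (by omega), List.length_append]
      rw [← (hJ.aligned_eq hP h2).2.2 i (by omega) (by omega),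
        ρ.factorOut_append (Nat.zero_le t₄) ht₄, List.getElem?_append_left (by omega)]
  refine ⟨p, hpB, hp0, ?_⟩
  intro i hi
  have hl : (ρ.factorOut 0 b).length =
      (ρ.factorOut 0 a).length + (ρ.factorOut a b).length := by
    rw [ρ.factorOut_append (Nat.zero_le a) hab.le, List.length_append]
  have e : a + (b - a) = b := by omega
  rw [← getElem?_factorOut ρ hab.le, ← getElem?_factorOut ρ hab.le,
    hv (b - a) _ (by omega) (by omega) (by rw [e]; omega),
    hv (b - a) _ (by omega) (by omega) (by rw [e]; omega)]
  push_cast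
  rw [← add_assoc, hp]

theorem anchorsIn_exists_anchor {K : Set ℕ} {c : ℕ} (hc : c ∈ ρ.anchorsIn P K) :
    c ∈ K ∧ ∃ L w, P L c w := by
  obtain ⟨h, L₁, t₁, w₁, L₂, t₂, w₂, hI, rfl | rfl⟩ := hc
  · exact ⟨h, _, _, hI.1⟩
  · exact ⟨h, _, _, hI.2.1⟩

/-- Two classes with a common element are equal. -/
theorem IsInversionClass.eq_of_mem {K K' : Set ℕ} (hK : ρ.IsInversionClass P K)
    (hK' : ρ.IsInversionClass P K') {c : ℕ} (h : c ∈ K) (h' : c ∈ K') : K = K' := by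
  ext r
  rw [hK.mem_iff h, hK'.mem_iff h']

/-! ### Blocks of classes -/

/-- The run starts at position `0`, ends at `u.length` and changes its position by at most one per
step. So it meets the leftmost anchor position before the class and the rightmost one after it. -/
theorem IsInversionClass.exists_isBlockOf {K : Set ℕ} (hK : ρ.IsInversionClass P K)
    (hP : ρ.ProperAnchors P) (hs : ρ.IsSuccessful) :
    ∃ s e, ρ.IsBlockOf P K s e := by
  obtain ⟨a, ha⟩ := hK.exists_isLeast
  obtain ⟨b, hb⟩ := hK.exists_isGreatest
  have haA := hK.least_mem_anchorsIn hP ha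
  have hbA := hK.greatest_mem_anchorsIn hP hb
  have hne : (ρ.pos '' ρ.anchorsIn P K).Nonempty := ⟨_, a, haA, rfl⟩
  have hbdd : BddAbove (ρ.pos '' ρ.anchorsIn P K) := by
    refine ⟨u.length, ?_⟩
    rintro _ ⟨c, hc, rfl⟩
    exact ρ.pos_le hs (hK.le_len hc.1)
  obtain ⟨x, hx⟩ : ∃ x, IsLeast (ρ.pos '' ρ.anchorsIn P K) x :=
    ⟨_, Nat.sInf_mem hne, fun d hd => Nat.sInf_le hd⟩
  obtain ⟨x', hx'⟩ : ∃ x, IsGreatest (ρ.pos '' ρ.anchorsIn P K) x :=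
    ⟨_, Nat.sSup_mem hne hbdd, fun d hd => le_csSup hbdd hd⟩
  have h1 := hx.2 ⟨a, haA, rfl⟩
  have h2 := hx'.2 ⟨b, hbA, rfl⟩
  have hale := hK.le_len ha.1
  have hble := hK.le_len hb.1
  obtain ⟨s₀, -, hs₀, hs₀'⟩ := ρ.exists_pos_eq_up (Nat.zero_le a) hale
    (by rw [ρ.pos_zero hs]; omega) h1
  have hx'n : x' ≤ u.length := by
    obtain ⟨c, hc, rfl⟩ := hx'.1
    exact ρ.pos_le hs (hK.le_len hc.1)
  obtain ⟨e₀, he₀, he₀', he₀''⟩ := ρ.exists_pos_eq_up hble le_rfl h2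
    (by rw [ρ.pos_len hs]; exact hx'n)
  have hbdd' : BddAbove {t | t ≤ a ∧ ρ.pos t = x} := ⟨a, fun t ht => ht.1⟩
  exact ⟨_, _, a, b, x, x', ha, hb, hx, hx',
    ⟨Nat.sSup_mem ⟨s₀, hs₀, hs₀'⟩ hbdd', fun d hd => le_csSup hbdd' hd⟩,
    ⟨Nat.sInf_mem (s := {t | b ≤ t ∧ t ≤ ρ.len ∧ ρ.pos t = x'}) ⟨e₀, he₀, he₀', he₀''⟩,
      fun d hd => Nat.sInf_le hd⟩⟩

/-- The data of a block: the class spans `[a, b]`, the block spans `[s, e]`. -/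
structure BlockData (ρ : T.Run u) (P : ℕ × ℕ → ℕ → List Γ → Prop) (K : Set ℕ)
    (a b s e : ℕ) : Prop where
  least : IsLeast K a
  greatest : IsGreatest K b
  s_le : s ≤ a
  lt : a < b
  le_e : b ≤ e
  e_le : e ≤ ρ.len
  pos_le : ρ.pos s ≤ ρ.pos e
  pos_a : ρ.pos s ≤ ρ.pos a
  pos_b : ρ.pos b ≤ ρ.pos e
  /-- Locations between `s` and `a` are to the right of `s`. -/
  left : ∀ t, s < t → t ≤ a → ρ.pos s < ρ.pos t
  /-- Locations between `b` and `e` are to the left of `e`. -/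
  right : ∀ t, b ≤ t → t < e → ρ.pos t < ρ.pos e
  anchor_left : ∃ c ∈ K, ρ.pos c = ρ.pos s ∧ ∃ L w, P L c w
  anchor_right : ∃ c ∈ K, ρ.pos c = ρ.pos e ∧ ∃ L w, P L c w
  before : ∀ L t w, P L t w → t < a → ρ.pos t ≤ ρ.pos s
  after : ∀ L t w, P L t w → b < t → ρ.pos e ≤ ρ.pos t
  inside : ∀ L t w, P L t w → a ≤ t → t ≤ b → ρ.pos s ≤ ρ.pos t ∧ ρ.pos t ≤ ρ.pos e

/-- An anchor point before `a` and to the right of the leftmost anchor `c` would form an inversion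
with `c`, contradicting the minimality of `a`; `after` is symmetric. For `inside`, an anchor point
between `a` and `b` to the left of `x` would form an inversion with `a`, itself an anchor point,
contradicting the minimality of `x`. -/
theorem IsBlockOf.data {K : Set ℕ} {s e : ℕ} (hK : ρ.IsInversionClass P K)
    (hP : ρ.ProperAnchors P) (h : ρ.IsBlockOf P K s e) :
    ∃ a b, ρ.BlockData P K a b s e := by
  obtain ⟨a, b, x, x', ha, hb, hx, hx', hs, he⟩ := h
  have haA := hK.least_mem_anchorsIn hP ha
  have hbA := hK.greatest_mem_anchorsIn hP hb
  have hab := hK.least_lt_greatest ha hb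
  obtain ⟨Lb, wb, hPb⟩ := (anchorsIn_exists_anchor hbA).2
  obtain ⟨La, wa, hPa⟩ := (anchorsIn_exists_anchor haA).2
  have hxa := hx.2 ⟨a, haA, rfl⟩
  have hxb := hx'.2 ⟨b, hbA, rfl⟩
  obtain ⟨c, hc, hcx⟩ := hx.1
  obtain ⟨c', hc', hcx'⟩ := hx'.1
  have h1 := hs.1.1
  have h2 := hs.1.2
  have h3 := he.1.1
  have h4 := he.1.2.1
  have h5 := he.1.2.2
  have hle : x ≤ x' := by
    have := hx.2 ⟨c', hc', hcx'⟩
    exact this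
  obtain ⟨hcK, Lc, wc, hPc⟩ := anchorsIn_exists_anchor hc
  obtain ⟨hcK', Lc', wc', hPc'⟩ := anchorsIn_exists_anchor hc'
  refine ⟨a, b, ⟨ha, hb, h1, hab, h3, h4, by omega, by omega, by omega, ?_, ?_,
    ⟨c, hcK, by omega, Lc, wc, hPc⟩, ⟨c', hcK', by omega, Lc', wc', hPc'⟩, ?_, ?_, ?_⟩⟩
  · intro t ht hta
    by_contra hcon
    obtain ⟨r, hr1, hr2, hr3⟩ := ρ.exists_pos_eq_up (x := x) hta (by omega) (by omega) hxa
    have := hs.2 (show r ∈ {t | t ≤ a ∧ ρ.pos t = x} from ⟨hr2, hr3⟩)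
    omega
  · intro t ht hte
    by_contra hcon
    obtain ⟨r, hr1, hr2, hr3⟩ := ρ.exists_pos_eq_up (x := x') ht (by omega) hxb (by omega)
    have := he.2 (show r ∈ {t | b ≤ t ∧ t ≤ ρ.len ∧ ρ.pos t = x'} from ⟨hr1, by omega, hr3⟩)
    omega
  · intro L t w hPt hta
    by_contra hcon
    have hac := ha.2 hcK
    have hI : ρ.IsInversion P L t w Lc c wc := ⟨hPt, hPc, by omega, by omega⟩
    have := ha.2 (hK.mem_of_isInversion hP hI hcK (by omega) le_rfl le_rfl (by omega))
    omega
  · intro L t w hPt hta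
    by_contra hcon
    have hcb := hb.2 hcK'
    have hI : ρ.IsInversion P Lc' c' wc' L t w := ⟨hPc', hPt, by omega, by omega⟩
    have := hb.2 (hK.mem_of_isInversion hP hI hcK' le_rfl (by omega) (by omega) le_rfl)
    omega
  · intro L t w hPt hat htb
    have htK := hK.mem_of_le_of_le hP ha.1 hb.1 hat htb
    constructor
    · by_contra hcon
      have hne : a ≠ t := by rintro rfl; omega
      have hI : ρ.IsInversion P La a wa L t w := ⟨hPa, hPt, by omega, by omega⟩
      have := hx.2 ⟨t, ⟨htK, _, _, _, _, _, _, hI, Or.inr rfl⟩, rfl⟩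
      omega
    · by_contra hcon
      have hne : t ≠ b := by rintro rfl; omega
      have hI : ρ.IsInversion P L t w Lb b wb := ⟨hPt, hPb, by omega, by omega⟩
      have := hx'.2 ⟨t, ⟨htK, _, _, _, _, _, _, hI, Or.inl rfl⟩, rfl⟩
      omega

theorem IsBlockOf.unique {K : Set ℕ} {s e s' e' : ℕ} (h : ρ.IsBlockOf P K s e)
    (h' : ρ.IsBlockOf P K s' e') : s = s' ∧ e = e' := by
  obtain ⟨a, b, x, x', ha, hb, hx, hx', hs, he⟩ := h
  obtain ⟨a₁, b₁, x₁, x₁', ha₁, hb₁, hx₁, hx₁', hs₁, he₁⟩ := h'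
  obtain rfl := ha.unique ha₁
  obtain rfl := hb.unique hb₁
  obtain rfl := hx.unique hx₁
  obtain rfl := hx'.unique hx₁'
  exact ⟨hs.unique hs₁, he.unique he₁⟩

/-- The rightmost anchor of `K` precedes `K'`, so `before` puts `pos e` weakly to the left of `pos
s'`. The run therefore reaches `pos e` between `b` and `a'`, and then `pos s'` again no later than
`a'`; as `s'` is the last such visit, `e ≤ s'`. -/
theorem BlockData.le_of_lt {K K' : Set ℕ} {a b s e a' b' s' e' : ℕ}
    (hP : ρ.ProperAnchors P) (hK : ρ.IsInversionClass P K) (hK' : ρ.IsInversionClass P K')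
    (h : ρ.BlockData P K a b s e) (h' : ρ.BlockData P K' a' b' s' e') (hne : K ≠ K')
    (haa : a ≤ a') : e ≤ s' ∧ ρ.pos e ≤ ρ.pos s' := by
  have hba : b < a' := by
    by_contra hcon
    exact hne (hK.eq_of_mem hK'
      (hK.mem_of_le_of_le hP h.least.1 h.greatest.1 haa (by omega)) h'.least.1)
  obtain ⟨c, hc, hc', L, w, hPc⟩ := h.anchor_right
  have h1 := h.greatest.2 hc
  have h2 := h'.before _ _ _ hPc (by omega)
  have h3 := h'.pos_a
  have h4 := h.pos_b
  have ha' := hK'.le_len h'.least.1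
  obtain ⟨r, hr1, hr2, hr3⟩ := ρ.exists_pos_eq_up (x := ρ.pos e) hba.le ha' h4 (by omega)
  have h5 : e ≤ r := by
    by_contra hcon
    have := h.right r hr1 (by omega)
    omega
  refine ⟨?_, by omega⟩
  obtain ⟨r', hr1', hr2', hr3'⟩ := ρ.exists_pos_eq_up (x := ρ.pos s') (h5.trans hr2) ha'
    (by omega) h3
  by_contra hcon
  have := h'.left r' (by omega) hr2'
  omega

theorem IsInversionBlock.trichotomy {s e s' e' : ℕ} (hP : ρ.ProperAnchors P)
    (h : ρ.IsInversionBlock P s e) (h' : ρ.IsInversionBlock P s' e') :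
    (s = s' ∧ e = e') ∨ e ≤ s' ∧ ρ.pos e ≤ ρ.pos s' ∨ e' ≤ s ∧ ρ.pos e' ≤ ρ.pos s := by
  obtain ⟨K, hK, hB⟩ := h
  obtain ⟨K', hK', hB'⟩ := h'
  by_cases hKK : K = K'
  · subst hKK
    exact Or.inl (hB.unique hB')
  obtain ⟨a, b, hD⟩ := hB.data hK hP
  obtain ⟨a', b', hD'⟩ := hB'.data hK' hP
  rcases le_total a a' with haa | haa
  · exact Or.inr (Or.inl (hD.le_of_lt hP hK hK' hD' hKK haa))
  · exact Or.inr (Or.inr (hD'.le_of_lt hP hK' hK hD (Ne.symm hKK) haa))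

/-- Factors that avoid blocks contain no inversion. -/
theorem AvoidsInversionBlocks.not_isInversion {s e : ℕ} (hP : ρ.ProperAnchors P)
    (hs : ρ.IsSuccessful) (h : ρ.AvoidsInversionBlocks P s e) {L₁ L₂ : ℕ × ℕ} {t₁ t₂ : ℕ}
    {w₁ w₂ : List Γ} (h1 : s ≤ t₁) (h2 : t₂ ≤ e) : ¬ ρ.IsInversion P L₁ t₁ w₁ L₂ t₂ w₂ := by
  intro hI
  have hlt := hI.2.2.1
  have hlen := (hP _ _ _ hI.2.1).1
  -- The class generated by the inversion has a block containing both `t₁` and `t₂`, and this block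
  -- overlaps the factor.
  let K := {r | r ≤ ρ.len ∧ Relation.ReflTransGen (ρ.InSameInversion P) t₁ r}
  have ht₁ : t₁ ∈ K := ⟨by omega, Relation.ReflTransGen.refl⟩
  have ht₂ : t₂ ∈ K := ⟨hlen, Relation.ReflTransGen.single
    ⟨_, _, _, _, _, _, hI, le_rfl, hlt.le, hlt.le, le_rfl⟩⟩
  have hK : ρ.IsInversionClass P K := ⟨⟨t₁, ht₁, t₂, ht₂, hlt.ne⟩, t₁, by omega, rfl⟩
  obtain ⟨s', e', hB⟩ := hK.exists_isBlockOf hP hs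
  obtain ⟨a, b, hD⟩ := hB.data hK hP
  have h3 := hD.least.2 ht₁
  have h4 := hD.greatest.2 ht₂
  have h5 := hD.s_le
  have h6 := hD.le_e
  refine h s' e' ⟨K, hK, hB⟩ ⟨⟨t₁, ⟨h1, by omega⟩, ⟨by omega, by omega⟩⟩, by omega, by omega⟩

/-! ### Factorization of the run along its blocks -/

/-- A factor between two consecutive blocks (or an extremity of the run). -/
structure IsGap (ρ : T.Run u) (P : ℕ × ℕ → ℕ → List Γ → Prop) (s e : ℕ) : Prop where
  forward : ρ.IsForwardFactor s e
  avoids : ρ.AvoidsInversionBlocks P s e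
  anchors : ∀ L t w, P L t w → s < t → t < e → ρ.pos s ≤ ρ.pos t ∧ ρ.pos t ≤ ρ.pos e

/-- The run is cut exactly at its two ends and at the ends of all blocks. Blocks do not overlap, so
no cut falls inside a block: each block is one factor and every other factor is a gap. It remains
for `hDiag` to treat gaps. -/
theorem exists_isDecomposition (hP : ρ.ProperAnchors P) (hs : ρ.IsSuccessful)
    {Diag Block : ℕ → ℕ → Prop} (hBlock : ∀ s e, ρ.IsInversionBlock P s e → Block s e)
    (hDiag : ∀ s e, ρ.IsGap P s e → Diag s e) :
    ∃ (k : ℕ) (τ : ℕ → ℕ), ρ.IsDecomposition Diag Block k τ ∧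
      (∀ s e, ρ.IsInversionBlock P s e → ∃ i < k, τ i = s ∧ τ (i + 1) = e) ∧
      ∀ i < k, ρ.IsInversionBlock P (τ i) (τ (i + 1)) ∨
        (ρ.AvoidsInversionBlocks P (τ i) (τ (i + 1)) ∧ Diag (τ i) (τ (i + 1))) := by
  let p : ℕ → Prop := fun c => c = 0 ∨ c = ρ.len ∨
    ∃ s e, ρ.IsInversionBlock P s e ∧ (c = s ∨ c = e)
  have hlt : ∀ s e, ρ.IsInversionBlock P s e → s < e ∧ e ≤ ρ.len := by
    rintro s e ⟨K, hK, hB⟩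
    obtain ⟨a, b, hD⟩ := hB.data hK hP
    have := hD.s_le
    have := hD.lt
    have := hD.le_e
    exact ⟨by omega, hD.e_le⟩
  have hcut : ∀ s e, ρ.IsInversionBlock P s e → ∀ c, s < c → c < e → ¬ p c := by
    intro s e hB c h1 h2
    have := hlt s e hB
    rintro (rfl | rfl | ⟨s', e', hB', h⟩)
    · omega
    · omega
    · have := hB.trichotomy hP hB'
      have := hlt s' e' hB'
      omega
  obtain ⟨k, τ, h0, hk, hstep, hmem⟩ := exists_enumeration p (Or.inl rfl) ρ.len
    (Or.inr (Or.inl rfl))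
  have hmono : ∀ i j, i ≤ j → j ≤ k → τ i ≤ τ j := by
    intro i j hij
    induction j, hij using Nat.le_induction with
    | base => intro _; exact le_rfl
    | succ j hij ih =>
      intro hj
      have := (hstep j (by omega)).1
      have := ih (by omega)
      omega
  have hblocks : ∀ s e, ρ.IsInversionBlock P s e → ∃ i < k, τ i = s ∧ τ (i + 1) = e := by
    intro s e hB
    have h1 := hlt s e hB
    obtain ⟨i, hi, hi'⟩ := hmem s (by omega) (Or.inr (Or.inr ⟨s, e, hB, Or.inl rfl⟩))
    have hik : i < k := by
      rcases hi.eq_or_lt with rfl | h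
      · omega
      · exact h
    refine ⟨i, hik, hi', ?_⟩
    have h2 := hstep i hik
    rcases lt_trichotomy (τ (i + 1)) e with h | h | h
    · exact absurd h2.2.2.1 (hcut s e hB _ (by omega) h)
    · exact h
    · exact absurd (Or.inr (Or.inr ⟨s, e, hB, Or.inr rfl⟩))
        (h2.2.2.2 e (by omega) h)
  have hgap : ∀ i < k, ρ.IsInversionBlock P (τ i) (τ (i + 1)) ∨
      ρ.IsGap P (τ i) (τ (i + 1)) := by
    intro i hi
    by_cases hB : ρ.IsInversionBlock P (τ i) (τ (i + 1))
    · exact Or.inl hB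
    right
    obtain ⟨h1, h2, h3, h4⟩ := hstep i hi
    have hle : τ (i + 1) ≤ ρ.len := by rw [← hk]; exact hmono _ _ hi le_rfl
    have hleft : τ i = 0 ∨ ∃ s, ρ.IsInversionBlock P s (τ i) := by
      rcases h2 with h | h | ⟨s, e, hB', h | h⟩
      · exact Or.inl h
      · omega
      · exfalso
        obtain ⟨j, hj, hj1, hj2⟩ := hblocks s e hB'
        have : i = j := by
          rcases lt_trichotomy i j with h5 | h5 | h5
          · have := hmono (i + 1) j h5 hj.le; omega
          · exact h5
          · have := hmono (j + 1) i h5 hi.le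
            have := (hstep j hj).1
            omega
        subst this
        rw [h, hj2] at hB
        exact hB hB'
      · exact Or.inr ⟨s, h ▸ hB'⟩
    have hright : τ (i + 1) = ρ.len ∨ ∃ e, ρ.IsInversionBlock P (τ (i + 1)) e := by
      rcases h3 with h | h | ⟨s, e, hB', h | h⟩
      · omega
      · exact Or.inl h
      · exact Or.inr ⟨e, h ▸ hB'⟩
      · exfalso
        obtain ⟨j, hj, hj1, hj2⟩ := hblocks s e hB'
        have : i = j := by
          rcases lt_trichotomy i j with h5 | h5 | h5
          · have := hmono (i + 1) j h5 hj.le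
            have := (hstep j hj).1
            omega
          · exact h5
          · have := hmono (j + 1) i h5 hi.le
            omega
        subst this
        rw [h, hj1] at hB
        exact hB hB'
    have hpos : ρ.pos (τ i) ≤ ρ.pos (τ (i + 1)) := by
      rcases hleft with h | ⟨s, hBs⟩
      · rw [h, ρ.pos_zero hs]; omega
      rcases hright with h | ⟨e, hBe⟩
      · rw [h, ρ.pos_len hs]
        exact ρ.pos_le hs (by omega)
      · have := hBs.trichotomy hP hBe
        have := hlt _ _ hBs
        have := hlt _ _ hBe
        omega
    refine ⟨⟨h1.le, hle, hpos⟩, ?_, ?_⟩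
    · rintro s' e' hB' ⟨⟨c, hc1, hc2⟩, h5, h6⟩
      simp only [Set.mem_Icc] at hc1 hc2
      have h7 := fun h => h4 s' h
      have h8 := h4 e'
      have hs' : ¬ (τ i < s' ∧ s' < τ (i + 1)) :=
        fun h => h4 s' h.1 h.2 (Or.inr (Or.inr ⟨s', e', hB', Or.inl rfl⟩))
      have he' : ¬ (τ i < e' ∧ e' < τ (i + 1)) :=
        fun h => h4 e' h.1 h.2 (Or.inr (Or.inr ⟨s', e', hB', Or.inr rfl⟩))
      have hi1 : ¬ (s' < τ i ∧ τ i < e') := fun h => hcut s' e' hB' _ h.1 h.2 h2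
      have hi2 : ¬ (s' < τ (i + 1) ∧ τ (i + 1) < e') := fun h => hcut s' e' hB' _ h.1 h.2 h3
      have e1 : s' = τ i := by omega
      have e2 : e' = τ (i + 1) := by omega
      rw [e1, e2] at hB'
      exact hB hB'
    -- Anchor points of a gap come after the block on its left and before the block on its right, so
    -- `after` and `before` confine their positions.
    · intro L t w hPt ht1 ht2
      constructor
      · rcases hleft with h | ⟨s, K, hK, hBs⟩
        · rw [h, ρ.pos_zero hs]; omega
        · obtain ⟨a, b, hD⟩ := hBs.data hK hP
          exact hD.after _ _ _ hPt (lt_of_le_of_lt hD.le_e ht1)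
      · rcases hright with h | ⟨e, K, hK, hBe⟩
        · rw [h, ρ.pos_len hs]
          exact ρ.pos_le hs (by omega)
        · obtain ⟨a, b, hD⟩ := hBe.data hK hP
          exact hD.before _ _ _ hPt (lt_of_lt_of_le ht2 hD.s_le)
  refine ⟨k, τ, ⟨h0, hk, fun i hi => (hstep i hi).1, ?_⟩, hblocks, ?_⟩
  · intro i hi
    rcases hgap i hi with h | h
    · exact Or.inr (hBlock _ _ h)
    · exact Or.inl (hDiag _ _ h)
  · intro i hi
    rcases hgap i hi with h | h
    · exact Or.inl h
    · exact Or.inr ⟨h.avoids, hDiag _ _ h⟩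

end Run

end TwoWayTransducer

/-! ### A Ramsey theorem for additive colourings -/

/-- This is stability of finite monoids: `x` lies in the left ideal of `s` and `s` in the two-sided
ideal of `x`, so both generate the same left ideal. Iterating gives `s = (l * x) ^ n * s * r ^ n`,
and a repetition among the powers of `l * x` allows the right factors to be absorbed. -/
theorem exists_eq_mul_of_mul_right_eq {S : Type*} [Monoid S] [Finite S] {x s l r : S}
    (h : x * s = x) (hs : s = l * x * r) : ∃ v, s = v * x := by
  have hn : ∀ n : ℕ, s = (l * x) ^ n * s * r ^ n := by
    intro n
    induction n with
    | zero => simp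
    | succ n ih =>
      calc s = l * (x * s) * r := by rw [h]; exact hs
        _ = l * (x * ((l * x) ^ n * s * r ^ n)) * r := by rw [← ih]
        _ = (l * x) ^ (n + 1) * s * r ^ (n + 1) := by
          rw [pow_succ' (l * x), pow_succ r]; simp only [mul_assoc]
  obtain ⟨i, j, hij, he⟩ := Finite.exists_ne_map_eq_of_infinite fun n : ℕ => (l * x) ^ n
  wlog hlt : i < j generalizing i j
  · exact this j i hij.symm he.symm (by omega)
  obtain ⟨k, rfl⟩ := Nat.exists_eq_add_of_lt hlt
  refine ⟨(l * x) ^ k * l, ?_⟩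
  calc s = (l * x) ^ (k + 1 + i) * s * r ^ i := by
        rw [show k + 1 + i = i + k + 1 by omega, ← he, ← hn]
    _ = (l * x) ^ (k + 1) * ((l * x) ^ i * s * r ^ i) := by rw [pow_add]; simp only [mul_assoc]
    _ = (l * x) ^ k * l * (x * s) := by rw [← hn, pow_succ]; simp only [mul_assoc]
    _ = (l * x) ^ k * l * x := by rw [h]

/-- The mirror image, obtained in the opposite monoid. -/
theorem exists_eq_mul_of_mul_left_eq {S : Type*} [Monoid S] [Finite S] {x s l r : S}
    (h : s * x = x) (hs : s = l * x * r) : ∃ v, s = x * v := by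
  have : Finite Sᵐᵒᵖ := Finite.of_equiv S MulOpposite.opEquiv
  obtain ⟨v, hv⟩ := exists_eq_mul_of_mul_right_eq (S := Sᵐᵒᵖ) (x := .op x) (s := .op s)
    (l := .op r) (r := .op l) (by rw [← MulOpposite.op_mul, h])
    (by rw [← MulOpposite.op_mul, ← MulOpposite.op_mul, hs, mul_assoc])
  exact ⟨v.unop, by rw [← MulOpposite.op_inj, hv]; simp⟩

/-- This is the count behind the pigeonhole argument below: `8 ^ j - 2` inner points in `j * j`
boxes put more than three points into one box. -/
theorem three_mul_sq_add_two_lt {j : ℕ} (hj : 1 ≤ j) : 3 * (j * j) + 2 < 8 ^ j := by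
  induction j, hj using Nat.le_induction with
  | base => norm_num
  | succ j hj ih => rw [pow_succ]; nlinarith

theorem exists_four_of_card {s : Finset ℕ} (h : 3 < s.card) :
    ∃ a₀ ∈ s, ∃ a₁ ∈ s, ∃ a₂ ∈ s, ∃ a₃ ∈ s, a₀ < a₁ ∧ a₁ < a₂ ∧ a₂ < a₃ := by
  let f := s.orderEmbOfCardLe (k := 4) h
  have hf : ∀ i, f i ∈ s := fun i => Finset.orderEmbOfCardLe_mem s h i
  exact ⟨f 0, hf 0, f 1, hf 1, f 2, hf 2, f 3, hf 3, f.strictMono (by decide),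
    f.strictMono (by decide), f.strictMono (by decide)⟩

/-- Let `c` be an additive colouring of the pairs in an interval, with values in a finite monoid,
and let `d` be a refinement of `c` with at most `n` values. If the interval has length at least
`8 ^ n`, then there are four points in it such that all pairs of them get the same colour, and such
that `d` does not distinguish them as seen from some earlier point. -/
theorem exists_homogeneous {S D : Type*} [Monoid S] [Finite S] (c : ℕ → ℕ → S) (d : ℕ → ℕ → D)
    {N : ℕ} (hcd : ∀ i j i' j', i < j → j ≤ N → i' < j' → j' ≤ N → d i j = d i' j' →
      c i j = c i' j')
    (hadd : ∀ i j k, i < j → j < k → k ≤ N → c i k = c i j * c j k) (U : Finset D) :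
    ∀ lo hi, hi ≤ N → (∀ i j, lo ≤ i → i < j → j ≤ hi → d i j ∈ U) → lo + 8 ^ U.card ≤ hi →
      ∃ q a₀ a₁ a₂ a₃, lo ≤ q ∧ q < a₀ ∧ a₀ < a₁ ∧ a₁ < a₂ ∧ a₂ < a₃ ∧ a₃ ≤ hi ∧
        d q a₁ = d q a₀ ∧ d q a₂ = d q a₀ ∧ d q a₃ = d q a₀ ∧
        c a₀ a₂ = c a₀ a₁ ∧ c a₀ a₃ = c a₀ a₁ ∧ c a₁ a₂ = c a₀ a₁ ∧ c a₁ a₃ = c a₀ a₁ ∧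
        c a₂ a₃ = c a₀ a₁ := by
  classical
  induction hn : U.card using Nat.strong_induction_on generalizing U with
  | _ n ih =>
  subst hn
  intro lo hi hhi hU hlen
  set X := c lo hi with hX
  have hlohi : lo < hi := by have : 0 < 8 ^ U.card := by positivity
                             omega
  -- The colour `X` of the whole interval is lowest in the two-sided divisibility order among the
  -- colours of its subintervals.
  have hge : ∀ i j, lo ≤ i → i < j → j ≤ hi → ∃ l r, X = l * c i j * r := by
    intro i j h1 h2 h3
    have h4 : ∃ l, c lo j = l * c i j := by
      rcases h1.eq_or_lt with rfl | h1
      · exact ⟨1, (one_mul _).symm⟩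
      · exact ⟨_, hadd _ _ _ h1 h2 (by omega)⟩
    have h5 : ∃ r, X = c lo j * r := by
      rcases h3.eq_or_lt with rfl | h3
      · exact ⟨1, (mul_one _).symm⟩
      · exact ⟨_, hadd _ _ _ (by omega) h3 (by omega)⟩
    obtain ⟨l, hl⟩ := h4
    obtain ⟨r, hr⟩ := h5
    exact ⟨l, r, by rw [hr, hl]⟩
  -- These are the values of `d` whose colours are also multiples of `X`, that is, lie in its
  -- J-class. Counting values of `d` instead of colours keeps the bound independent of the size of
  -- `S`.
  let J := U.filter fun δ => ∃ i j, lo ≤ i ∧ i < j ∧ j ≤ hi ∧ d i j = δ ∧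
    ∃ l r, c i j = l * X * r
  have hJ : ∀ i j, lo ≤ i → i < j → j ≤ hi → (d i j ∈ J ↔ ∃ l r, c i j = l * X * r) := by
    intro i j h1 h2 h3
    simp only [J, Finset.mem_filter]
    constructor
    · rintro ⟨-, i', j', g1, g2, g3, g4, l, r, g5⟩
      exact ⟨l, r, by rw [← g5, hcd i j i' j' h2 (by omega) g2 (by omega) g4.symm]⟩
    · intro h
      exact ⟨hU i j h1 h2 h3, i, j, h1, h2, h3, rfl, h⟩
  have hJU : J ⊆ U := Finset.filter_subset _ _
  have hJpos : 0 < J.card := by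
    apply Finset.card_pos.2
    exact ⟨d lo hi, (hJ lo hi le_rfl hlohi le_rfl).2 ⟨1, 1, by simp [hX]⟩⟩
  have hcard : (U \ J).card + J.card = U.card := Finset.card_sdiff_add_card_eq_card hJU
  set ℓ := 8 ^ (U \ J).card with hℓ
  have hmul : 8 ^ J.card * ℓ = 8 ^ U.card := by rw [hℓ, ← pow_add, add_comm, hcard]
  -- The interval is divided into `8 ^ |J|` pieces of length `8 ^ |U \ J|`. A piece without values
  -- in `J` is handled by the induction hypothesis for `U \ J`; otherwise every piece supplies a
  -- pair `(f b, g b)` coloured in the J-class.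
  by_cases hblock : ∃ b < 8 ^ J.card, ∀ i j, lo + b * ℓ ≤ i → i < j → j ≤ lo + (b + 1) * ℓ →
      d i j ∉ J
  · obtain ⟨b, hb, hbJ⟩ := hblock
    have hble : (b + 1) * ℓ ≤ 8 ^ U.card := by
      rw [← hmul]; exact Nat.mul_le_mul_right _ hb
    obtain ⟨q, a₀, a₁, a₂, a₃, h1, h2, h3, h4, h5, h6, h7⟩ :=
      ih _ (by omega) (U \ J) rfl (lo + b * ℓ) (lo + (b + 1) * ℓ) (by omega)
        (fun i j h1 h2 h3 => Finset.mem_sdiff.2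
          ⟨hU i j (by omega) h2 (by omega), hbJ i j h1 h2 h3⟩)
        (by rw [add_mul, one_mul]; omega)
    exact ⟨q, a₀, a₁, a₂, a₃, by omega, h2, h3, h4, h5, by omega, h7⟩
  · push Not at hblock
    choose! f g hf hfg hg hfJ using hblock
    have hble : ∀ b < 8 ^ J.card, (b + 1) * ℓ ≤ 8 ^ U.card := by
      intro b hb
      rw [← hmul]; exact Nat.mul_le_mul_right _ hb
    have hgf : ∀ b b', b < b' → b' < 8 ^ J.card → g b ≤ f b' := by
      intro b b' h h'
      have h1 := hg b (by omega)
      have h2 := hf b' h'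
      have : (b + 1) * ℓ ≤ b' * ℓ := Nat.mul_le_mul_right _ h
      omega
    have hpair : ∀ b b', b < b' → b' < 8 ^ J.card → lo ≤ f b ∧ f b < f b' ∧ f b' ≤ hi ∧
        ∃ l r, c (f b) (f b') = l * X * r := by
      intro b b' h h'
      have h1 := hgf b b' h h'
      have h2 := hf b (by omega)
      have h3 := hfg b (by omega)
      have h4 := hg b' h'
      have h5 := hfg b' h'
      have h6 := hble b' h'
      refine ⟨by omega, by omega, by omega, ?_⟩
      obtain ⟨l, r, h7⟩ := (hJ (f b) (g b) (by omega) h3 (by omega)).1 (hfJ b (by omega))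
      rcases h1.eq_or_lt with h8 | h8
      · exact ⟨l, r, by rw [← h8, h7]⟩
      · exact ⟨l, r * c (g b) (f b'), by
          rw [hadd _ _ _ h3 h8 (by omega), h7]; simp only [mul_assoc]⟩
    set M := 8 ^ J.card - 1 with hM
    have hbig := three_mul_sq_add_two_lt hJpos
    -- The inner points `f a` are sorted by their values seen from the first point and towards the
    -- last one; some box contains four of them.
    obtain ⟨⟨p, t⟩, -, hfib⟩ := Finset.exists_lt_card_fiber_of_mul_lt_card_of_maps_to
      (s := Finset.Ioo 0 M) (t := J ×ˢ J) (n := 3)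
      (f := fun a => (d (f 0) (f a), d (f a) (f M)))
      (by
        intro a ha
        simp only [Finset.mem_Ioo] at ha
        have h1 := hpair 0 a ha.1 (by omega)
        have h2 := hpair a M ha.2 (by omega)
        exact Finset.mem_product.2 ⟨(hJ _ _ h1.1 h1.2.1 h1.2.2.1).2 h1.2.2.2,
          (hJ _ _ h2.1 h2.2.1 h2.2.2.1).2 h2.2.2.2⟩)
      (by rw [Finset.card_product, Nat.card_Ioo]; omega)
    have hmem : ∀ a ∈ (Finset.Ioo 0 M).filter
        (fun a => (d (f 0) (f a), d (f a) (f M)) = (p, t)),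
        0 < a ∧ a < M ∧ d (f 0) (f a) = p ∧ d (f a) (f M) = t := by
      intro a ha
      simp only [Finset.mem_filter, Finset.mem_Ioo, Prod.mk.injEq] at ha
      exact ⟨ha.1.1, ha.1.2, ha.2.1, ha.2.2⟩
    obtain ⟨b₀, hb₀, b₁, hb₁, b₂, hb₂, b₃, hb₃, h01, h12, h23⟩ := exists_four_of_card hfib
    replace hb₀ := hmem _ hb₀
    replace hb₁ := hmem _ hb₁
    replace hb₂ := hmem _ hb₂
    replace hb₃ := hmem _ hb₃
    set x := c (f 0) (f b₀) with hx
    set y := c (f b₀) (f M) with hy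
    have hxa : ∀ a, 0 < a → a < M → d (f 0) (f a) = p → c (f 0) (f a) = x := by
      intro a h1 h2 h3
      have g1 := hpair 0 a h1 (by omega)
      have g2 := hpair 0 b₀ hb₀.1 (by omega)
      exact hcd _ _ _ _ g1.2.1 (by omega) g2.2.1 (by omega) (by rw [h3, hb₀.2.2.1])
    have hya : ∀ a, 0 < a → a < M → d (f a) (f M) = t → c (f a) (f M) = y := by
      intro a h1 h2 h3
      have g1 := hpair a M h2 (by omega)
      have g2 := hpair b₀ M hb₀.2.1 (by omega)
      exact hcd _ _ _ _ g1.2.1 (by omega) g2.2.1 (by omega) (by rw [h3, hb₀.2.2.2])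
    -- Within a box, every colour `s` fixes `x` on the right and `y` on the left. Stability then
    -- makes `s` a left multiple of `x` and a right multiple of `y`.
    have key : ∀ a b, 0 < a → a < b → b < M → d (f 0) (f a) = p → d (f 0) (f b) = p →
        d (f a) (f M) = t → d (f b) (f M) = t →
        x * c (f a) (f b) = x ∧ c (f a) (f b) * y = y ∧ (∃ v, c (f a) (f b) = v * x) ∧
          ∃ v, c (f a) (f b) = y * v := by
      intro a b h1 h2 h3 g1 g2 g3 g4
      have k1 := hpair 0 a h1 (by omega)
      have k2 := hpair a b h2 (by omega)
      have k3 := hpair b M h3 (by omega)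
      have e1 : x * c (f a) (f b) = x := by
        rw [← hxa a h1 (by omega) g1, ← hadd _ _ _ k1.2.1 k2.2.1 (by omega),
          hxa b (by omega) h3 g2, hxa a h1 (by omega) g1]
      have e2 : c (f a) (f b) * y = y := by
        rw [← hya b (by omega) h3 g4, ← hadd _ _ _ k2.2.1 k3.2.1 (by omega),
          hya a h1 (by omega) g3, hya b (by omega) h3 g4]
      obtain ⟨l, r, e3⟩ := k2.2.2.2
      have k4 := hpair 0 b₀ hb₀.1 (by omega)
      have k5 := hpair b₀ M hb₀.2.1 (by omega)
      obtain ⟨l₁, r₁, e4⟩ := hge _ _ k4.1 k4.2.1 k4.2.2.1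
      obtain ⟨l₂, r₂, e5⟩ := hge _ _ k5.1 k5.2.1 k5.2.2.1
      refine ⟨e1, e2, ?_, ?_⟩
      · refine exists_eq_mul_of_mul_right_eq e1 (l := l * l₁) (r := r₁ * r) ?_
        rw [e3, e4, hx]; simp only [mul_assoc]
      · refine exists_eq_mul_of_mul_left_eq e2 (l := l * l₂) (r := r₂ * r) ?_
        rw [e3, e5, hy]; simp only [mul_assoc]
    -- These four conditions determine the element: `s * s'` equals `s` because `s = v * x` and `x *
    -- s' = x`, and it equals `s'` because `s' = y * v'` and `s * y = y`.
    have heq : ∀ s s' : S, (x * s = x ∧ s * y = y ∧ (∃ v, s = v * x) ∧ ∃ v, s = y * v) →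
        (x * s' = x ∧ s' * y = y ∧ (∃ v, s' = v * x) ∧ ∃ v, s' = y * v) → s = s' := by
      rintro s s' ⟨-, e2, ⟨v, hv⟩, -⟩ ⟨e1', -, -, ⟨v', hv'⟩⟩
      have h1 : s * s' = s := by rw [hv, mul_assoc, e1']
      have h2 : s * s' = s' := by rw [hv', ← mul_assoc, e2]
      rw [← h1, h2]
    have k01 := key b₀ b₁ hb₀.1 h01 hb₁.2.1 hb₀.2.2.1 hb₁.2.2.1 hb₀.2.2.2 hb₁.2.2.2
    refine ⟨f 0, f b₀, f b₁, f b₂, f b₃, (hpair 0 b₀ hb₀.1 (by omega)).1,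
      (hpair 0 b₀ hb₀.1 (by omega)).2.1, (hpair b₀ b₁ h01 (by omega)).2.1,
      (hpair b₁ b₂ h12 (by omega)).2.1, (hpair b₂ b₃ h23 (by omega)).2.1,
      (hpair b₂ b₃ h23 (by omega)).2.2.1, by rw [hb₀.2.2.1, hb₁.2.2.1],
      by rw [hb₀.2.2.1, hb₂.2.2.1], by rw [hb₀.2.2.1, hb₃.2.2.1],
      heq _ _ (key b₀ b₂ hb₀.1 (by omega) hb₂.2.1 hb₀.2.2.1 hb₂.2.2.1 hb₀.2.2.2 hb₂.2.2.2) k01,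
      heq _ _ (key b₀ b₃ hb₀.1 (by omega) hb₃.2.1 hb₀.2.2.1 hb₃.2.2.1 hb₀.2.2.2 hb₃.2.2.2) k01,
      heq _ _ (key b₁ b₂ hb₁.1 h12 hb₂.2.1 hb₁.2.2.1 hb₂.2.2.1 hb₁.2.2.2 hb₂.2.2.2) k01,
      heq _ _ (key b₁ b₃ hb₁.1 (by omega) hb₃.2.1 hb₁.2.2.1 hb₃.2.2.1 hb₁.2.2.2 hb₃.2.2.2) k01,
      heq _ _ (key b₂ b₃ hb₂.1 h23 hb₃.2.1 hb₂.2.2.1 hb₃.2.2.1 hb₂.2.2.2 hb₃.2.2.2) k01⟩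

namespace TwoWayTransducer

namespace Run

variable {Q A Γ : Type*} {T : TwoWayTransducer Q A Γ} {u : List A} {ρ : T.Run u}

/-! ### Intercepted factors -/

theorem Intercepted.entry (hs : ρ.IsSuccessful) {x₁ x₂ s e : ℕ}
    (h : ρ.Intercepted (x₁, x₂) s e) :
    Even (ρ.level s) ∧ ρ.pos s = x₁ ∨ Odd (ρ.level s) ∧ ρ.pos s = x₂ := by
  obtain ⟨h1, h2, h3, h4, -⟩ := h
  have h5 := h3 s le_rfl h1
  rw [ρ.even_level_iff hs.1 (by omega), ρ.odd_level_iff hs.1 (by omega)]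
  rcases s with _ | t
  · have := hs.1
    have : ρ.pos 0 = ρ.head 0 := rfl
    dsimp only at h5
    omega
  · have h6 := h4 t rfl
    have := ρ.step (t := t) (by omega)
    dsimp only at h5 h6
    omega

theorem Intercepted.exit (hs : ρ.IsSuccessful) {x₁ x₂ s e : ℕ} (hx : x₂ ≤ u.length)
    (h : ρ.Intercepted (x₁, x₂) s e) :
    Odd (ρ.level e) ∧ ρ.pos e = x₁ ∨ Even (ρ.level e) ∧ ρ.pos e = x₂ := by
  obtain ⟨h1, h2, h3, -, h4⟩ := h
  rw [ρ.even_level_iff hs.1 (by omega), ρ.odd_level_iff hs.1 (by omega)]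
  obtain ⟨t, rfl⟩ : ∃ t, e = t + 1 := ⟨e - 1, by omega⟩
  have h5 := h3 t (by omega) (by omega)
  have := ρ.step (t := t) (by omega)
  have h6 : ¬ (x₁ ≤ ρ.head (t + 1) ∧ ρ.head (t + 1) < x₂) := by
    rcases h2.eq_or_lt with h6 | h6
    · have := hs.2.2.1
      rw [h6]; omega
    · exact h4 h6
  dsimp only at h5
  omega

theorem Intercepted.between {x₁ x₂ s e t : ℕ}
    (h : ρ.Intercepted (x₁, x₂) s e) (h1 : s < t) (h2 : t < e) :
    x₁ < ρ.pos t ∧ ρ.pos t < x₂ := by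
  obtain ⟨-, h3, h4, -⟩ := h
  obtain ⟨r, rfl⟩ : ∃ r, t = r + 1 := ⟨t - 1, by omega⟩
  have h5 := h4 r (by omega) (by omega)
  have h6 := h4 (r + 1) (by omega) (by omega)
  have := ρ.step (t := r) (by omega)
  dsimp only at h5 h6
  omega

/-- Every transition reading a letter in an interval belongs to a factor intercepted by it. -/
theorem exists_intercepted (hs : ρ.IsSuccessful) {x₁ x₂ r : ℕ} (hx : x₂ ≤ u.length)
    (hr : r < ρ.len) (h1 : x₁ ≤ ρ.head r) (h2 : ρ.head r < x₂) :
    ∃ s e, s ≤ r ∧ r < e ∧ ρ.Intercepted (x₁, x₂) s e := by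
  classical
  have hA : ∃ s, s ≤ r ∧ ∀ t, s ≤ t → t ≤ r → x₁ ≤ ρ.head t ∧ ρ.head t < x₂ :=
    ⟨r, le_rfl, fun t h3 h4 => by obtain rfl : t = r := by omega
                                  exact ⟨h1, h2⟩⟩
  have hB : ∃ e, r < e ∧ ¬ (x₁ ≤ ρ.head e ∧ ρ.head e < x₂) :=
    ⟨ρ.len, hr, by rw [hs.2.2.1]; omega⟩
  have hle : Nat.find hB ≤ ρ.len := Nat.find_min' hB ⟨hr, by rw [hs.2.2.1]; omega⟩
  obtain ⟨h3, h4⟩ := Nat.find_spec hA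
  obtain ⟨h5, h6⟩ := Nat.find_spec hB
  refine ⟨Nat.find hA, Nat.find hB, h3, h5, by omega, hle, ?_, ?_, fun _ => h6⟩
  · intro t h7 h8
    by_cases h9 : t ≤ r
    · exact h4 t h7 h9
    · have := Nat.find_min hB h8
      by_contra hcon
      exact this ⟨by omega, hcon⟩
  · intro t h7 h8
    refine Nat.find_min hA (m := t) (by omega) ⟨by omega, fun t' h9 h10 => ?_⟩
    by_cases h11 : t' = t
    · subst h11; exact h8
    · exact h4 t' (by omega) h10

/-- The parity of the first level tells at which border the factor enters, so the level fixes the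
starting time, and maximality fixes the end. -/
theorem Intercepted.eq_of_level_eq (hs : ρ.IsSuccessful) {x₁ x₂ s e s' e' : ℕ}
    (h : ρ.Intercepted (x₁, x₂) s e) (h' : ρ.Intercepted (x₁, x₂) s' e')
    (hl : ρ.level s = ρ.level s') : s = s' ∧ e = e' := by
  have h1 := h.entry hs
  have h2 := h'.entry hs
  rw [hl] at h1
  have hpos : ρ.pos s = ρ.pos s' := by
    have := Nat.not_even_iff_odd (n := ρ.level s')
    rcases h1 with h1 | h1 <;> rcases h2 with h2 | h2
    · omega
    · exact absurd h1.1 (this.2 h2.1)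
    · exact absurd h2.1 (this.2 h1.1)
    · omega
  have hss := ρ.eq_of_level_eq hpos hl
  subst hss
  refine ⟨rfl, ?_⟩
  by_contra hne
  obtain ⟨h3, h4, h5, -, h6⟩ := h
  obtain ⟨h3', h4', h5', -, h6'⟩ := h'
  rcases lt_or_gt_of_ne hne with h7 | h7
  · exact h6 (by omega) (h5' e (by omega) h7)
  · exact h6' (by omega) (h5 e' (by omega) h7)

/-! ### Times of visits -/

open Classical in
/-- The time of the visit of position `x` at level `y`. -/
noncomputable def visit (ρ : T.Run u) (x y : ℕ) : ℕ :=
  if h : ∃ t ≤ ρ.len, ρ.pos t = x ∧ ρ.level t = y then h.choose else 0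

theorem visit_spec {x y : ℕ} (h : y < ρ.width x) :
    ρ.visit x y ≤ ρ.len ∧ ρ.pos (ρ.visit x y) = x ∧ ρ.level (ρ.visit x y) = y := by
  have h' : ∃ t ≤ ρ.len, ρ.pos t = x ∧ ρ.level t = y := by
    obtain ⟨s, h1, h2⟩ := ρ.exists_visit h
    exact ⟨s, by omega, h2⟩
  unfold visit
  rw [dif_pos h']
  exact h'.choose_spec

theorem visit_pos_level {t : ℕ} (ht : t ≤ ρ.len) : ρ.visit (ρ.pos t) (ρ.level t) = t := by
  have := visit_spec (ρ.level_lt_width ht)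
  exact ρ.eq_of_level_eq this.2.1 this.2.2

theorem visit_lt_visit {x y y' : ℕ} (hy' : y' < ρ.width x) (h : y < y') :
    ρ.visit x y < ρ.visit x y' := by
  have h1 := visit_spec (ρ := ρ) (h.trans hy')
  have h2 := visit_spec hy'
  by_contra hcon
  have := ρ.level_le (s := ρ.visit x y') (t := ρ.visit x y) (by omega) (by omega)
  omega

theorem visit_le_visit {x y y' : ℕ} (hy' : y' < ρ.width x) (h : y ≤ y') :
    ρ.visit x y ≤ ρ.visit x y' := by
  rcases h.eq_or_lt with rfl | h
  · exact le_rfl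
  · exact (visit_lt_visit hy' h).le

theorem visit_ne_visit {x x' y y' : ℕ} (hx : x ≠ x') (hy : y < ρ.width x)
    (hy' : y' < ρ.width x') : ρ.visit x y ≠ ρ.visit x' y' := by
  intro h
  have h1 := visit_spec hy
  have h2 := visit_spec hy'
  rw [h] at h1
  omega

/-! ### Homogeneous sequences of positions -/

/-- Four positions `z 0 < z 1 < z 2 < z 3`, each visited `k` times, such that for all pairs of them
the visits are interleaved in the same way: the visit of the left position at level `y` comes
before the visit of the right position at level `y'` if and only if `R y y'`. -/
structure Homogeneous (ρ : T.Run u) (z : ℕ → ℕ) (k : ℕ) (R : ℕ → ℕ → Prop) : Prop where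
  lt : ∀ i j, i < j → j ≤ 3 → z i < z j
  le : ∀ i ≤ 3, z i ≤ u.length
  width_eq : ∀ i ≤ 3, ρ.width (z i) = k
  rel_iff : ∀ i j, i < j → j ≤ 3 → ∀ y y', y < k → y' < k →
    (R y y' ↔ ρ.visit (z i) y < ρ.visit (z j) y')

variable {z : ℕ → ℕ} {k : ℕ} {R : ℕ → ℕ → Prop}

namespace Homogeneous

theorem visit_lt (h : ρ.Homogeneous z k R) {i y y' : ℕ} (hi : i ≤ 3) (hy' : y' < k)
    (hy : y < y') : ρ.visit (z i) y < ρ.visit (z i) y' :=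
  visit_lt_visit (by rw [h.width_eq i hi]; exact hy') hy

theorem visit_le (h : ρ.Homogeneous z k R) {i y y' : ℕ} (hi : i ≤ 3) (hy' : y' < k)
    (hy : y ≤ y') : ρ.visit (z i) y ≤ ρ.visit (z i) y' :=
  visit_le_visit (by rw [h.width_eq i hi]; exact hy') hy

theorem not_rel_iff (h : ρ.Homogeneous z k R) {i j y y' : ℕ} (hij : i < j) (hj : j ≤ 3)
    (hy : y < k) (hy' : y' < k) : ¬ R y y' ↔ ρ.visit (z j) y' < ρ.visit (z i) y := by
  rw [h.rel_iff i j hij hj y y' hy hy']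
  have := visit_ne_visit (ρ := ρ) (x := z i) (x' := z j) (y := y) (y' := y')
    (h.lt i j hij hj).ne (by rw [h.width_eq i (by omega)]; exact hy)
    (by rw [h.width_eq j hj]; exact hy')
  omega

theorem rel_mono (h : ρ.Homogeneous z k R) {a b a' b' : ℕ} (hab : R a b) (ha : a < k)
    (haa : a' ≤ a) (hbb : b ≤ b') (hb' : b' < k) : R a' b' := by
  rw [h.rel_iff 0 1 (by omega) (by omega) _ _ (by omega) (by omega)] at hab ⊢
  have := h.visit_le (i := 0) (by omega) ha haa
  have := h.visit_le (i := 1) (by omega) hb' hbb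
  omega

/-- The pairs `(0, 1)`, `(1, 2)` and `(0, 2)` share one pattern, so two successive comparisons
compose to a third. The same reason makes the complement of `R` transitive. -/
theorem rel_trans (h : ρ.Homogeneous z k R) {a b c : ℕ} (ha : a < k) (hb : b < k) (hc : c < k)
    (hab : R a b) (hbc : R b c) : R a c := by
  rw [h.rel_iff 0 1 (by omega) (by omega) _ _ ha hb] at hab
  rw [h.rel_iff 1 2 (by omega) (by omega) _ _ hb hc] at hbc
  rw [h.rel_iff 0 2 (by omega) (by omega) _ _ ha hc]
  omega

theorem not_rel_trans (h : ρ.Homogeneous z k R) {a b c : ℕ} (ha : a < k) (hb : b < k)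
    (hc : c < k) (hab : ¬ R a b) (hbc : ¬ R b c) : ¬ R a c := by
  rw [h.not_rel_iff (i := 0) (j := 1) (by omega) (by omega) ha hb] at hab
  rw [h.not_rel_iff (i := 1) (j := 2) (by omega) (by omega) hb hc] at hbc
  rw [h.not_rel_iff (i := 0) (j := 2) (by omega) (by omega) ha hc]
  omega

end Homogeneous

/-- Two levels are linked if they belong to the same component of a homogeneous sequence. -/
def Linked (R : ℕ → ℕ → Prop) (a b : ℕ) : Prop := R a b ↔ R b a

theorem Linked.symm {a b : ℕ} (h : Linked R a b) : Linked R b a := Iff.symm h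

namespace Homogeneous

/-- In the mixed cases, transitivity of `R` and of its complement would give both `R b b` and `¬ R b
b`. -/
theorem linked_trans (h : ρ.Homogeneous z k R) {a b c : ℕ} (ha : a < k) (hb : b < k)
    (hc : c < k) (hab : Linked R a b) (hbc : Linked R b c) : Linked R a c := by
  by_cases h1 : R a b
  · by_cases h2 : R b c
    · exact iff_of_true (h.rel_trans ha hb hc h1 h2) (h.rel_trans hc hb ha (hbc.1 h2) (hab.1 h1))
    · exact absurd (h.rel_trans hb ha hb (hab.1 h1) h1)
        (h.not_rel_trans hb hc hb h2 fun h3 => h2 (hbc.2 h3))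
  · by_cases h2 : R b c
    · exact absurd (h.rel_trans hb hc hb h2 (hbc.1 h2))
        (h.not_rel_trans hb ha hb (fun h3 => h1 (hab.2 h3)) h1)
    · exact iff_of_false (h.not_rel_trans ha hb hc h1 h2)
        (h.not_rel_trans hc hb ha (fun h3 => h2 (hbc.2 h3)) fun h3 => h1 (hab.2 h3))

/-- The alternatives are the two types of components. If `R b a`, all visits on levels `a` to `b` at
the left position precede those at the right one; if `¬ R a b`, they all follow them. -/
theorem linked_iff_of_le (h : ρ.Homogeneous z k R) {a b : ℕ} (hab : a ≤ b) (hb : b < k) :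
    Linked R a b ↔ (R b a ∨ ¬ R a b) := by
  unfold Linked
  have : R b a → R a b := fun h' => h.rel_mono h' hb hab hab hb
  tauto

theorem linked_of_linked (h : ρ.Homogeneous z k R) {a a' b b' : ℕ} (h1 : a ≤ a') (h2 : a' ≤ b')
    (h3 : b' ≤ b) (hb : b < k) (hab : Linked R a b) : Linked R a' b' := by
  rw [h.linked_iff_of_le (by omega) (by omega)] at hab ⊢
  rcases hab with hab | hab
  · exact Or.inl (h.rel_mono hab hb h3 h1 (by omega))
  · exact Or.inr fun h' => hab (h.rel_mono h' (by omega) h1 h3 hb)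

/-- Levels that are not linked are separated in time. -/
theorem visit_lt_visit_of_not_linked (h : ρ.Homogeneous z k R) {a b i j : ℕ} (hab : a < b)
    (hb : b < k) (hi : i ≤ 3) (hj : j ≤ 3) (hl : ¬ Linked R a b) :
    ρ.visit (z i) a < ρ.visit (z j) b := by
  rw [h.linked_iff_of_le hab.le hb] at hl
  push Not at hl
  rcases lt_trichotomy i j with hij | rfl | hij
  · exact (h.rel_iff i j hij hj _ _ (by omega) hb).1 hl.2
  · exact h.visit_lt hi hb hab
  · exact (h.not_rel_iff hij hi hb (by omega)).1 hl.1

end Homogeneous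

/-- `[m, M]` is a maximal interval of linked levels. -/
structure IsLinkClass (R : ℕ → ℕ → Prop) (k m M : ℕ) : Prop where
  le : m ≤ M
  lt : M < k
  linked : Linked R m M
  maximal : ∀ y < k, ∀ y', m ≤ y' → y' ≤ M → Linked R y y' → m ≤ y ∧ y ≤ M

namespace Homogeneous

theorem exists_isLinkClass (h : ρ.Homogeneous z k R) {y : ℕ} (hy : y < k) :
    ∃ m M, IsLinkClass R k m M ∧ m ≤ y ∧ y ≤ M := by
  classical
  have hE : ∃ m, m < k ∧ Linked R m y := ⟨y, hy, Iff.rfl⟩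
  have hG := Nat.findGreatest_spec (P := fun M => M < k ∧ Linked R y M) hy.le ⟨hy, Iff.rfl⟩
  have hG' := Nat.le_findGreatest (P := fun M => M < k ∧ Linked R y M) hy.le ⟨hy, Iff.rfl⟩
  have hG'' := fun M => Nat.findGreatest_is_greatest (P := fun M => M < k ∧ Linked R y M)
    (n := k) (k := M)
  obtain ⟨hm1, hm2⟩ := Nat.find_spec hE
  have hm3 := Nat.find_min' hE ⟨hy, Iff.rfl⟩
  have hm4 := fun m => Nat.find_min hE (m := m)
  generalize Nat.findGreatest (fun M => M < k ∧ Linked R y M) k = M at *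
  generalize Nat.find hE = m at *
  have hmM := h.linked_trans hm1 hy hG.1 hm2 hG.2
  refine ⟨m, M, ⟨by omega, hG.1, hmM, ?_⟩, hm3, hG'⟩
  intro a ha b hb1 hb2 hab
  have hyb : Linked R y b := by
    rcases le_total y b with h1 | h1
    · exact h.linked_of_linked le_rfl h1 hb2 hG.1 hG.2
    · exact (h.linked_of_linked hb1 h1 le_rfl hy hm2).symm
  have hya := h.linked_trans hy (by omega) ha hyb hab.symm
  constructor
  · by_contra hcon
    exact hm4 a (by omega) ⟨ha, hya.symm⟩
  · by_contra hcon
    exact hG'' a (by omega) ha.le ⟨ha, hya⟩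

theorem isLinkClass_unique {m M m' M' y : ℕ} (hC : IsLinkClass R k m M)
    (hC' : IsLinkClass R k m' M') (h : ρ.Homogeneous z k R) (h1 : m ≤ y) (h2 : y ≤ M)
    (h1' : m' ≤ y) (h2' : y ≤ M') : m = m' ∧ M = M' := by
  have l1 := h.linked_of_linked le_rfl h1 h2 hC.lt hC.linked
  have l2 := h.linked_of_linked h1 h2 le_rfl hC.lt hC.linked
  have l1' := h.linked_of_linked le_rfl h1' h2' hC'.lt hC'.linked
  have l2' := h.linked_of_linked h1' h2' le_rfl hC'.lt hC'.linked
  have hM := hC.lt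
  have hM' := hC'.lt
  have e1 := hC'.maximal m (by omega) y h1' h2' l1
  have e2 := hC'.maximal M (by omega) y h1' h2' l2.symm
  have e3 := hC.maximal m' (by omega) y h1 h2 l1'
  have e4 := hC.maximal M' (by omega) y h1 h2 l2'.symm
  omega

theorem linked_of_mem {m M y y' : ℕ} (h : ρ.Homogeneous z k R) (hC : IsLinkClass R k m M)
    (h1 : m ≤ y) (h2 : y ≤ M) (h1' : m ≤ y') (h2' : y' ≤ M) : Linked R y y' := by
  rcases le_total y y' with h3 | h3
  · exact h.linked_of_linked h1 h3 h2' hC.lt hC.linked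
  · exact (h.linked_of_linked h1' h3 h2 hC.lt hC.linked).symm

/-- The shape of the factors intercepted by the intervals of a homogeneous sequence. -/
theorem intercepted_cases (h : ρ.Homogeneous z k R) (hs : ρ.IsSuccessful) {i j s e : ℕ}
    (hij : i < j) (hj : j ≤ 3) (hI : ρ.Intercepted (z i, z j) s e) :
    ρ.level s < k ∧ ρ.level e < k ∧
    (ρ.level e = ρ.level s + 1 ∧ Linked R (ρ.level s) (ρ.level e) ∨
      (ρ.level e ≤ ρ.level s ∧ Linked R (ρ.level e) (ρ.level s) ∧
        (ρ.level s + 1 < k → ¬ Linked R (ρ.level s) (ρ.level s + 1)) ∧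
        (0 < ρ.level e → ¬ Linked R (ρ.level e - 1) (ρ.level e)) ∧
        (Even (ρ.level s) ∧ Even (ρ.level e) ∧ R (ρ.level s) (ρ.level e) ∨
          Odd (ρ.level s) ∧ Odd (ρ.level e) ∧ ¬ R (ρ.level e) (ρ.level s)))) := by
  have hen := hI.entry hs
  have hex := hI.exit hs (h.le j hj)
  have hse : s < e := hI.1
  have hel : e ≤ ρ.len := hI.2.1
  have hbet : ∀ t, s < t → t < e → ρ.pos t ≠ z i ∧ ρ.pos t ≠ z j := fun t h1 h2 => by
    have := hI.between h1 h2; omega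
  have hzij := h.lt i j hij hj
  have hwi := h.width_eq i (by omega)
  have hwj := h.width_eq j hj
  have hsk : ρ.level s < k := by
    have := ρ.level_lt_width (t := s) (by omega)
    rcases hen with h1 | h1 <;> rw [h1.2] at this <;> omega
  have hek : ρ.level e < k := by
    have := ρ.level_lt_width (t := e) (by omega)
    rcases hex with h1 | h1 <;> rw [h1.2] at this <;> omega
  have hvs := visit_pos_level (ρ := ρ) (t := s) (by omega)
  have hve := visit_pos_level (ρ := ρ) (t := e) (by omega)
  have hheads : z i ≤ ρ.head s ∧ ρ.head s < z j := hI.2.2.1 s le_rfl hse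
  have hvis_i : ∀ y < k, ¬ (s < ρ.visit (z i) y ∧ ρ.visit (z i) y < e) := by
    intro y hy h1
    have := visit_spec (ρ := ρ) (x := z i) (y := y) (by omega)
    exact (hbet _ h1.1 h1.2).1 this.2.1
  have hvis_j : ∀ y < k, ¬ (s < ρ.visit (z j) y ∧ ρ.visit (z j) y < e) := by
    intro y hy h1
    have := visit_spec (ρ := ρ) (x := z j) (y := y) (by omega)
    exact (hbet _ h1.1 h1.2).2 this.2.1
  refine ⟨hsk, hek, ?_⟩
  generalize hy : ρ.level s = y at *
  generalize hy' : ρ.level e = y' at *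
  have hR := fun a b => h.rel_iff i j hij hj a b
  have hS := fun a b ha hb => h.not_rel_iff (i := i) (j := j) (y := a) (y' := b) hij hj ha hb
  have hmi := fun a b hb hab => h.visit_lt (i := i) (y := a) (y' := b) (by omega) hb hab
  have hmj := fun a b hb hab => h.visit_lt (i := j) (y := a) (y' := b) (by omega) hb hab
  have hmi' := fun a b hb hab => h.visit_le (i := i) (y := a) (y' := b) (by omega) hb hab
  have hmj' := fun a b hb hab => h.visit_le (i := j) (y := a) (y' := b) (by omega) hb hab
  rcases hen with ⟨hpy, hps⟩ | ⟨hpy, hps⟩ <;> rcases hex with ⟨hpy', hpe⟩ | ⟨hpy', hpe⟩ <;>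
    rw [hps] at hvs <;> rw [hpe] at hve
  · -- a left-to-left factor
    left
    have hyy : y < y' := by
      by_contra hcon
      have := hmi' y' y hsk (by omega)
      omega
    have hyy' : y' = y + 1 := by
      by_contra hcon
      have h1 := hmi y (y + 1) (by omega) (by omega)
      have h2 := hmi (y + 1) y' hek (by omega)
      exact hvis_i (y + 1) (by omega) (by omega)
    -- If the levels were not linked, the right position would have been visited `y + 1` times up to
    -- time `s`. This number is odd, so the head would already be beyond the right border.
    refine ⟨hyy', ?_⟩
    rw [h.linked_iff_of_le hyy.le hek]
    by_contra hcon
    push Not at hcon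
    have h1 := (hS y' y hek hsk).1 hcon.1
    have h2 := (hR y y' hsk hek).1 hcon.2
    have h3 := hvis_j y hsk
    have h4 := visit_ne_visit (ρ := ρ) (x := z i) (x' := z j) (y := y) (y' := y) hzij.ne
      (by omega) (by omega)
    have h5 : ρ.visits (s + 1) (z j) = y + 1 := by
      have e1 := visit_spec (ρ := ρ) (x := z j) (y := y) (by omega)
      have e2 := visit_spec (ρ := ρ) (x := z j) (y := y') (by omega)
      have e3 := ρ.visits_succ_pos (ρ.visit (z j) y)
      rw [e1.2.1, e1.2.2] at e3
      have e4 := ρ.visits_mono (s := ρ.visit (z j) y + 1) (t := s + 1) (by omega) (z j)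
      have e5 := ρ.level_eq_visits (ρ.visit (z j) y')
      rw [e2.2.1, e2.2.2] at e5
      have e6 := ρ.visits_mono (s := s + 1) (t := ρ.visit (z j) y') (by omega) (z j)
      omega
    have h6 := (ρ.odd_visits_iff hs.1 (t := s) (by omega) (z j)).1
      (by rw [h5]; exact hpy.add_one)
    omega
  · -- a left-to-right factor
    right
    have hRyy : R y y' := (hR y y' hsk hek).2 (by omega)
    have hS1 : 0 < y' → ¬ R y (y' - 1) := by
      intro h0
      rw [hS y (y' - 1) hsk (by omega)]
      have h1 := hmj (y' - 1) y' hek (by omega)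
      have h2 := hvis_j (y' - 1) (by omega)
      have h3 := visit_ne_visit (ρ := ρ) (x := z i) (x' := z j) (y := y) (y' := y' - 1) hzij.ne
        (by omega) (by omega)
      omega
    have hS2 : y + 1 < k → ¬ R (y + 1) y' := by
      intro h0
      rw [hS (y + 1) y' h0 hek]
      have h1 := hmi y (y + 1) h0 (by omega)
      have h2 := hvis_i (y + 1) h0
      have h3 := visit_ne_visit (ρ := ρ) (x := z i) (x' := z j) (y := y + 1) (y' := y') hzij.ne
        (by omega) (by omega)
      omega
    -- If the level increased, parity would leave room for `y + 1 ≤ y' - 1`, and transitivity of the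
    -- complement would contradict `R y y'`.
    have hle : y' ≤ y := by
      by_contra hcon
      have h1 : y + 1 ≤ y' - 1 := by
        obtain ⟨a, ha⟩ := hpy
        obtain ⟨b, hb⟩ := hpy'
        omega
      have h2 : ¬ R (y' - 1) y' := fun h' => hS2 (by omega)
        (h.rel_mono h' (by omega) h1 le_rfl hek)
      exact h.not_rel_trans hsk (by omega) hek (hS1 (by omega)) h2 hRyy
    refine ⟨hle, (h.linked_iff_of_le hle hsk).2 (Or.inl hRyy), ?_, ?_, Or.inl ⟨hpy, hpy', hRyy⟩⟩
    · intro h0 hl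
      have h1 : R y y := h.rel_mono hRyy hsk le_rfl hle hsk
      have h2 : R y (y + 1) := h.rel_mono h1 hsk le_rfl (by omega) h0
      exact hS2 h0 (h.rel_trans h0 hsk hek (hl.1 h2) hRyy)
    · intro h0 hl
      have h1 : R y' y' := h.rel_mono hRyy hsk hle le_rfl hek
      have h2 : R (y' - 1) y' := h.rel_mono h1 hek (by omega) le_rfl hek
      exact hS1 h0 (h.rel_trans hsk hek (by omega) hRyy (hl.1 h2))
  · -- a right-to-left factor
    right
    have hSyy : ¬ R y' y := (hS y' y hek hsk).2 (by omega)
    have hR1 : 0 < y' → R (y' - 1) y := by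
      intro h0
      rw [hR (y' - 1) y (by omega) hsk]
      have h1 := hmi (y' - 1) y' hek (by omega)
      have h2 := hvis_i (y' - 1) (by omega)
      have h3 := visit_ne_visit (ρ := ρ) (x := z i) (x' := z j) (y := y' - 1) (y' := y) hzij.ne
        (by omega) (by omega)
      omega
    have hR2 : y + 1 < k → R y' (y + 1) := by
      intro h0
      rw [hR y' (y + 1) hek h0]
      have h1 := hmj y (y + 1) h0 (by omega)
      have h2 := hvis_j (y + 1) h0
      have h3 := visit_ne_visit (ρ := ρ) (x := z i) (x' := z j) (y := y') (y' := y + 1) hzij.ne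
        (by omega) (by omega)
      omega
    have hle : y' ≤ y := by
      by_contra hcon
      have h1 : y + 1 ≤ y' - 1 := by
        obtain ⟨a, ha⟩ := hpy
        obtain ⟨b, hb⟩ := hpy'
        omega
      have h2 : R y' (y' - 1) := h.rel_mono (hR2 (by omega)) hek le_rfl h1 (by omega)
      exact hSyy (h.rel_trans hek (by omega) hsk h2 (hR1 (by omega)))
    refine ⟨hle, (h.linked_iff_of_le hle hsk).2 (Or.inr hSyy), ?_, ?_,
      Or.inr ⟨hpy, hpy', hSyy⟩⟩
    · intro h0 hl
      have h1 : ¬ R y y := fun h' => hSyy (h.rel_mono h' hsk hle le_rfl hsk)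
      have h2 : ¬ R (y + 1) y := fun h' => h1 (h.rel_mono h' h0 (by omega) le_rfl hsk)
      exact h.not_rel_trans hek hsk h0 hSyy (fun h' => h2 (hl.1 h')) (hR2 h0)
    · intro h0 hl
      have h1 : ¬ R y' y' := fun h' => hSyy (h.rel_mono h' hek le_rfl hle hsk)
      have h2 : ¬ R y' (y' - 1) := fun h' => h1 (h.rel_mono h' hek le_rfl (by omega) hek)
      exact h.not_rel_trans (by omega) hek hsk (fun h' => h2 (hl.1 h')) hSyy (hR1 h0)
  · -- a right-to-right factor
    left
    have hyy : y < y' := by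
      by_contra hcon
      have := hmj' y' y hsk (by omega)
      omega
    have hyy' : y' = y + 1 := by
      by_contra hcon
      have h1 := hmj y (y + 1) (by omega) (by omega)
      have h2 := hmj (y + 1) y' hek (by omega)
      exact hvis_j (y + 1) (by omega) (by omega)
    refine ⟨hyy', ?_⟩
    rw [h.linked_iff_of_le hyy.le hek]
    by_contra hcon
    push Not at hcon
    have h1 := (hS y' y hek hsk).1 hcon.1
    have h2 := (hR y y' hsk hek).1 hcon.2
    have h3 := hvis_i y hsk
    have h4 := visit_ne_visit (ρ := ρ) (x := z i) (x' := z j) (y := y) (y' := y) hzij.ne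
      (by omega) (by omega)
    have h5 : ρ.visits (s + 1) (z i) = y + 1 := by
      have e1 := visit_spec (ρ := ρ) (x := z i) (y := y) (by omega)
      have e2 := visit_spec (ρ := ρ) (x := z i) (y := y') (by omega)
      have e3 := ρ.visits_succ_pos (ρ.visit (z i) y)
      rw [e1.2.1, e1.2.2] at e3
      have e4 := ρ.visits_mono (s := ρ.visit (z i) y + 1) (t := s + 1) (by omega) (z i)
      have e5 := ρ.level_eq_visits (ρ.visit (z i) y')
      rw [e2.2.1, e2.2.2] at e5
      have e6 := ρ.visits_mono (s := s + 1) (t := ρ.visit (z i) y') (by omega) (z i)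
      omega
    have h6 := (ρ.odd_visits_iff hs.1 (t := s) (by omega) (z i)).2 hheads.1
    rw [h5] at h6
    exact absurd hpy.add_one (Nat.not_even_iff_odd.2 h6)

end Homogeneous

end Run

end TwoWayTransducer

/-! ### The flow of a homogeneous sequence: cycles, idempotency and traces -/

namespace TwoWayTransducer

namespace Run

variable {Q A Γ : Type*} {T : TwoWayTransducer Q A Γ} {u : List A} {ρ : T.Run u}
  {z : ℕ → ℕ} {k : ℕ} {R : ℕ → ℕ → Prop}

/-- The edges of the flow of a homogeneous sequence: every class `[m, M]` forms the cycle
`m → m + 1 → … → M → m`. -/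
def CycleEdge (R : ℕ → ℕ → Prop) (k y y' : ℕ) : Prop :=
  ∃ m M, IsLinkClass R k m M ∧ m ≤ y ∧ y ≤ M ∧ (y < M ∧ y' = y + 1 ∨ y = M ∧ y' = m)

namespace Homogeneous

theorem cycleEdge_iff (h : ρ.Homogeneous z k R) {m M y y' : ℕ} (hC : IsLinkClass R k m M)
    (h1 : m ≤ y) (h2 : y ≤ M) :
    CycleEdge R k y y' ↔ (y < M ∧ y' = y + 1 ∨ y = M ∧ y' = m) := by
  constructor
  · rintro ⟨m', M', hC', h1', h2', h3⟩
    obtain ⟨rfl, rfl⟩ := isLinkClass_unique hC hC' h h1 h2 h1' h2'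
    exact h3
  · intro h3
    exact ⟨m, M, hC, h1, h2, h3⟩

/-- A U-turn climbs one level inside a class. A traversal starts at a level not linked to the next
one and ends at a level not linked to the previous one, so it leads from the maximum of the class to
its minimum. -/
theorem cycleEdge_of_flow (h : ρ.Homogeneous z k R) (hs : ρ.IsSuccessful) {i j y y' : ℕ}
    (hij : i < j) (hj : j ≤ 3) (hF : ρ.flow (z i, z j) y y') : CycleEdge R k y y' := by
  obtain ⟨s, e, hI, rfl, rfl⟩ := hF
  obtain ⟨hsk, hek, hcase⟩ := h.intercepted_cases hs hij hj hI
  obtain ⟨m, M, hC, h1, h2⟩ := h.exists_isLinkClass hsk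
  refine ⟨m, M, hC, h1, h2, ?_⟩
  rcases hcase with ⟨h3, h4⟩ | ⟨h3, h4, h5, h6, -⟩
  · have := hC.maximal _ hek _ h1 h2 h4.symm
    omega
  · have h7 := hC.maximal _ hek _ h1 h2 h4
    right
    constructor
    · by_contra hcon
      have := hC.lt
      exact h5 (by omega) (h.linked_of_mem hC h1 h2 (by omega) (by omega))
    · by_contra hcon
      exact h6 (by omega) (h.linked_of_mem hC (by omega) (by omega) h7.1 h7.2)

theorem exists_intercepted_level (h : ρ.Homogeneous z k R) (hs : ρ.IsSuccessful) {i j y : ℕ}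
    (hij : i < j) (hj : j ≤ 3) (hy : y < k) :
    ∃ s e, ρ.Intercepted (z i, z j) s e ∧ ρ.level s = y := by
  have hz := h.lt i j hij hj
  have hn := h.le j hj
  have hlen := hs.2.2.1
  obtain ⟨t, htl, hty, ht⟩ : ∃ t ≤ ρ.len, ρ.level t = y ∧
      (ρ.pos t = z i ∧ ρ.head t = z i ∨ ρ.pos t = z j ∧ ρ.head t + 1 = z j) := by
    rcases Nat.even_or_odd y with hpar | hpar
    · have h1 := visit_spec (ρ := ρ) (x := z i) (y := y) (by rw [h.width_eq i (by omega)]; exact hy)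
      refine ⟨_, h1.1, h1.2.2, Or.inl ⟨h1.2.1, ?_⟩⟩
      have := (ρ.even_level_iff hs.1 h1.1).1 (by rw [h1.2.2]; exact hpar)
      omega
    · have h1 := visit_spec (ρ := ρ) (x := z j) (y := y) (by rw [h.width_eq j hj]; exact hy)
      refine ⟨_, h1.1, h1.2.2, Or.inr ⟨h1.2.1, ?_⟩⟩
      have := (ρ.odd_level_iff hs.1 h1.1).1 (by rw [h1.2.2]; exact hpar)
      omega
  have htl' : t < ρ.len := by
    rcases htl.eq_or_lt with rfl | h1
    · omega
    · exact h1
  obtain ⟨s, e, h1, h2, hI⟩ := exists_intercepted hs hn htl' (x₁ := z i) (by omega) (by omega)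
  have hst : s = t := by
    by_contra hcon
    have := hI.between (t := t) (by omega) h2
    omega
  exact ⟨s, e, hI, by rw [hst, hty]⟩

/-- Every level has an outgoing intercepted factor, and cycle edges are deterministic; hence
inclusion implies equality. -/
theorem flow_iff (h : ρ.Homogeneous z k R) (hs : ρ.IsSuccessful) {i j y y' : ℕ}
    (hij : i < j) (hj : j ≤ 3) : ρ.flow (z i, z j) y y' ↔ CycleEdge R k y y' := by
  refine ⟨h.cycleEdge_of_flow hs hij hj, ?_⟩
  rintro ⟨m, M, hC, h1, h2, h3⟩
  obtain ⟨s, e, hI, hl⟩ := h.exists_intercepted_level hs hij hj (lt_of_le_of_lt h2 hC.lt)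
  have h4 := (h.cycleEdge_iff hC h1 h2).1
    (h.cycleEdge_of_flow hs hij hj ⟨s, e, hI, hl, rfl⟩)
  exact ⟨s, e, hI, hl, by omega⟩

/-- The edge leaving `M` returns to `m ≤ M`, so it is not a U-turn: its two ends have equal parity,
and its direction tells how `R` relates them. -/
theorem class_parity (h : ρ.Homogeneous z k R) (hs : ρ.IsSuccessful) {m M : ℕ}
    (hC : IsLinkClass R k m M) :
    Even m ∧ Even M ∧ R M m ∨ Odd m ∧ Odd M ∧ ¬ R m M := by
  obtain ⟨s, e, hI, hl⟩ := h.exists_intercepted_level hs (i := 0) (j := 1) (by omega) (by omega)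
    hC.lt
  have h1 := (h.cycleEdge_iff hC hC.le le_rfl).1
    (h.cycleEdge_of_flow hs (by omega) (by omega) ⟨s, e, hI, hl, rfl⟩)
  have h2 : ρ.level e = m := by omega
  have h3 := (h.intercepted_cases hs (by omega) (by omega) hI).2.2
  rw [hl, h2] at h3
  have := hC.le
  rcases h3 with h3 | ⟨-, -, -, -, h3 | h3⟩
  · omega
  · exact Or.inl ⟨h3.2.1, h3.1, h3.2.2⟩
  · exact Or.inr ⟨h3.2.1, h3.1, h3.2.2⟩

/-- Edges between nodes of the same parity lead from the maximum of a class to its minimum. -/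
theorem cycleEdge_same_parity {m M y y' : ℕ} (h : ρ.Homogeneous z k R)
    (hC : IsLinkClass R k m M) (h1 : m ≤ y) (h2 : y ≤ M) (hF : CycleEdge R k y y')
    (hpar : Even y ↔ Even y') : y = M ∧ y' = m := by
  rcases (h.cycleEdge_iff hC h1 h2).1 hF with h3 | h3
  · rw [h3.2, Nat.even_add_one] at hpar
    tauto
  · exact h3

theorem cycleEdge_mem {m M y y' : ℕ} (h : ρ.Homogeneous z k R)
    (hC : IsLinkClass R k m M) (h1 : m ≤ y) (h2 : y ≤ M) (hF : CycleEdge R k y y') :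
    m ≤ y' ∧ y' ≤ M := by
  have := (h.cycleEdge_iff hC h1 h2).1 hF
  omega

theorem reflTransGen_mem {m M y y' : ℕ} {r : ℕ → ℕ → Prop}
    (hr : ∀ a b, m ≤ a → a ≤ M → r a b → m ≤ b ∧ b ≤ M)
    (h1 : m ≤ y) (h2 : y ≤ M) (hF : Relation.ReflTransGen r y y') : m ≤ y' ∧ y' ≤ M := by
  induction hF with
  | refl => exact ⟨h1, h2⟩
  | tail _ hstep ih => exact hr _ _ ih.1 ih.2 hstep

theorem reflTransGen_two_steps (h : ρ.Homogeneous z k R) {m M : ℕ}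
    (hC : IsLinkClass R k m M) {f g : (ℕ → ℕ → Prop) → ℕ → ℕ → Prop}
    (hf : ∀ i, CycleEdge R k (m + 2 * i) (m + 2 * i + 1) →
      f (CycleEdge R k) (m + 2 * i) (m + 2 * i + 1))
    (hg : ∀ i, CycleEdge R k (m + 2 * i + 1) (m + 2 * i + 2) →
      g (CycleEdge R k) (m + 2 * i + 1) (m + 2 * i + 2)) (i : ℕ) (hi : m + 2 * i ≤ M) :
    Relation.ReflTransGen (Relation.Comp (f (CycleEdge R k)) (g (CycleEdge R k))) m
      (m + 2 * i) := by
  induction i with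
  | zero => exact Relation.ReflTransGen.refl
  | succ i ih =>
    refine (ih (by omega)).tail ⟨m + 2 * i + 1, hf i ?_, hg i ?_⟩
    · rw [h.cycleEdge_iff hC (by omega) (by omega)]; omega
    · rw [h.cycleEdge_iff hC (by omega) (by omega)]; omega

/-- The only edge between levels of equal parity in a class is the one from its maximum to its
minimum. In the product, this edge arises from a traversal, the U-turns up the cycle, and a second
traversal, while U-turns come directly from the factors. -/
theorem flowMul_cycleEdge (h : ρ.Homogeneous z k R) (hs : ρ.IsSuccessful) (y y' : ℕ) :
    flowMul (CycleEdge R k) (CycleEdge R k) y y' ↔ CycleEdge R k y y' := by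
  have hclass : ∀ a b, CycleEdge R k a b → ∃ m M, IsLinkClass R k m M ∧ m ≤ a ∧ a ≤ M := by
    rintro a b ⟨m, M, hC, h1, h2, -⟩
    exact ⟨m, M, hC, h1, h2⟩
  have hcomp : ∀ {m M} (hC : IsLinkClass R k m M) (r r' : ℕ → ℕ → Prop),
      (∀ a b, r a b → CycleEdge R k a b) → (∀ a b, r' a b → CycleEdge R k a b) →
      ∀ a b, m ≤ a → a ≤ M → Relation.Comp r r' a b → m ≤ b ∧ b ≤ M := by
    rintro m M hC r r' hr hr' a b h1 h2 ⟨c, h3, h4⟩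
    have h5 := h.cycleEdge_mem hC h1 h2 (hr _ _ h3)
    exact h.cycleEdge_mem hC h5.1 h5.2 (hr' _ _ h4)
  have hpar : ∀ n : ℕ, ¬ (Even n ∧ Odd n) := fun n hn => by
    have := Nat.not_even_iff_odd.2 hn.2; exact this hn.1
  constructor
  · rintro (⟨a, h1, b, h2, h3⟩ | ⟨a, h1, b, h2, h3⟩ | h1 | ⟨a, h1, b, h2, c, h3, h4⟩ | h1 |
      ⟨a, h1, b, h2, c, h3, h4⟩)
    · obtain ⟨m, M, hC, g1, g2⟩ := hclass _ _ h1.1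
      have g3 := h.cycleEdge_same_parity hC g1 g2 h1.1 (iff_of_true h1.2.1 h1.2.2)
      have hle := hC.le
      have g4 := reflTransGen_mem (hcomp hC _ _ (fun _ _ h => h.1) (fun _ _ h => h.1))
        (by omega : m ≤ a) (by omega) h2
      have g5 := h.cycleEdge_same_parity hC g4.1 g4.2 h3.1 (iff_of_true h3.2.1 h3.2.2)
      rw [h.cycleEdge_iff hC g1 g2]; omega
    · obtain ⟨m, M, hC, g1, g2⟩ := hclass _ _ h1.1
      have g3 := h.cycleEdge_same_parity hC g1 g2 h1.1
        (iff_of_false (fun h' => hpar _ ⟨h', h1.2.1⟩) (fun h' => hpar _ ⟨h', h1.2.2⟩))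
      have hle := hC.le
      have g4 := reflTransGen_mem (hcomp hC _ _ (fun _ _ h => h.1) (fun _ _ h => h.1))
        (by omega : m ≤ a) (by omega) h2
      have g5 := h.cycleEdge_same_parity hC g4.1 g4.2 h3.1
        (iff_of_false (fun h' => hpar _ ⟨h', h3.2.1⟩) (fun h' => hpar _ ⟨h', h3.2.2⟩))
      rw [h.cycleEdge_iff hC g1 g2]; omega
    · exact h1.1
    -- A composite U-turn would need both a left-right and a right-left traversal in one class, but
    -- a class has only one traversal edge.
    · exfalso
      obtain ⟨m, M, hC, g1, g2⟩ := hclass _ _ h1.1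
      have g3 := h.cycleEdge_same_parity hC g1 g2 h1.1 (iff_of_true h1.2.1 h1.2.2)
      have hle := hC.le
      have g4 := reflTransGen_mem (hcomp hC _ _ (fun _ _ h => h.1) (fun _ _ h => h.1))
        (by omega : m ≤ a) (by omega) h2
      have g5 := h.cycleEdge_mem hC g4.1 g4.2 h3.1
      have g6 := h.cycleEdge_same_parity hC g5.1 g5.2 h4.1
        (iff_of_false (fun h' => hpar _ ⟨h', h4.2.1⟩) (fun h' => hpar _ ⟨h', h4.2.2⟩))
      have g7 : y = c := by omega
      exact hpar c ⟨g7 ▸ h1.2.1, h4.2.1⟩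
    · exact h1.1
    · exfalso
      obtain ⟨m, M, hC, g1, g2⟩ := hclass _ _ h1.1
      have g3 := h.cycleEdge_same_parity hC g1 g2 h1.1
        (iff_of_false (fun h' => hpar _ ⟨h', h1.2.1⟩) (fun h' => hpar _ ⟨h', h1.2.2⟩))
      have hle := hC.le
      have g4 := reflTransGen_mem (hcomp hC _ _ (fun _ _ h => h.1) (fun _ _ h => h.1))
        (by omega : m ≤ a) (by omega) h2
      have g5 := h.cycleEdge_mem hC g4.1 g4.2 h3.1
      have g6 := h.cycleEdge_same_parity hC g5.1 g5.2 h4.1 (iff_of_true h4.2.1 h4.2.2)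
      have g7 : y = c := by omega
      exact hpar c ⟨h4.2.1, g7 ▸ h1.2.1⟩
  · intro hF
    obtain ⟨m, M, hC, h1, h2⟩ := hclass _ _ hF
    have hle := hC.le
    have hMm : CycleEdge R k M m := (h.cycleEdge_iff hC hle le_rfl).2 (Or.inr ⟨rfl, rfl⟩)
    have hmM := h.class_parity hs hC
    rcases Nat.even_or_odd y with hy | hy <;> rcases Nat.even_or_odd y' with hy' | hy'
    · left
      obtain ⟨rfl, rfl⟩ := h.cycleEdge_same_parity hC h1 h2 hF (iff_of_true hy hy')
      refine ⟨y', ⟨hMm, hy, hy'⟩, y, ?_, ⟨hMm, hy, hy'⟩⟩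
      obtain ⟨a, ha⟩ := hy
      obtain ⟨b, hb⟩ := hy'
      have := h.reflTransGen_two_steps hC (f := flowLL) (g := flowRR)
        (fun i hi => ⟨hi, ⟨b + i, by omega⟩, ⟨b + i, by omega⟩⟩)
        (fun i hi => ⟨hi, ⟨b + i, by omega⟩, ⟨b + i + 1, by omega⟩⟩) (a - b) (by omega)
      rwa [show y' + 2 * (a - b) = y by omega] at this
    · right; right; left
      exact ⟨hF, hy, hy'⟩
    · right; right; right; right; left
      exact ⟨hF, hy, hy'⟩
    · right; left
      obtain ⟨rfl, rfl⟩ := h.cycleEdge_same_parity hC h1 h2 hF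
        (iff_of_false (fun h' => hpar _ ⟨h', hy⟩) (fun h' => hpar _ ⟨h', hy'⟩))
      refine ⟨y', ⟨hMm, hy, hy'⟩, y, ?_, ⟨hMm, hy, hy'⟩⟩
      obtain ⟨a, ha⟩ := hy
      obtain ⟨b, hb⟩ := hy'
      have := h.reflTransGen_two_steps hC (f := flowRR) (g := flowLL)
        (fun i hi => ⟨hi, ⟨b + i, by omega⟩, ⟨b + i + 1, by omega⟩⟩)
        (fun i hi => ⟨hi, ⟨b + i + 1, by omega⟩, ⟨b + i + 1, by omega⟩⟩) (a - b) (by omega)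
      rwa [show y' + 2 * (a - b) = y by omega] at this

theorem flow_eq (h : ρ.Homogeneous z k R) (hs : ρ.IsSuccessful) {i j : ℕ}
    (hij : i < j) (hj : j ≤ 3) : ρ.flow (z i, z j) = CycleEdge R k := by
  funext y y'
  exact propext (h.flow_iff hs hij hj)

/-- The intervals between positions of a homogeneous sequence are idempotent loops, provided that
the crossing sequences at these positions are equal. -/
theorem isIdempotentLoop (h : ρ.Homogeneous z k R) (hs : ρ.IsSuccessful) {i j : ℕ}
    (hij : i < j) (hj : j ≤ 3) (hc : ρ.crossing (z i) = ρ.crossing (z j)) :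
    ρ.IsIdempotentLoop (z i, z j) := by
  refine ⟨⟨h.lt i j hij hj, h.le j hj, hc⟩, ?_⟩
  intro y y'
  rw [h.flow_eq hs hij hj]
  exact h.flowMul_cycleEdge hs y y'

theorem reflTransGen_of_mem (h : ρ.Homogeneous z k R) {m M y y' : ℕ}
    (hC : IsLinkClass R k m M) (h1 : m ≤ y) (h2 : y ≤ M) (h1' : m ≤ y') (h2' : y' ≤ M) :
    Relation.ReflTransGen (CycleEdge R k) y y' := by
  have hup : ∀ a b, m ≤ a → a ≤ b → b ≤ M → Relation.ReflTransGen (CycleEdge R k) a b := by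
    intro a b h3 h4 h5
    induction b, h4 using Nat.le_induction with
    | base => exact Relation.ReflTransGen.refl
    | succ b h4 ih =>
      refine (ih (by omega)).tail ?_
      rw [h.cycleEdge_iff hC (by omega) (by omega)]; omega
  have hMm : CycleEdge R k M m := (h.cycleEdge_iff hC hC.le le_rfl).2 (Or.inr ⟨rfl, rfl⟩)
  exact ((hup y M h1 h2 le_rfl).tail hMm).trans (hup m y' le_rfl h1' h2')

theorem isComponent (h : ρ.Homogeneous z k R) (hs : ρ.IsSuccessful) {i j m M : ℕ}
    (hij : i < j) (hj : j ≤ 3) (hC : IsLinkClass R k m M) :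
    ρ.IsComponent (z i, z j) (Set.Icc m M) := by
  refine ⟨M, ?_, ?_⟩
  · rw [length_crossing, h.width_eq i (by omega)]
    exact hC.lt
  · ext y
    rw [Set.mem_Icc, Set.mem_ofPred, h.flow_eq hs hij hj]
    constructor
    · rintro ⟨h1, h2⟩
      exact ⟨h.reflTransGen_of_mem hC hC.le le_rfl h1 h2,
        h.reflTransGen_of_mem hC h1 h2 hC.le le_rfl⟩
    · rintro ⟨h1, -⟩
      exact reflTransGen_mem (fun a b h3 h4 h5 => h.cycleEdge_mem hC h3 h4 h5) hC.le le_rfl h1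

/-- The trace of the anchor point of a class exists, and it contains all factors of the class. -/
theorem exists_isTrace (h : ρ.Homogeneous z k R) (hs : ρ.IsSuccessful) {i j m M : ℕ}
    (hij : i < j) (hj : j ≤ 3) (hC : IsLinkClass R k m M) :
    ∃ fs, ρ.IsTrace (z i, z j) M fs ∧ ∀ s e, ρ.Intercepted (z i, z j) s e →
      m ≤ ρ.level s → ρ.level s ≤ M → (s, e) ∈ fs := by
  have hex : ∀ y, ∃ f : ℕ × ℕ, y < k →
      ρ.Intercepted (z i, z j) f.1 f.2 ∧ ρ.level f.1 = y := by
    intro y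
    by_cases hy : y < k
    · obtain ⟨s, e, h1, h2⟩ := h.exists_intercepted_level hs hij hj hy
      exact ⟨(s, e), fun _ => ⟨h1, h2⟩⟩
    · exact ⟨(0, 0), fun h' => absurd h' hy⟩
  choose g hg using hex
  have hle := hC.le
  have hlt := hC.lt
  have hedge : ∀ y, m ≤ y → y ≤ M →
      (y < M ∧ ρ.level (g y).2 = y + 1 ∨ y = M ∧ ρ.level (g y).2 = m) := by
    intro y h1 h2
    have h3 := hg y (by omega)
    exact (h.cycleEdge_iff hC h1 h2).1 (h.cycleEdge_of_flow hs hij hj ⟨_, _, h3.1, h3.2, rfl⟩)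
  have hmem : ∀ y ∈ M :: List.range' m (M - m), m ≤ y ∧ y ≤ M := by
    intro y hy
    rw [List.mem_cons, List.mem_range'_1] at hy
    omega
  have hlev : (M :: List.range' m (M - m)).map (fun y => ρ.level (g y).1) =
      M :: List.range' m (M - m) := by
    conv_rhs => rw [← List.map_id (M :: List.range' m (M - m))]
    apply List.map_congr_left
    intro y hy
    have := hmem y hy
    exact (hg y (by omega)).2
  -- The cycle is listed from `M`: the traversal to `m` comes first, then the U-turns up to `M`. For
  -- `m = M` only the traversal remains.
  refine ⟨(M :: List.range' m (M - m)).map g, ⟨?_, ?_, ?_, ?_, ?_⟩, ?_⟩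
  · intro f hf
    obtain ⟨y, hy, rfl⟩ := List.mem_map.1 hf
    have := hmem y hy
    exact (hg y (by omega)).1
  · rw [List.isChain_map, List.isChain_iff_getElem]
    intro n hn
    rw [List.length_cons, List.length_range'] at hn
    have e1 : (M :: List.range' m (M - m))[n + 1] = m + n := by simp
    have e2 := hg (m + n) (by omega)
    rw [e1, e2.2]
    rcases n with _ | n
    · have := hedge M hle le_rfl
      simp only [List.getElem_cons_zero]
      omega
    · have e3 : (M :: List.range' m (M - m))[n + 1] = m + n := by simp
      rw [e3]
      have := hedge (m + n) (by omega) (by omega)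
      omega
  · rw [List.map_map]
    have : (fun f : ℕ × ℕ => ρ.level f.1) ∘ g = fun y => ρ.level (g y).1 := rfl
    rw [this, hlev, List.nodup_cons]
    refine ⟨?_, List.nodup_range'⟩
    rw [List.mem_range'_1]; omega
  · rw [List.map_map]
    have : (fun f : ℕ × ℕ => ρ.level f.1) ∘ g = fun y => ρ.level (g y).1 := rfl
    rw [this, hlev]; rfl
  · rw [List.map_map, List.getLast?_map]
    rcases hle.eq_or_lt with rfl | hlt'
    · have := hedge m le_rfl le_rfl
      simp only [Nat.sub_self, List.range'_zero, List.getLast?_singleton, Option.map_some,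
        Function.comp, Option.some.injEq]
      omega
    · have e1 : (M :: List.range' m (M - m)).getLast? = some (M - 1) := by
        obtain ⟨d, hd⟩ := Nat.exists_eq_add_of_lt hlt'
        have : M - m = d + 1 := by omega
        rw [this, List.range'_1_concat, ← List.cons_append, List.getLast?_append]
        simp only [List.getLast?_singleton, Option.some_or, Option.some.injEq]
        omega
      have := hedge (M - 1) (by omega) (by omega)
      simp only [e1, Option.map_some, Function.comp, Option.some.injEq]
      omega
  · intro s e hI h1 h2
    have h3 := hg (ρ.level s) (by omega)
    have h4 := hI.eq_of_level_eq hs h3.1 h3.2.symm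
    rw [List.mem_map]
    refine ⟨ρ.level s, ?_, ?_⟩
    · rw [List.mem_cons, List.mem_range'_1]; omega
    · exact Prod.ext h4.1.symm h4.2.symm

/-- The anchor point of a class in which some output is produced. -/
theorem twoWayAnchor (h : ρ.Homogeneous z k R) (hs : ρ.IsSuccessful) {i j l m M r s e : ℕ}
    (hij : i < j) (hj : j ≤ 3) (hc : ρ.crossing (z i) = ρ.crossing (z j))
    (hC : IsLinkClass R k m M) (hl : Even m ∧ l = i ∨ Odd m ∧ l = j)
    (hI : ρ.Intercepted (z i, z j) s e) (h1 : m ≤ ρ.level s) (h2 : ρ.level s ≤ M)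
    (hsr : s ≤ r) (hre : r < e) (hr : (ρ.rule r).output ≠ []) :
    ∃ L w, ρ.TwoWayAnchor L (ρ.visit (z l) M) w := by
  obtain ⟨fs, hT, hfs⟩ := h.exists_isTrace hs hij hj hC
  have hv := visit_spec (ρ := ρ) (x := z l) (y := M)
    (by rw [h.width_eq l (by omega)]; exact hC.lt)
  refine ⟨(z i, z j), _, h.isIdempotentLoop hs hij hj hc,
    ⟨Set.Icc m M, h.isComponent hs hij hj hC, hv.1, ?_, m, isLeast_Icc hC.le, ?_⟩,
    fs, by rw [hv.2.2]; exact hT, rfl, ?_⟩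
  · rw [hv.2.2]; exact isGreatest_Icc hC.le
  · rw [hv.2.1]
    rcases hl with ⟨hl, rfl⟩ | ⟨hl, rfl⟩
    · exact Or.inl ⟨hl, rfl⟩
    · exact Or.inr ⟨hl, rfl⟩
  · intro hnil
    rw [List.flatMap_eq_nil_iff] at hnil
    exact ρ.output_mem_factorOut_ne_nil hsr hre hr (hnil _ (hfs s e hI h1 h2))

end Homogeneous

end Run

end TwoWayTransducer

/-! ### Anchor points between three given times -/

/-- Among three numbers, one has at most one smaller and at most one larger. -/
theorem exists_median (f : ℕ → ℕ) : ∃ j, 1 ≤ j ∧ j ≤ 3 ∧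
    ¬ (f 1 < f j ∧ f 2 < f j) ∧ ¬ (f 1 < f j ∧ f 3 < f j) ∧ ¬ (f 2 < f j ∧ f 3 < f j) ∧
    ¬ (f j < f 1 ∧ f j < f 2) ∧ ¬ (f j < f 1 ∧ f j < f 3) ∧ ¬ (f j < f 2 ∧ f j < f 3) := by
  by_cases c2 : (f 1 ≤ f 2 ∧ f 2 ≤ f 3) ∨ (f 3 ≤ f 2 ∧ f 2 ≤ f 1)
  · exact ⟨2, by omega⟩
  by_cases c1 : (f 2 ≤ f 1 ∧ f 1 ≤ f 3) ∨ (f 3 ≤ f 1 ∧ f 1 ≤ f 2)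
  · exact ⟨1, by omega⟩
  · exact ⟨3, by omega⟩

/-- The choice of an anchor point `A i` between three given times `r j`, such that one of these
times lies in the same class `m` with `i < j`. -/
theorem exists_index_between {m m₁ m₂ m₃ r₁ r₂ r₃ A₀ A₁ A₂ A₃ μ₀ μ₁ μ₂ μ₃ lo hi : ℕ}
    (h0 : μ₀ ≤ A₀) (h01 : A₀ < μ₁) (h1 : μ₁ ≤ A₁) (h12 : A₁ < μ₂) (h2 : μ₂ ≤ A₂)
    (h23 : A₂ < μ₃) (h3 : μ₃ ≤ A₃)
    (hlo : lo ≤ r₁ ∧ lo ≤ r₂ ∧ lo ≤ r₃) (hhi : r₁ ≤ hi ∧ r₂ ≤ hi ∧ r₃ ≤ hi)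
    (s₁ : m₁ = m ∧ μ₀ ≤ r₁ ∧ r₁ < A₁ ∨ m₁ < m ∧ r₁ < μ₀ ∨ m < m₁ ∧ A₃ < r₁)
    (s₂ : m₂ = m ∧ μ₁ ≤ r₂ ∧ r₂ < A₂ ∨ m₂ < m ∧ r₂ < μ₀ ∨ m < m₂ ∧ A₃ < r₂)
    (s₃ : m₃ = m ∧ μ₂ ≤ r₃ ∧ r₃ < A₃ ∨ m₃ < m ∧ r₃ < μ₀ ∨ m < m₃ ∧ A₃ < r₃)
    (hmed : ¬ (m₁ < m ∧ m₂ < m) ∧ ¬ (m₁ < m ∧ m₃ < m) ∧ ¬ (m₂ < m ∧ m₃ < m) ∧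
      ¬ (m < m₁ ∧ m < m₂) ∧ ¬ (m < m₁ ∧ m < m₃) ∧ ¬ (m < m₂ ∧ m < m₃)) :
    (lo ≤ A₀ ∧ A₀ ≤ hi ∧ (m₁ = m ∨ m₂ = m ∨ m₃ = m)) ∨
      (lo ≤ A₁ ∧ A₁ ≤ hi ∧ (m₂ = m ∨ m₃ = m)) ∨ (lo ≤ A₂ ∧ A₂ ≤ hi ∧ m₃ = m) := by
  rcases s₁ with s₁ | s₁ | s₁ <;> rcases s₂ with s₂ | s₂ | s₂ <;>
    rcases s₃ with s₃ | s₃ | s₃ <;> omega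

namespace TwoWayTransducer

namespace Run

variable {Q A Γ : Type*} {T : TwoWayTransducer Q A Γ} {u : List A} {ρ : T.Run u}
  {z : ℕ → ℕ} {k : ℕ} {R : ℕ → ℕ → Prop}

namespace Homogeneous

/-- In a left-to-right class, the visit of the left border on level `M` precedes that of the right
border on level `m`. So the whole class takes place between the lowest visit on the left and the
highest visit on the right; right-to-left classes are mirrored. -/
theorem time_bounds (h : ρ.Homogeneous z k R) (hs : ρ.IsSuccessful) {i j m M r s e : ℕ}
    (hij : i < j) (hj : j ≤ 3) (hC : IsLinkClass R k m M) (hI : ρ.Intercepted (z i, z j) s e)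
    (h1 : m ≤ ρ.level s) (h2 : ρ.level s ≤ M) (hsr : s ≤ r) (hre : r < e) :
    (Even m ∧ ρ.visit (z i) m ≤ r ∧ r < ρ.visit (z j) M) ∨
      (Odd m ∧ ρ.visit (z j) m ≤ r ∧ r < ρ.visit (z i) M) := by
  have h3 := h.cycleEdge_mem hC h1 h2 (h.cycleEdge_of_flow hs hij hj ⟨s, e, hI, rfl, rfl⟩)
  have hM := hC.lt
  have hle := hC.le
  have a1 := h.visit_le (i := i) (by omega) (by omega : ρ.level s < k) h1
  have a2 := h.visit_le (i := j) hj (by omega : ρ.level s < k) h1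
  have a3 := h.visit_le (i := i) (by omega) hM h3.2
  have a4 := h.visit_le (i := j) hj hM h3.2
  have a5 := h.visit_le (i := i) (by omega) hM hle
  have a6 := h.visit_le (i := j) hj hM hle
  have a7 := h.visit_le (i := i) (by omega) hM h2
  have a8 := h.visit_le (i := j) hj hM h2
  have hel := hI.2.1
  have hse := hI.1
  have b1 := visit_pos_level (ρ := ρ) (t := s) (by omega)
  have b2 := visit_pos_level (ρ := ρ) (t := e) (by omega)
  have c1 : ρ.pos s = z i ∨ ρ.pos s = z j := by have := hI.entry hs; tauto
  have c2 : ρ.pos e = z i ∨ ρ.pos e = z j := by have := hI.exit hs (h.le j hj); tauto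
  rcases h.class_parity hs hC with ⟨p1, -, p2⟩ | ⟨p1, -, p2⟩
  · left
    rw [h.rel_iff i j hij hj M m hM (by omega)] at p2
    refine ⟨p1, ?_, ?_⟩
    · rcases c1 with c1 | c1 <;> rw [c1] at b1 <;> omega
    · rcases c2 with c2 | c2 <;> rw [c2] at b2 <;> omega
  · right
    rw [h.not_rel_iff hij hj (by omega) hM] at p2
    refine ⟨p1, ?_, ?_⟩
    · rcases c1 with c1 | c1 <;> rw [c1] at b1 <;> omega
    · rcases c2 with c2 | c2 <;> rw [c2] at b2 <;> omega

/-- Different classes occupy disjoint intervals of unlinked levels, and unlinked levels are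
separated in time at all four positions. -/
theorem visit_lt_of_class_lt (h : ρ.Homogeneous z k R) {i j m M m' M' : ℕ}
    (hi : i ≤ 3) (hj : j ≤ 3) (hC : IsLinkClass R k m M) (hC' : IsLinkClass R k m' M')
    (hlt : m < m') : ρ.visit (z i) M < ρ.visit (z j) m' := by
  have hle := hC.le
  have hle' := hC'.le
  have hM' := hC'.lt
  have hMm : M < m' := by
    by_contra hcon
    have := isLinkClass_unique hC hC' h hlt.le (by omega) le_rfl hle'
    omega
  refine h.visit_lt_visit_of_not_linked hMm (by omega) hi hj ?_
  intro hl
  have := hC.maximal m' (by omega) M hle le_rfl hl.symm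
  omega

/-- The class of a time is determined by any interval. -/
theorem class_unique (h : ρ.Homogeneous z k R) (hs : ρ.IsSuccessful)
    {i j m M r s e i' j' m' M' s' e' : ℕ}
    (hij : i < j) (hj : j ≤ 3) (hC : IsLinkClass R k m M) (hI : ρ.Intercepted (z i, z j) s e)
    (h1 : m ≤ ρ.level s) (h2 : ρ.level s ≤ M) (hsr : s ≤ r) (hre : r < e)
    (hij' : i' < j') (hj' : j' ≤ 3) (hC' : IsLinkClass R k m' M')
    (hI' : ρ.Intercepted (z i', z j') s' e')
    (h1' : m' ≤ ρ.level s') (h2' : ρ.level s' ≤ M') (hsr' : s' ≤ r) (hre' : r < e') :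
    m = m' ∧ M = M' := by
  have b := h.time_bounds hs hij hj hC hI h1 h2 hsr hre
  have b' := h.time_bounds hs hij' hj' hC' hI' h1' h2' hsr' hre'
  rcases lt_trichotomy m m' with hlt | rfl | hlt
  · exfalso
    have k1 := h.visit_lt_of_class_lt (i := i) (j := i') (by omega) (by omega) hC hC' hlt
    have k2 := h.visit_lt_of_class_lt (i := i) (j := j') (by omega) (by omega) hC hC' hlt
    have k3 := h.visit_lt_of_class_lt (i := j) (j := i') (by omega) (by omega) hC hC' hlt
    have k4 := h.visit_lt_of_class_lt (i := j) (j := j') (by omega) (by omega) hC hC' hlt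
    omega
  · exact isLinkClass_unique hC hC' h le_rfl hC.le le_rfl hC'.le
  · exfalso
    have k1 := h.visit_lt_of_class_lt (i := i') (j := i) (by omega) (by omega) hC' hC hlt
    have k2 := h.visit_lt_of_class_lt (i := i') (j := j) (by omega) (by omega) hC' hC hlt
    have k3 := h.visit_lt_of_class_lt (i := j') (j := i) (by omega) (by omega) hC' hC hlt
    have k4 := h.visit_lt_of_class_lt (i := j') (j := j) (by omega) (by omega) hC' hC hlt
    omega

/-- If output is produced in each of the three intervals of a homogeneous sequence, then there is
an anchor point between the times when this happens. -/
theorem exists_twoWayAnchor (h : ρ.Homogeneous z k R) (hs : ρ.IsSuccessful)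
    (hc : ∀ i ≤ 3, ρ.crossing (z i) = ρ.crossing (z 0)) {r : ℕ → ℕ} {lo hi : ℕ}
    (hr : ∀ j, 1 ≤ j → j ≤ 3 → r j < ρ.len ∧ z (j - 1) ≤ ρ.head (r j) ∧ ρ.head (r j) < z j ∧
      (ρ.rule (r j)).output ≠ [] ∧ lo ≤ r j ∧ r j ≤ hi) :
    ∃ t, lo ≤ t ∧ t ≤ hi ∧ (∃ i ≤ 3, ρ.pos t = z i) ∧ ∃ L w, ρ.TwoWayAnchor L t w := by
  have hex : ∀ j, ∃ s e m M, 1 ≤ j → j ≤ 3 → s ≤ r j ∧ r j < e ∧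
      ρ.Intercepted (z (j - 1), z j) s e ∧ IsLinkClass R k m M ∧ m ≤ ρ.level s ∧
      ρ.level s ≤ M := by
    intro j
    by_cases hj : 1 ≤ j ∧ j ≤ 3
    · obtain ⟨h1, h2, h3, -⟩ := hr j hj.1 hj.2
      obtain ⟨s, e, h4, h5, hI⟩ := exists_intercepted hs (h.le j hj.2) h1 h2 h3
      have h6 := h.intercepted_cases hs (by omega) hj.2 hI
      obtain ⟨m, M, hC, h7, h8⟩ := h.exists_isLinkClass h6.1
      exact ⟨s, e, m, M, fun _ _ => ⟨h4, h5, hI, hC, h7, h8⟩⟩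
    · exact ⟨0, 0, 0, 0, fun h1 h2 => absurd ⟨h1, h2⟩ hj⟩
  choose s e m M hsem using hex
  -- The anchor is sought in the median class. At most one of the three times belongs to an earlier
  -- class and at most one to a later class, so some candidate anchor of this class falls between
  -- `lo` and `hi`.
  obtain ⟨j₀, hj₁, hj₃, hmed⟩ := exists_median m
  have hC := (hsem j₀ hj₁ hj₃).2.2.2.1
  have hCj : ∀ j, 1 ≤ j → j ≤ 3 → IsLinkClass R k (m j) (M j) := fun j h1 h2 =>
    (hsem j h1 h2).2.2.2.1
  have hMlt := hC.lt
  have hle := hC.le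
  -- an anchor point of the class at `z l`, inside the loop `(z i, z j)`, for the time `r q`
  have hanchor : ∀ i j l q, i < j → j ≤ 3 → 1 ≤ q → q ≤ 3 → i ≤ q - 1 → q ≤ j → m q = m j₀ →
      (Even (m j₀) ∧ l = i ∨ Odd (m j₀) ∧ l = j) → lo ≤ ρ.visit (z l) (M j₀) →
      ρ.visit (z l) (M j₀) ≤ hi →
      ∃ t, lo ≤ t ∧ t ≤ hi ∧ (∃ i ≤ 3, ρ.pos t = z i) ∧ ∃ L w, ρ.TwoWayAnchor L t w := by
    intro i j l q hij hj hq1 hq3 hiq hqj hm hl hlo hhi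
    obtain ⟨g1, g2, g3, g4, -, -⟩ := hr q hq1 hq3
    obtain ⟨f1, f2, f3, f4, f5, f6⟩ := hsem q hq1 hq3
    have z1 : z i ≤ z (q - 1) := by
      rcases hiq.eq_or_lt with h1 | h1
      · rw [h1]
      · exact (h.lt _ _ h1 (by omega)).le
    have z2 : z q ≤ z j := by
      rcases hqj.eq_or_lt with h1 | h1
      · rw [h1]
      · exact (h.lt _ _ h1 (by omega)).le
    obtain ⟨s', e', k1, k2, hI'⟩ := exists_intercepted hs (h.le j hj) g1 (x₁ := z i) (x₂ := z j)
      (by omega) (by omega)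
    have k3 := h.intercepted_cases hs hij hj hI'
    obtain ⟨m', M', hC', k4, k5⟩ := h.exists_isLinkClass k3.1
    have k6 := h.class_unique hs (by omega) hq3 f4 f3 f5 f6 f1 f2 hij hj hC' hI' k4 k5 k1 k2
    have k7 := isLinkClass_unique f4 hC h le_rfl f4.le (by omega) (by rw [hm]; exact hle)
    have hv := visit_spec (ρ := ρ) (x := z l) (y := M j₀)
      (by rw [h.width_eq l (by omega)]; exact hC.lt)
    exact ⟨_, hlo, hhi, ⟨l, by omega, hv.2.1⟩,
      h.twoWayAnchor hs hij hj (by rw [hc i (by omega), hc j hj]) hC hl hI' (by omega) (by omega)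
        k1 k2 g4⟩
  have hr1 := hr 1 (by omega) (by omega)
  have hr2 := hr 2 (by omega) (by omega)
  have hr3 := hr 3 (by omega) (by omega)
  have hv := fun i (hi : i ≤ 3) => h.visit_le hi hMlt hle
  have hv0 := hv 0 (by omega)
  have hv1 := hv 1 (by omega)
  have hv2 := hv 2 (by omega)
  have hv3 := hv 3 (by omega)
  have hbounds : ∀ q, 1 ≤ q → q ≤ 3 →
      (Even (m q) ∧ ρ.visit (z (q - 1)) (m q) ≤ r q ∧ r q < ρ.visit (z q) (M q)) ∨
        (Odd (m q) ∧ ρ.visit (z q) (m q) ≤ r q ∧ r q < ρ.visit (z (q - 1)) (M q)) := by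
    intro q hq1 hq3
    obtain ⟨f1, f2, f3, f4, f5, f6⟩ := hsem q hq1 hq3
    exact h.time_bounds hs (by omega) hq3 f4 f3 f5 f6 f1 f2
  have hbefore : ∀ q l, 1 ≤ q → q ≤ 3 → l ≤ 3 → m q < m j₀ → r q < ρ.visit (z l) (m j₀) := by
    intro q l hq1 hq3 hl hlt
    have k1 := h.visit_lt_of_class_lt (i := q) (j := l) hq3 hl (hCj q hq1 hq3) hC hlt
    have k2 := h.visit_lt_of_class_lt (i := q - 1) (j := l) (by omega) hl (hCj q hq1 hq3) hC hlt
    have := hbounds q hq1 hq3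
    omega
  have hafter : ∀ q l, 1 ≤ q → q ≤ 3 → l ≤ 3 → m j₀ < m q → ρ.visit (z l) (M j₀) < r q := by
    intro q l hq1 hq3 hl hlt
    have k1 := h.visit_lt_of_class_lt (i := l) (j := q) hl hq3 hC (hCj q hq1 hq3) hlt
    have k2 := h.visit_lt_of_class_lt (i := l) (j := q - 1) hl (by omega) hC (hCj q hq1 hq3) hlt
    have := hbounds q hq1 hq3
    omega
  have hsame : ∀ q, 1 ≤ q → q ≤ 3 → m q = m j₀ → M q = M j₀ := by
    intro q hq1 hq3 hm
    have f4 := hCj q hq1 hq3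
    exact (isLinkClass_unique f4 hC h le_rfl f4.le (by omega) (by rw [hm]; exact hle)).2
  -- In a left-to-right class the anchor lies at the left border of its loop. The candidates are `z
  -- 0`, `z 1`, `z 2`, always with right border `z 3`, visited by this class in that order.
  rcases h.class_parity hs hC with ⟨p1, -, p2⟩ | ⟨p1, -, p2⟩
  · have o := fun i j hij hj => (h.rel_iff i j hij hj _ _ hMlt (by omega)).1 p2
    have o01 := o 0 1 (by omega) (by omega)
    have o12 := o 1 2 (by omega) (by omega)
    have o23 := o 2 3 (by omega) (by omega)
    have hst : ∀ q, 1 ≤ q → q ≤ 3 → m q = m j₀ ∧ ρ.visit (z (q - 1)) (m j₀) ≤ r q ∧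
        r q < ρ.visit (z q) (M j₀) ∨ m q < m j₀ ∧ r q < ρ.visit (z 0) (m j₀) ∨
          m j₀ < m q ∧ ρ.visit (z 3) (M j₀) < r q := by
      intro q hq1 hq3
      rcases lt_trichotomy (m q) (m j₀) with h1 | h1 | h1
      · exact Or.inr (Or.inl ⟨h1, hbefore q 0 hq1 hq3 (by omega) h1⟩)
      · have h2 := hbounds q hq1 hq3
        rw [hsame q hq1 hq3 h1, h1] at h2
        rcases h2 with h2 | h2
        · exact Or.inl ⟨h1, h2.2⟩
        · exact absurd p1 (Nat.not_even_iff_odd.2 h2.1)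
      · exact Or.inr (Or.inr ⟨h1, hafter q 3 hq1 hq3 (by omega) h1⟩)
    have hsel := exists_index_between hv0 o01 hv1 o12 hv2 o23 hv3
      ⟨hr1.2.2.2.2.1, hr2.2.2.2.2.1, hr3.2.2.2.2.1⟩ ⟨hr1.2.2.2.2.2, hr2.2.2.2.2.2, hr3.2.2.2.2.2⟩
      (hst 1 (by omega) (by omega)) (hst 2 (by omega) (by omega)) (hst 3 (by omega) (by omega))
      hmed
    rcases hsel with ⟨l1, l2, l3 | l3 | l3⟩ | ⟨l1, l2, l3 | l3⟩ | ⟨l1, l2, l3⟩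
    · exact hanchor 0 3 0 1 (by omega) (by omega) (by omega) (by omega) (by omega) (by omega) l3
        (Or.inl ⟨p1, rfl⟩) l1 l2
    · exact hanchor 0 3 0 2 (by omega) (by omega) (by omega) (by omega) (by omega) (by omega) l3
        (Or.inl ⟨p1, rfl⟩) l1 l2
    · exact hanchor 0 3 0 3 (by omega) (by omega) (by omega) (by omega) (by omega) (by omega) l3
        (Or.inl ⟨p1, rfl⟩) l1 l2
    · exact hanchor 1 3 1 2 (by omega) (by omega) (by omega) (by omega) (by omega) (by omega) l3
        (Or.inl ⟨p1, rfl⟩) l1 l2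
    · exact hanchor 1 3 1 3 (by omega) (by omega) (by omega) (by omega) (by omega) (by omega) l3
        (Or.inl ⟨p1, rfl⟩) l1 l2
    · exact hanchor 2 3 2 3 (by omega) (by omega) (by omega) (by omega) (by omega) (by omega) l3
        (Or.inl ⟨p1, rfl⟩) l1 l2
  -- In a right-to-left class the anchor lies at the right border: the candidates are `z 3`, `z 2`,
  -- `z 1`, with left border `z 0`.
  · have o := fun i j hij hj => (h.not_rel_iff (i := i) (j := j) hij hj (by omega) hMlt).1 p2
    have o01 := o 0 1 (by omega) (by omega)
    have o12 := o 1 2 (by omega) (by omega)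
    have o23 := o 2 3 (by omega) (by omega)
    have hst : ∀ q, 1 ≤ q → q ≤ 3 → m q = m j₀ ∧ ρ.visit (z q) (m j₀) ≤ r q ∧
        r q < ρ.visit (z (q - 1)) (M j₀) ∨ m q < m j₀ ∧ r q < ρ.visit (z 3) (m j₀) ∨
          m j₀ < m q ∧ ρ.visit (z 0) (M j₀) < r q := by
      intro q hq1 hq3
      rcases lt_trichotomy (m q) (m j₀) with h1 | h1 | h1
      · exact Or.inr (Or.inl ⟨h1, hbefore q 3 hq1 hq3 (by omega) h1⟩)
      · have h2 := hbounds q hq1 hq3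
        rw [hsame q hq1 hq3 h1, h1] at h2
        rcases h2 with h2 | h2
        · exact absurd h2.1 (Nat.not_even_iff_odd.2 p1)
        · exact Or.inl ⟨h1, h2.2⟩
      · exact Or.inr (Or.inr ⟨h1, hafter q 0 hq1 hq3 (by omega) h1⟩)
    have hsel := exists_index_between hv3 o23 hv2 o12 hv1 o01 hv0
      ⟨hr3.2.2.2.2.1, hr2.2.2.2.2.1, hr1.2.2.2.2.1⟩ ⟨hr3.2.2.2.2.2, hr2.2.2.2.2.2, hr1.2.2.2.2.2⟩
      (hst 3 (by omega) (by omega)) (hst 2 (by omega) (by omega)) (hst 1 (by omega) (by omega))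
      (by omega)
    rcases hsel with ⟨l1, l2, l3 | l3 | l3⟩ | ⟨l1, l2, l3 | l3⟩ | ⟨l1, l2, l3⟩
    · exact hanchor 0 3 3 3 (by omega) (by omega) (by omega) (by omega) (by omega) (by omega) l3
        (Or.inr ⟨p1, rfl⟩) l1 l2
    · exact hanchor 0 3 3 2 (by omega) (by omega) (by omega) (by omega) (by omega) (by omega) l3
        (Or.inr ⟨p1, rfl⟩) l1 l2
    · exact hanchor 0 3 3 1 (by omega) (by omega) (by omega) (by omega) (by omega) (by omega) l3
        (Or.inr ⟨p1, rfl⟩) l1 l2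
    · exact hanchor 0 2 2 2 (by omega) (by omega) (by omega) (by omega) (by omega) (by omega) l3
        (Or.inr ⟨p1, rfl⟩) l1 l2
    · exact hanchor 0 2 2 1 (by omega) (by omega) (by omega) (by omega) (by omega) (by omega) l3
        (Or.inr ⟨p1, rfl⟩) l1 l2
    · exact hanchor 0 1 1 1 (by omega) (by omega) (by omega) (by omega) (by omega) (by omega) l3
        (Or.inr ⟨p1, rfl⟩) l1 l2

end Homogeneous

end Run

end TwoWayTransducer

namespace TwoWayTransducer

namespace Run

variable {Q A Γ : Type*} {T : TwoWayTransducer Q A Γ} {u : List A} {ρ : T.Run u}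

/-! ### Effects of intervals -/

/-- The visit of `x` at level `y` comes before the visit of `x'` at level `y'`. -/
def Before (ρ : T.Run u) (x x' y y' : ℕ) : Prop :=
  y < ρ.width x ∧ y' < ρ.width x' ∧ ρ.visit x y < ρ.visit x' y'

/-- Between a visit of `x₀` and a later visit of `x₂` the run must meet `x₁`, so interleavings
compose like relations. This is the additivity needed for the Ramsey argument. -/
theorem before_comp {x₀ x₁ x₂ : ℕ} (h01 : x₀ < x₁) (h12 : x₁ < x₂)
    (y y'' : ℕ) :
    ρ.Before x₀ x₂ y y'' ↔ ∃ y', ρ.Before x₀ x₁ y y' ∧ ρ.Before x₁ x₂ y' y'' := by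
  constructor
  · rintro ⟨h1, h2, h3⟩
    have s1 := visit_spec h1
    have s2 := visit_spec h2
    obtain ⟨r, r1, r2, r3⟩ := ρ.exists_pos_eq_up (x := x₁) h3.le s2.1 (by omega) (by omega)
    have hr := ρ.level_lt_width (t := r) (by omega)
    have hv := visit_pos_level (ρ := ρ) (t := r) (by omega)
    rw [r3] at hr hv
    have hne1 : ρ.visit x₀ y ≠ r := by rintro rfl; omega
    have hne2 : ρ.visit x₂ y'' ≠ r := by rintro rfl; omega
    exact ⟨ρ.level r, ⟨h1, hr, by omega⟩, hr, h2, by omega⟩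
  · rintro ⟨y', ⟨h1, -, h2⟩, -, h3, h4⟩
    exact ⟨h1, h3, h2.trans h4⟩

/-- The sequence of all visits of the positions `x` and `x'` before time `t`, where `true` stands
for `x`, together with the states. -/
def events (ρ : T.Run u) (x x' t : ℕ) : List (Bool × Q) :=
  ((List.range t).filter fun s => ρ.pos s = x ∨ ρ.pos s = x').map
    fun s => (decide (ρ.pos s = x), ρ.state s)

theorem visits_eq_countP (t x : ℕ) :
    ρ.visits t x = (List.range t).countP fun s => ρ.pos s = x := by
  rw [visits, List.countP_eq_length_filter, Finset.card_def, Finset.filter_val,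
    Finset.range_val, Multiset.range, Multiset.filter_coe, Multiset.coe_card]

theorem countP_events_true {x x' : ℕ} (t : ℕ) :
    (ρ.events x x' t).countP (fun e => e.1) = ρ.visits t x := by
  rw [events, List.countP_map, List.countP_filter, visits_eq_countP]
  apply List.countP_congr
  intro s _
  simp only [Function.comp, Bool.and_eq_true, decide_eq_true_eq]
  tauto

theorem countP_events_false {x x' : ℕ} (hx : x ≠ x') (t : ℕ) :
    (ρ.events x x' t).countP (fun e => !e.1) = ρ.visits t x' := by
  rw [events, List.countP_map, List.countP_filter, visits_eq_countP]
  apply List.countP_congr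
  intro s _
  simp only [Function.comp, Bool.and_eq_true, decide_eq_true_eq, Bool.not_eq_true',
    decide_eq_false_iff_not]
  constructor
  · tauto
  · intro h
    exact ⟨by omega, Or.inr h⟩

theorem length_events {x x' : ℕ} (hx : x ≠ x') (t : ℕ) :
    (ρ.events x x' t).length = ρ.visits t x + ρ.visits t x' := by
  rw [← countP_events_true (x' := x') t, ← countP_events_false hx t]
  rw [List.length_eq_countP_add_countP (p := fun e => e.1)]
  congr 2
  funext e
  simp

theorem crossing_eq_of_events {x x' : ℕ} (hx : x ≠ x') :
    ((ρ.events x x' (ρ.len + 1)).filter fun e => !e.1).map Prod.snd = ρ.crossing x' := by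
  rw [events, List.filter_map, List.map_map, List.filter_filter, crossing]
  congr 1
  apply List.filter_congr
  intro s _
  simp only [Function.comp]
  by_cases h : ρ.pos s = x'
  · have : ¬ ρ.pos s = x := by omega
    simp [h, Ne.symm hx]
  · simp only [h, or_false, decide_false, Bool.and_eq_false_iff, Bool.not_eq_false',
      decide_eq_true_eq, decide_eq_false_iff_not]
    tauto

/-- Appending further entries marked `true` is harmless: a prefix that extends beyond the events has
already seen all visits of `x'`, which `p.countP (fun e => !e.1) ≤ y'` forbids. -/
theorem before_iff_events {x x' : ℕ} (hx : x ≠ x') {l : List (Bool × Q)}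
    (hl : ∀ e ∈ l, e.1 = true) (y y' : ℕ) :
    ρ.Before x x' y y' ↔
      y' < (ρ.events x x' (ρ.len + 1) ++ l).countP (fun e => !e.1) ∧
        ∃ p, p <+: ρ.events x x' (ρ.len + 1) ++ l ∧ y < p.countP (fun e => e.1) ∧
          p.countP (fun e => !e.1) ≤ y' := by
  have hl0 : l.countP (fun e => !e.1) = 0 := by
    rw [List.countP_eq_zero]
    intro e he
    simp [hl e he]
  rw [List.countP_append, hl0, add_zero, countP_events_false hx]
  have hpre : ∀ t ≤ ρ.len + 1, ρ.events x x' t <+: ρ.events x x' (ρ.len + 1) := by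
    intro t ht
    refine List.IsPrefix.map _ (List.IsPrefix.filter _ ?_)
    obtain ⟨d, hd⟩ := Nat.exists_eq_add_of_le ht
    rw [hd, List.range_add]
    exact List.prefix_append _ _
  constructor
  · rintro ⟨h1, h2, h3⟩
    have s1 := visit_spec h1
    have s2 := visit_spec h2
    refine ⟨h2, ρ.events x x' (ρ.visit x' y'),
      (hpre _ (by omega)).trans (List.prefix_append _ _), ?_, ?_⟩
    · rw [countP_events_true]
      have := ρ.level_lt_visits h3
      rwa [s1.2.1, s1.2.2] at this
    · rw [countP_events_false hx]
      have := ρ.level_eq_visits (ρ.visit x' y')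
      rw [s2.2.1, s2.2.2] at this
      exact this.ge
  · rintro ⟨h1, p, hp, h2, h3⟩
    obtain ⟨t, ht, rfl⟩ : ∃ t ≤ ρ.len + 1, p = ρ.events x x' t := by
      rcases List.prefix_or_prefix_of_prefix hp (List.prefix_append _ _) with h4 | h4
      · obtain ⟨q, hq, rfl⟩ := List.prefix_map_iff.1 h4
        obtain ⟨q', hq', rfl⟩ := List.prefix_filter_iff.1 hq
        have h5 := List.prefix_iff_eq_take.1 hq'
        have h6 := hq'.length_le
        rw [List.take_range, List.length_range] at *
        refine ⟨q'.length, by simpa using h6, ?_⟩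
        rw [events]
        conv_lhs => rw [h5]
        congr 3
        omega
      · exfalso
        have h5 := h4.sublist.countP_le (p := fun e => !e.1)
        rw [countP_events_false hx] at h5
        omega
    rw [countP_events_true] at h2
    rw [countP_events_false hx] at h3
    have hy : y < ρ.width x := lt_of_lt_of_le h2 (ρ.visits_mono ht x)
    have s2 := visit_spec (ρ := ρ) h1
    refine ⟨hy, h1, ?_⟩
    obtain ⟨s, hs1, hs2, hs3⟩ := ρ.exists_visit h2
    have hv := visit_pos_level (ρ := ρ) (t := s) (by omega)
    rw [hs2, hs3] at hv
    rw [hv]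
    by_contra hcon
    have := ρ.level_lt_visits (s := ρ.visit x' y') (t := t) (by omega)
    rw [s2.2.1, s2.2.2] at this
    omega

/-- The sequence of visits of two positions, padded to a fixed length. -/
def effect (ρ : T.Run u) (n : ℕ) (x x' : ℕ) (i : Fin n) : Bool × Q :=
  (ρ.events x x' (ρ.len + 1)).getD i (true, ρ.state 0)

theorem ofFn_effect {n x x' : ℕ} (hn : (ρ.events x x' (ρ.len + 1)).length ≤ n) :
    List.ofFn (ρ.effect n x x') = ρ.events x x' (ρ.len + 1) ++
      List.replicate (n - (ρ.events x x' (ρ.len + 1)).length) (true, ρ.state 0) := by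
  apply List.ext_getElem
  · rw [List.length_ofFn, List.length_append, List.length_replicate]; omega
  · intro i h1 h2
    rw [List.getElem_ofFn, effect]
    by_cases h : i < (ρ.events x x' (ρ.len + 1)).length
    · rw [List.getElem_append_left h]
      exact List.getD_eq_getElem _ _ h
    · rw [List.getElem_append_right (by omega), List.getElem_replicate]
      exact List.getD_eq_default _ _ (by simpa using h)

/-- The padding looks like visits of the left position, so only the crossing sequence of the right
position can be recovered. This is why `exists_homogeneous` compares its points as seen from an
earlier one. -/
theorem effect_eq {n x₁ x₁' x₂ x₂' : ℕ} (hx₁ : x₁ ≠ x₁') (hx₂ : x₂ ≠ x₂')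
    (h1 : ρ.width x₁ + ρ.width x₁' ≤ n) (h2 : ρ.width x₂ + ρ.width x₂' ≤ n)
    (h : ρ.effect n x₁ x₁' = ρ.effect n x₂ x₂') :
    ρ.crossing x₁' = ρ.crossing x₂' ∧ ∀ y y', ρ.Before x₁ x₁' y y' ↔ ρ.Before x₂ x₂' y y' := by
  have e1 := ofFn_effect (ρ := ρ) (n := n) (x := x₁) (x' := x₁')
    (by rw [length_events hx₁]; exact h1)
  have e2 := ofFn_effect (ρ := ρ) (n := n) (x := x₂) (x' := x₂')
    (by rw [length_events hx₂]; exact h2)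
  rw [h, e2] at e1
  have hrep : ∀ j, ∀ e ∈ List.replicate j ((true, ρ.state 0) : Bool × Q), e.1 = true := by
    intro j e he
    rw [List.eq_of_mem_replicate he]
  constructor
  · have := congrArg (fun l => (l.filter fun e => !e.1).map Prod.snd) e1
    simp only [List.filter_append, List.filter_replicate, Bool.not_true,
      Bool.false_eq_true, if_false, List.append_nil] at this
    rw [crossing_eq_of_events hx₁, crossing_eq_of_events hx₂] at this
    exact this.symm
  · intro y y'
    rw [before_iff_events hx₁ (hrep _), before_iff_events hx₂ (hrep _), e1]

/-- The interleaving of the visits of two positions, as a transformation of sets of levels. -/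
def interleaving (ρ : T.Run u) (n : ℕ) (x x' : ℕ) : Function.End (Set (Fin n)) :=
  fun Y => {y | ∃ y' ∈ Y, ρ.Before x x' y y'}

theorem interleaving_mul {n x₀ x₁ x₂ : ℕ} (h01 : x₀ < x₁) (h12 : x₁ < x₂)
    (hn : ρ.width x₁ ≤ n) :
    ρ.interleaving n x₀ x₂ = ρ.interleaving n x₀ x₁ * ρ.interleaving n x₁ x₂ := by
  funext Y
  ext y
  change (∃ y' ∈ Y, ρ.Before x₀ x₂ y y') ↔
    ∃ y' : Fin n, (∃ y'' ∈ Y, ρ.Before x₁ x₂ y' y'') ∧ ρ.Before x₀ x₁ y y'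
  constructor
  · rintro ⟨y'', hy, h⟩
    obtain ⟨y', h1, h2⟩ := (before_comp h01 h12 _ _).1 h
    exact ⟨⟨y', lt_of_lt_of_le h1.2.1 hn⟩, ⟨y'', hy, h2⟩, h1⟩
  · rintro ⟨y', ⟨y'', hy, h2⟩, h1⟩
    exact ⟨y'', hy, (before_comp h01 h12 _ _).2 ⟨y', h1, h2⟩⟩

theorem before_iff_of_interleaving_eq {n x₁ x₁' x₂ x₂' : ℕ}
    (h : ρ.interleaving n x₁ x₁' = ρ.interleaving n x₂ x₂') (y y' : Fin n) :
    ρ.Before x₁ x₁' y y' ↔ ρ.Before x₂ x₂' y y' := by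
  have h1 : ∀ x x', y ∈ ρ.interleaving n x x' {y'} ↔ ρ.Before x x' y y' := by
    intro x x'
    change (∃ y'' ∈ ({y'} : Set (Fin n)), ρ.Before x x' y y'') ↔ _
    simp
  rw [← h1, ← h1, h]

/-! ### Anchor points in subsequences with large output -/

theorem exists_enumeration_of_finset (s : Finset ℕ) :
    ∃ p : ℕ → ℕ, (∀ i j, i < j → j < s.card → p i < p j) ∧ ∀ i < s.card, p i ∈ s := by
  let f := s.orderEmbOfFin rfl
  refine ⟨fun i => if h : i < s.card then f ⟨i, h⟩ else 0, ?_, ?_⟩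
  · intro i j hij hj
    simp only [hj, hij.trans hj, dif_pos]
    exact f.strictMono hij
  · intro i hi
    simp only [hi, dif_pos]
    exact s.orderEmbOfFin_mem rfl _

/-- The colouring by `interleaving` is additive but has values in a large monoid; the refinement by
`effect` has only `T.emax` values, so `8 ^ T.emax = 2 ^ (3 * T.emax)` positions suffice. -/
theorem exists_homogeneous_positions [Fintype Q] (hs : ρ.IsSuccessful) (hn : ρ.IsNormalized)
    {p : ℕ → ℕ} {lo hi : ℕ} (hlen : lo + 2 ^ (3 * T.emax) ≤ hi)
    (hp : ∀ i j, i < j → j ≤ hi → p i < p j) (hpu : ∀ i ≤ hi, p i ≤ u.length) :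
    ∃ a : ℕ → ℕ, lo ≤ a 0 ∧ a 3 ≤ hi ∧ (∀ i j, i < j → j ≤ 3 → a i < a j) ∧
      (∀ i ≤ 3, ρ.crossing (p (a i)) = ρ.crossing (p (a 0))) ∧
      ∃ k R, ρ.Homogeneous (fun i => p (a i)) k R := by
  classical
  have hw : ∀ i ≤ hi, ρ.width (p i) ≤ T.hmax := fun i h => ρ.width_le hs hn (hpu i h)
  have hcard : (Finset.univ : Finset (Fin (2 * T.hmax) → Bool × Q)).card = T.emax := by
    rw [Finset.card_univ, Fintype.card_fun, Fintype.card_prod, Fintype.card_bool,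
      Fintype.card_fin, emax]
  have hfin : Finite (Function.End (Set (Fin T.hmax))) :=
    inferInstanceAs (Finite (Set (Fin T.hmax) → Set (Fin T.hmax)))
  obtain ⟨q, a₀, a₁, a₂, a₃, h1, h2, h3, h4, h5, h6, d1, d2, d3, c02, c03, c12, c13, c23⟩ :=
    exists_homogeneous (N := hi) (fun i j => ρ.interleaving T.hmax (p i) (p j))
      (fun i j => ρ.effect (2 * T.hmax) (p i) (p j))
      (by
        intro i j i' j' hij hj hij' hj' hd
        have w1 := hw i (by omega)
        have w2 := hw j hj
        have w3 := hw i' (by omega)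
        have w4 := hw j' hj'
        have := (effect_eq (hp i j hij hj).ne (hp i' j' hij' hj').ne (by omega) (by omega) hd).2
        funext Y
        ext y
        change (∃ y' ∈ Y, _) ↔ ∃ y' ∈ Y, _
        simp only [this])
      (by
        intro i j l hij hjl hl
        exact interleaving_mul (hp i j hij (by omega)) (hp j l hjl hl) (hw j (by omega)))
      Finset.univ lo hi le_rfl (fun _ _ _ _ _ => Finset.mem_univ _)
      (by rw [hcard, show (8 : ℕ) = 2 ^ 3 by norm_num, ← pow_mul]; exact hlen)
  have hcr : ∀ b, q < b → b ≤ hi →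
      ρ.effect (2 * T.hmax) (p q) (p b) = ρ.effect (2 * T.hmax) (p q) (p a₀) →
      ρ.crossing (p b) = ρ.crossing (p a₀) := by
    intro b hb hb' he
    have w1 := hw q (by omega)
    have w2 := hw b hb'
    have w3 := hw a₀ (by omega)
    exact (effect_eq (hp q b hb hb').ne (hp q a₀ h2 (by omega)).ne (by omega) (by omega) he).1
  have k1 := hcr a₁ (by omega) (by omega) d1
  have k2 := hcr a₂ (by omega) (by omega) d2
  have k3 := hcr a₃ (by omega) (by omega) d3
  let a : ℕ → ℕ := fun i => match i with
    | 0 => a₀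
    | 1 => a₁
    | 2 => a₂
    | _ => a₃
  have ha : ∀ i j, i < j → j ≤ 3 → a i < a j := by
    intro i j hij hj
    interval_cases j <;> interval_cases i <;> simp only [a] <;> omega
  have hahi : ∀ i ≤ 3, a i ≤ hi := by
    intro i hi'
    interval_cases i <;> simp only [a] <;> omega
  have hacr : ∀ i ≤ 3, ρ.crossing (p (a i)) = ρ.crossing (p (a 0)) := by
    intro i hi'
    interval_cases i
    · rfl
    · exact k1
    · exact k2
    · exact k3
  have haw : ∀ i ≤ 3, ρ.width (p (a i)) = ρ.width (p (a 0)) := by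
    intro i hi'
    rw [← length_crossing, ← length_crossing, hacr i hi']
  have hac : ∀ i j, i < j → j ≤ 3 → ρ.interleaving T.hmax (p (a i)) (p (a j)) =
      ρ.interleaving T.hmax (p (a 0)) (p (a 1)) := by
    intro i j hij hj
    interval_cases j <;> interval_cases i
    · rfl
    · exact c02
    · exact c12
    · exact c03
    · exact c13
    · exact c23
  refine ⟨a, by simp only [a]; omega, h6, ha, hacr, ρ.width (p (a 0)),
    ρ.Before (p (a 0)) (p (a 1)), ?_, ?_, haw, ?_⟩
  · intro i j hij hj
    exact hp _ _ (ha i j hij hj) (hahi j hj)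
  · intro i hi'
    exact hpu _ (hahi i hi')
  · intro i j hij hj y y' hy hy'
    have w0 := hw (a 0) (hahi 0 (by omega))
    have := before_iff_of_interleaving_eq (hac i j hij hj) ⟨y, by omega⟩ ⟨y', by omega⟩
    rw [← this, Before, haw i (by omega), haw j hj]
    tauto

/-- A large output in a rectangle of locations yields an anchor point inside this rectangle. -/
theorem exists_twoWayAnchor_of_outOn [Fintype Q] (hs : ρ.IsSuccessful) (hn : ρ.IsNormalized)
    {t₁ t₂ x₁ x₂ : ℕ} {Z : Finset ℕ}
    (hZ : ∀ t ∈ Z, t₁ ≤ t ∧ t ≤ t₂ ∧ x₁ ≤ ρ.pos t ∧ ρ.pos t ≤ x₂)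
    (hout : T.capacity * T.hmax * (2 ^ (3 * T.emax) + 4) < (ρ.outOn Z).length) :
    ∃ t, t₁ ≤ t ∧ t < t₂ ∧ x₁ < ρ.pos t ∧ ρ.pos t < x₂ ∧ ∃ L w, ρ.TwoWayAnchor L t w := by
  classical
  rw [length_outOn] at hout
  set X := (Finset.range ρ.len).filter fun t => t ∈ Z ∧ t + 1 ∈ Z with hX
  set X' := X.filter fun t => (ρ.rule t).output ≠ [] with hX'
  have hmemX : ∀ t ∈ X', t < ρ.len ∧ t ∈ Z ∧ t + 1 ∈ Z ∧ (ρ.rule t).output ≠ [] := by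
    intro t ht
    simp only [hX', hX, Finset.mem_filter, Finset.mem_range] at ht
    tauto
  have h1 := ρ.sum_output_le (X := X) (N := X'.card)
    (fun t ht => Finset.mem_range.1 (Finset.mem_filter.1 ht).1) le_rfl
  set S := X'.image ρ.head with hS
  -- Each letter is read at most `T.hmax` times, so a large output comes from many different
  -- letters.
  have h2 : X'.card ≤ T.hmax * S.card := by
    refine Finset.card_le_mul_card_image (f := ρ.head) X' T.hmax ?_
    intro x _
    refine le_trans (Finset.card_le_card ?_) (ρ.card_readings_le hs hn x)
    intro t ht
    rw [Finset.mem_filter] at ht ⊢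
    exact ⟨Finset.mem_range.2 (hmemX t ht.1).1, ht.2⟩
  have h3 : 2 ^ (3 * T.emax) + 4 < S.card := by
    by_contra hcon
    have h4 : T.capacity * X'.card ≤ T.capacity * (T.hmax * (2 ^ (3 * T.emax) + 4)) :=
      Nat.mul_le_mul_left _ (h2.trans (Nat.mul_le_mul_left _ (by omega)))
    rw [← mul_assoc] at h4
    omega
  have hpow : 0 < 2 ^ (3 * T.emax) := by positivity
  obtain ⟨p, hp, hpS⟩ := exists_enumeration_of_finset S
  have hpos : ∀ i < S.card, ∃ t, t < ρ.len ∧ ρ.head t = p i ∧ (ρ.rule t).output ≠ [] ∧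
      t₁ ≤ t ∧ t + 1 ≤ t₂ ∧ x₁ ≤ p i + 1 ∧ p i ≤ x₂ := by
    intro i hi
    obtain ⟨t, ht, hti⟩ := Finset.mem_image.1 (hpS i hi)
    obtain ⟨g1, g2, g3, g4⟩ := hmemX t ht
    have b1 := hZ t g2
    have b2 := hZ (t + 1) g3
    have b3 := ρ.step g1
    have b4 := ρ.pos_eq_or g1.le
    exact ⟨t, g1, hti, g4, b1.1, b2.2.1, by omega, by omega⟩
  -- Two indices are left out at either end, to have the anchor strictly between `x₁` and `x₂`. At
  -- the lower end one index would not do, since `p 0` may equal `x₁ - 1`.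
  obtain ⟨a, a1, a2, a3, a4, k, R, hH⟩ := exists_homogeneous_positions hs hn (p := p) (lo := 2)
    (hi := S.card - 2) (by omega) (fun i j hij hj => hp i j hij (by omega))
    (fun i hi => by
      obtain ⟨t, g1, g2, -⟩ := hpos i (by omega)
      have := ρ.head_lt g1
      omega)
  have hai : ∀ i ≤ 3, 2 ≤ a i ∧ a i ≤ S.card - 2 := by
    intro i hi
    have b1 : a 0 ≤ a i := by
      rcases Nat.eq_zero_or_pos i with rfl | h
      · exact le_rfl
      · exact (a3 0 i h hi).le
    have b2 : a i ≤ a 3 := by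
      rcases hi.eq_or_lt with rfl | h
      · exact le_rfl
      · exact (a3 i 3 h le_rfl).le
    omega
  have hex : ∀ j, ∃ t, 1 ≤ j → j ≤ 3 → t < ρ.len ∧ ρ.head t = p (a (j - 1)) ∧
      (ρ.rule t).output ≠ [] ∧ t₁ ≤ t ∧ t + 1 ≤ t₂ := by
    intro j
    by_cases hj : j ≤ 3
    · have := hai (j - 1) (by omega)
      obtain ⟨t, g1, g2, g3, g4, g5, -⟩ := hpos (a (j - 1)) (by omega)
      exact ⟨t, fun _ _ => ⟨g1, g2, g3, g4, g5⟩⟩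
    · exact ⟨0, fun _ h => absurd h hj⟩
  choose r hr using hex
  obtain ⟨t, l1, l2, ⟨i, hi, l3⟩, l4⟩ := hH.exists_twoWayAnchor hs a4 (r := r) (lo := t₁)
    (hi := t₂ - 1) (by
      intro j hj1 hj3
      obtain ⟨g1, g2, g3, g4, g5⟩ := hr j hj1 hj3
      have := hH.lt (j - 1) j (by omega) hj3
      exact ⟨g1, g2.ge, by omega, g3, g4, by omega⟩)
  have hr1 := hr 1 (by omega) (by omega)
  have hb := hai i hi
  have c1 := hp 0 1 (by omega) (by omega)
  have c2 := hp 1 (a i) (by omega) (by omega)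
  have c3 := hp (a i) (S.card - 1) (by omega) (by omega)
  obtain ⟨-, -, -, -, -, -, d1, -⟩ := hpos 0 (by omega)
  obtain ⟨-, -, -, -, -, -, -, d2⟩ := hpos (S.card - 1) (by omega)
  exact ⟨t, l1, by omega, by omega, by omega, l4⟩

end Run

end TwoWayTransducer

namespace TwoWayTransducer

namespace Run

variable {Q A Γ : Type*} {T : TwoWayTransducer Q A Γ} {u : List A} {ρ : T.Run u}
  {P : ℕ × ℕ → ℕ → List Γ → Prop} {B : ℕ}

/-! ### Comparing outputs -/

theorem length_outOn_Icc {s e : ℕ} (he : e ≤ ρ.len) :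
    (ρ.outOn (Finset.Icc s e)).length = (ρ.factorOut s e).length := by
  rw [length_outOn, length_factorOut]
  apply Finset.sum_congr _ fun _ _ => rfl
  ext t
  simp only [Finset.mem_filter, Finset.mem_range, Finset.mem_Icc, Finset.mem_Ico]
  omega

theorem length_outOn_le_add {Z Z' : Finset ℕ} (r₀ : ℕ)
    (h : ∀ r < ρ.len, r ∈ Z → r + 1 ∈ Z → (r ∈ Z' ∧ r + 1 ∈ Z') ∨ r = r₀) :
    (ρ.outOn Z).length ≤ (ρ.outOn Z').length + T.capacity := by
  classical
  rw [length_outOn, length_outOn]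
  set X := (Finset.range ρ.len).filter (fun t => t ∈ Z ∧ t + 1 ∈ Z) with hX
  set X' := (Finset.range ρ.len).filter (fun t => t ∈ Z' ∧ t + 1 ∈ Z') with hX'
  rw [← Finset.sum_filter_add_sum_filter_not X fun t => t ∈ X']
  apply add_le_add
  · apply Finset.sum_le_sum_of_subset
    intro t ht
    exact (Finset.mem_filter.1 ht).2
  · refine le_trans (Finset.sum_le_card_nsmul _ _ T.capacity ?_) ?_
    · intro t ht
      simp only [hX, Finset.mem_filter, Finset.mem_range] at ht
      exact ρ.capacity_le ht.1.1
    · have : (X.filter fun t => t ∉ X').card ≤ 1 := by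
        rw [Finset.card_le_one]
        have key : ∀ t ∈ X.filter (fun t => t ∉ X'), t = r₀ := by
          intro t ht
          simp only [hX, hX', Finset.mem_filter, Finset.mem_range] at ht
          have := h t ht.1.1 ht.1.2.1 ht.1.2.2
          tauto
        intro a ha b hb
        rw [key a ha, key b hb]
      rw [smul_eq_mul]
      exact (Nat.mul_le_mul_right _ this).trans (by omega)

theorem length_outOn_le {Z Z' : Finset ℕ}
    (h : ∀ r < ρ.len, r ∈ Z → r + 1 ∈ Z → r ∈ Z' ∧ r + 1 ∈ Z') :
    (ρ.outOn Z).length ≤ (ρ.outOn Z').length := by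
  rw [length_outOn, length_outOn]
  apply Finset.sum_le_sum_of_subset
  intro r hr
  simp only [Finset.mem_filter, Finset.mem_range] at hr ⊢
  exact ⟨hr.1, h r hr.1 hr.2.1 hr.2.2⟩

theorem length_outOn_eq_zero {Z : Finset ℕ} (h : ∀ r < ρ.len, r ∈ Z → r + 1 ∉ Z) :
    (ρ.outOn Z).length = 0 := by
  rw [length_outOn]
  apply Finset.sum_eq_zero
  intro r hr
  simp only [Finset.mem_filter, Finset.mem_range] at hr
  exact absurd hr.2.2 (h r hr.1 hr.2.1)

theorem BlockData.almostPeriodic {K : Set ℕ} {a b s e : ℕ} (hP : ρ.ProperAnchors P)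
    (h2 : ρ.SatisfiesP2 P B) (hK : ρ.IsInversionClass P K) (hD : ρ.BlockData P K a b s e)
    {p : ℕ} (hp : B ≤ p) (h1 : (ρ.factorOut s a).length ≤ p)
    (h3 : (ρ.factorOut b e).length ≤ p) : AlmostPeriodic p (ρ.factorOut s e) := by
  obtain ⟨q, hq, hper⟩ := hK.hasPeriod hP h2 hD.least hD.greatest
  have := hD.s_le
  have := hD.lt
  have := hD.le_e
  refine ⟨_, ρ.factorOut a b, _, ?_, h1, h3, q, by omega, hper⟩
  rw [ρ.factorOut_append (s := s) (m := a) (e := e) (by omega) (by omega),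
    ρ.factorOut_append (s := a) (m := b) (e := e) (by omega) (by omega), List.append_assoc]

theorem BlockData.isForwardFactor {K : Set ℕ} {a b s e : ℕ} (hD : ρ.BlockData P K a b s e) :
    ρ.IsForwardFactor s e := by
  have := hD.s_le
  have := hD.lt
  have := hD.le_e
  exact ⟨by omega, hD.e_le, hD.pos_le⟩

/-! ### The two-way case -/

theorem properAnchors_twoWayAnchor : ρ.ProperAnchors ρ.TwoWayAnchor := by
  rintro L t w ⟨-, ⟨C, -, h, -⟩, fs, -, -, hw⟩
  exact ⟨h, hw⟩

/-- Each of the four bounds holds because too much output would yield an anchor point strictly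
inside a region where `before`, `after` and `inside` allow none. -/
theorem BlockData.isTwoWayBlock [Fintype Q] (hs : ρ.IsSuccessful) (hn : ρ.IsNormalized)
    (h2 : ρ.SatisfiesP2 ρ.TwoWayAnchor T.twoWayBound) {K : Set ℕ} {a b s e : ℕ}
    (hK : ρ.IsInversionClass ρ.TwoWayAnchor K) (hD : ρ.BlockData ρ.TwoWayAnchor K a b s e) :
    ρ.IsTwoWayBlock T.twoWayBound s e := by
  have hsa := hD.s_le
  have hab := hD.lt
  have hbe := hD.le_e
  have hel := hD.e_le
  have hpse := hD.pos_le
  have hB : T.twoWayBound = T.capacity * T.hmax * (2 ^ (3 * T.emax) + 4) + 4 * T.capacity := rfl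
  refine ⟨hD.isForwardFactor, hD.almostPeriodic properAnchors_twoWayAnchor h2 hK le_rfl ?_ ?_,
    ?_, ?_⟩
  · by_contra hcon
    rw [← length_outOn_Icc (by omega)] at hcon
    obtain ⟨t, h3, h4, h5, -, L, w, hPt⟩ := exists_twoWayAnchor_of_outOn hs hn (t₁ := s)
      (t₂ := a) (x₁ := ρ.pos s) (x₂ := u.length) (Z := Finset.Icc s a)
      (by
        intro t ht
        rw [Finset.mem_Icc] at ht
        refine ⟨ht.1, ht.2, ?_, ρ.pos_le hs (by omega)⟩
        rcases ht.1.eq_or_lt with rfl | h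
        · exact le_rfl
        · exact (hD.left t h ht.2).le) (by omega)
    have := hD.before _ _ _ hPt h4
    omega
  · by_contra hcon
    rw [← length_outOn_Icc (by omega)] at hcon
    -- `after` requires a time strictly after `b`, so the first transition is given up; the summand
    -- `4 * T.capacity` of the bound pays for it.
    have hle := length_outOn_le_add (ρ := ρ) (Z := Finset.Icc b e) (Z' := Finset.Icc (b + 1) e) b
      (by
        intro r _ h3 h4
        rw [Finset.mem_Icc] at *
        rw [Finset.mem_Icc]
        omega)
    obtain ⟨t, h3, h4, -, h5, L, w, hPt⟩ := exists_twoWayAnchor_of_outOn hs hn (t₁ := b + 1)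
      (t₂ := e) (x₁ := 0) (x₂ := ρ.pos e) (Z := Finset.Icc (b + 1) e)
      (by
        intro t ht
        rw [Finset.mem_Icc] at ht
        refine ⟨ht.1, ht.2, Nat.zero_le _, ?_⟩
        rcases ht.2.eq_or_lt with rfl | h
        · exact le_rfl
        · exact (hD.right t (by omega) h).le) (by omega)
    have := hD.after _ _ _ hPt (by omega)
    omega
  · by_contra hcon
    obtain ⟨t, h3, h4, -, h5, L, w, hPt⟩ := exists_twoWayAnchor_of_outOn hs hn (t₁ := s)
      (t₂ := e) (x₁ := 0) (x₂ := ρ.pos s)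
      (Z := (Finset.Icc s e).filter fun r => ρ.pos r ≤ ρ.pos s)
      (by
        intro t ht
        rw [Finset.mem_filter, Finset.mem_Icc] at ht
        exact ⟨ht.1.1, ht.1.2, Nat.zero_le _, ht.2⟩) (by omega)
    have hne : t ≠ s := by rintro rfl; omega
    have i1 := hD.inside _ _ _ hPt
    have i2 := hD.after _ _ _ hPt
    have i3 := hD.left t
    omega
  · by_contra hcon
    obtain ⟨t, h3, h4, h5, -, L, w, hPt⟩ := exists_twoWayAnchor_of_outOn hs hn (t₁ := s)
      (t₂ := e) (x₁ := ρ.pos e) (x₂ := u.length)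
      (Z := (Finset.Icc s e).filter fun r => ρ.pos e ≤ ρ.pos r)
      (by
        intro t ht
        rw [Finset.mem_filter, Finset.mem_Icc] at ht
        exact ⟨ht.1.1, ht.1.2, ht.2, ρ.pos_le hs (by omega)⟩) (by omega)
    have i1 := hD.inside _ _ _ hPt
    have i2 := hD.before _ _ _ hPt
    have i3 := hD.right t
    omega

/-- For each `x` take the earliest visit `t` after which little output is produced to the left of
`x`; the last visit shows that one exists. If much output were produced to the right of `x` before
`t`, then the previous visit `t'` would have much output on its right before it and on its left
after it. This yields two anchor points forming an inversion. -/
theorem IsForwardFactor.isTwoWayDiagonal [Fintype Q] (hs : ρ.IsSuccessful)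
    (hn : ρ.IsNormalized) {s e : ℕ} (hF : ρ.IsForwardFactor s e)
    (hA : ρ.AvoidsInversionBlocks ρ.TwoWayAnchor s e) :
    ρ.IsTwoWayDiagonal T.twoWayBound s e := by
  classical
  refine ⟨hF, ?_⟩
  obtain ⟨hse, hel, hpse⟩ := hF
  intro x hsx hxe
  have hB : T.twoWayBound = T.capacity * T.hmax * (2 ^ (3 * T.emax) + 4) + 4 * T.capacity := rfl
  have hex : ∃ t, s ≤ t ∧ t ≤ e ∧ ρ.pos t = x ∧
      (ρ.outOn ((Finset.Icc t e).filter fun r => ρ.pos r ≤ x)).length ≤ T.twoWayBound := by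
    obtain ⟨t₀, h1, h2, h3⟩ := ρ.exists_pos_eq_up hse hel hsx hxe
    have hG := Nat.findGreatest_spec (P := fun t => s ≤ t ∧ ρ.pos t = x) h2 ⟨h1, h3⟩
    have hG' := Nat.findGreatest_le (P := fun t => s ≤ t ∧ ρ.pos t = x) e
    have hG'' := fun t => Nat.findGreatest_is_greatest (P := fun t => s ≤ t ∧ ρ.pos t = x)
      (n := e) (k := t)
    generalize Nat.findGreatest (fun t => s ≤ t ∧ ρ.pos t = x) e = t at *
    refine ⟨t, hG.1, hG', hG.2, ?_⟩
    rw [length_outOn_eq_zero]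
    · exact Nat.zero_le _
    · intro r _ _ hr
      rw [Finset.mem_filter, Finset.mem_Icc] at *
      rename_i hr'
      obtain ⟨r', h4, h5, h6⟩ := ρ.exists_pos_eq_up hr.1.2 hel hr.2 hxe
      exact hG'' r' (by omega) h5 ⟨by omega, h6⟩
  obtain ⟨hst, hte, hpt, hout⟩ := Nat.find_spec hex
  have hmin := fun t' => Nat.find_min hex (m := t')
  generalize Nat.find hex = t at *
  refine ⟨t, hst, hte, hpt, hout, ?_⟩
  by_cases hvis : ∃ t', s ≤ t' ∧ t' < t ∧ ρ.pos t' = x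
  swap
  · rw [length_outOn_eq_zero]
    · exact Nat.zero_le _
    · intro r _ hr hr'
      rw [Finset.mem_filter, Finset.mem_Icc] at *
      obtain ⟨r', h4, h5, h6⟩ := ρ.exists_pos_eq_up hr.1.1 (by omega) hsx hr.2
      exact hvis ⟨r', h4, by omega, h6⟩
  obtain ⟨t₀, g1, g2, g3⟩ := hvis
  have hG := Nat.findGreatest_spec (P := fun t' => s ≤ t' ∧ ρ.pos t' = x)
    (by omega : t₀ ≤ t - 1) ⟨g1, g3⟩
  have hG' := Nat.findGreatest_le (P := fun t' => s ≤ t' ∧ ρ.pos t' = x) (t - 1)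
  have hG'' := fun t' => Nat.findGreatest_is_greatest (P := fun t' => s ≤ t' ∧ ρ.pos t' = x)
    (n := t - 1) (k := t')
  generalize Nat.findGreatest (fun t' => s ≤ t' ∧ ρ.pos t' = x) (t - 1) = t' at *
  obtain ⟨hst', hpt'⟩ := hG
  have htt' : t' < t := by omega
  have hnov : ∀ r, t' < r → r < t → ρ.pos r ≠ x := fun r h1 h2 h3 =>
    hG'' r h1 (by omega) ⟨by omega, h3⟩
  have hbig : T.twoWayBound <
      (ρ.outOn ((Finset.Icc t' e).filter fun r => ρ.pos r ≤ x)).length := by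
    by_contra hcon
    exact hmin t' htt' ⟨hst', by omega, hpt', by omega⟩
  by_contra hcon
  push Not at hcon
  -- Between `t'` and `t` the run stays on one side of `x`. An excursion to the right leaves the
  -- left output unchanged, contradicting minimality; otherwise at most the transition at `t'` is
  -- lost from the right output.
  rcases lt_or_ge x (ρ.pos (t' + 1)) with hdir | hdir
  · have := length_outOn_le (ρ := ρ) (Z := (Finset.Icc t' e).filter fun r => ρ.pos r ≤ x)
      (Z' := (Finset.Icc t e).filter fun r => ρ.pos r ≤ x)
      (by
        intro r _ h1 h2
        simp only [Finset.mem_filter, Finset.mem_Icc] at *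
        have h3 : t ≤ r := by
          by_contra h4
          rcases h1.1.1.eq_or_lt with rfl | h5
          · omega
          · obtain ⟨r', k1, k2, k3⟩ := ρ.exists_pos_eq_down (x := x) h5 (by omega) hdir.le h1.2
            exact hnov r' (by omega) (by omega) k3
        omega)
    omega
  · have hle := length_outOn_le_add (ρ := ρ)
      (Z := (Finset.Icc s t).filter fun r => x ≤ ρ.pos r)
      (Z' := (Finset.Icc s t').filter fun r => x ≤ ρ.pos r) t'
      (by
        intro r _ h1 h2
        simp only [Finset.mem_filter, Finset.mem_Icc] at *
        have h3 : r ≤ t' := by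
          by_contra h4
          obtain ⟨r', k1, k2, k3⟩ := ρ.exists_pos_eq_up (x := x) (by omega : t' + 1 ≤ r)
            (by omega) hdir h1.2
          exact hnov r' (by omega) (by omega) k3
        omega)
    obtain ⟨α, a1, a2, -, a3, L₂, w₂, hα⟩ := exists_twoWayAnchor_of_outOn hs hn (t₁ := t')
      (t₂ := e) (x₁ := 0) (x₂ := x) (Z := (Finset.Icc t' e).filter fun r => ρ.pos r ≤ x)
      (by
        intro r hr
        rw [Finset.mem_filter, Finset.mem_Icc] at hr
        exact ⟨hr.1.1, hr.1.2, Nat.zero_le _, hr.2⟩) (by omega)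
    obtain ⟨β, b1, b2, b3, -, L₁, w₁, hβ⟩ := exists_twoWayAnchor_of_outOn hs hn (t₁ := s)
      (t₂ := t') (x₁ := x) (x₂ := u.length)
      (Z := (Finset.Icc s t').filter fun r => x ≤ ρ.pos r)
      (by
        intro r hr
        rw [Finset.mem_filter, Finset.mem_Icc] at hr
        exact ⟨hr.1.1, hr.1.2, hr.2, ρ.pos_le hs (by omega)⟩) (by omega)
    exact hA.not_isInversion properAnchors_twoWayAnchor hs (t₁ := β) (t₂ := α) (by omega)
      (by omega) ⟨hβ, hα, by omega, by omega⟩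

end Run

end TwoWayTransducer

namespace TwoWayTransducer

namespace Run

variable {Q A Γ : Type*} {T : TwoWayTransducer Q A Γ} {u : List A} {ρ : T.Run u}

/-! ### Levels of sweeping runs -/

theorem pos_pos (t : ℕ) (h0 : 0 < t) (ht : t ≤ ρ.len) : 1 ≤ ρ.pos t := by
  obtain ⟨r, rfl⟩ : ∃ r, t = r + 1 := ⟨t - 1, by omega⟩
  have := ρ.step (t := r) (by omega)
  omega

theorem pos_lt (hs : ρ.IsSuccessful) (hu : 2 ≤ u.length) {t : ℕ} (ht : t < ρ.len) :
    ρ.pos t + 1 ≤ u.length := by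
  rcases t with _ | r
  · have := ρ.pos_zero hs; omega
  · have := ρ.step (t := r) (by omega)
    have := ρ.head_lt (t := r) (by omega)
    have := ρ.head_lt ht
    omega

/-- The numbers of visits of the inner positions: all of them have been visited once in each of the
first `k` sweeps, and the ones that the head has passed were visited in the current sweep. -/
theorem ReversesOnlyAtBorders.exists_visits (hb : ρ.ReversesOnlyAtBorders) (hs : ρ.IsSuccessful)
    {t : ℕ} (ht : t ≤ ρ.len) :
    ∃ k, (Even k ↔ ρ.head t = ρ.pos t) ∧ ∀ x, 1 ≤ x → x + 1 ≤ u.length →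
      ρ.visits (t + 1) x =
        k + if (Even k ∧ x ≤ ρ.head t) ∨ (¬ Even k ∧ ρ.head t < x) then 1 else 0 := by
  induction t with
  | zero =>
    refine ⟨0, by simp [pos], fun x h1 h2 => ?_⟩
    have := ρ.pos_zero hs
    have := hs.1
    have h : ρ.visits 0 x = 0 := by simp [visits]
    rw [visits_succ, h, if_neg (by omega), if_neg]
    simp only [Even.zero, true_and, not_true_eq_false, false_and, or_false]
    omega
  | succ t ih =>
    obtain ⟨k, hk, hv⟩ := ih (by omega)
    have hst := ρ.step (t := t) (by omega)
    have hh := ρ.head_lt (t := t) (by omega)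
    have hp := ρ.pos_eq_or (t := t) (by omega)
    -- Moving against the direction of the current sweep is a reversal, hence possible only at a
    -- border.
    have hborder : (Even k ∧ ρ.head t = ρ.head (t + 1) + 1 → ρ.head t + 1 = u.length) ∧
        (¬ Even k ∧ ρ.head (t + 1) = ρ.head t + 1 → ρ.head t = 0) := by
      rcases t with _ | r
      · have := hs.1
        exact ⟨by omega, by omega⟩
      · have hst' := ρ.step (t := r) (by omega)
        have hh' := ρ.head_lt (t := r) (by omega)
        constructor
        · rintro ⟨h1, h2⟩
          rw [hk] at h1
          have := hb r (by omega) (by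
            intro h
            rcases hst' with h3 | h3
            · rcases hst with h4 | h4
              · omega
              · rw [h3.1, h4.1] at h; cases h
            · omega)
          omega
        · rintro ⟨h1, h2⟩
          rw [hk] at h1
          have := hb r (by omega) (by
            intro h
            rcases hst' with h3 | h3
            · omega
            · rcases hst with h4 | h4
              · rw [h3.1, h4.1] at h; cases h
              · omega)
          omega
    by_cases hev : Even k
    · have hev1 : ¬ Even (k + 1) := by rwa [Nat.even_add_one, not_not]
      rcases hst with h1 | h1
      · refine ⟨k, by simp only [hev, true_iff]; omega, fun x h2 h3 => ?_⟩
        have := hv x h2 h3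
        simp only [hev, true_and, not_true_eq_false, false_and, or_false] at this ⊢
        rw [visits_succ, this]
        split_ifs <;> omega
      · have hb1 := hborder.1 ⟨hev, h1.2.1⟩
        refine ⟨k + 1, by simp only [hev1, false_iff]; omega, fun x h2 h3 => ?_⟩
        have := hv x h2 h3
        simp only [hev, hev1, true_and, not_true_eq_false, not_false_eq_true, false_and, or_false,
          false_or] at this ⊢
        rw [visits_succ, this]
        split_ifs <;> omega
    · have hev1 : Even (k + 1) := by rwa [Nat.even_add_one]
      rcases hst with h1 | h1
      · have hb1 := hborder.2 ⟨hev, h1.2.1⟩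
        refine ⟨k + 1, by simp only [hev1, true_iff]; omega, fun x h2 h3 => ?_⟩
        have := hv x h2 h3
        simp only [hev, hev1, true_and, not_true_eq_false, not_false_eq_true, false_and, or_false,
          false_or] at this ⊢
        rw [visits_succ, this]
        split_ifs <;> omega
      · refine ⟨k, by simp only [hev, false_iff]; omega, fun x h2 h3 => ?_⟩
        have := hv x h2 h3
        simp only [hev, true_and, not_false_eq_true, false_and, false_or] at this ⊢
        rw [visits_succ, this]
        split_ifs <;> omega

theorem ReversesOnlyAtBorders.width_eq (hb : ρ.ReversesOnlyAtBorders) (hs : ρ.IsSuccessful)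
    (hu : 2 ≤ u.length) {x : ℕ} (h1 : 1 ≤ x) (h2 : x + 1 ≤ u.length) :
    ρ.width x = ρ.width 1 := by
  obtain ⟨k, hk, hv⟩ := hb.exists_visits hs le_rfl
  have h3 : Even k := by rw [hk, hs.2.2.1, ρ.pos_len hs]
  have h4 := hs.2.2.1
  rw [width, width, hv x h1 h2, hv 1 le_rfl (by omega), if_pos, if_pos]
  · exact Or.inl ⟨h3, by omega⟩
  · exact Or.inl ⟨h3, by omega⟩

/-- Before the last transition, a sweeping run either moves on within the current level, or it
reverses at a border and moves up one level. -/
theorem ReversesOnlyAtBorders.step_level (hb : ρ.ReversesOnlyAtBorders) (hs : ρ.IsSuccessful)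
    (hu : 2 ≤ u.length) {t : ℕ} (ht : t + 1 < ρ.len) :
    (ρ.level (t + 1) = ρ.level t ∧
      (Even (ρ.level t) ∧ ρ.pos (t + 1) = ρ.pos t + 1 ∨
        ¬ Even (ρ.level t) ∧ ρ.pos t = ρ.pos (t + 1) + 1)) ∨
    (ρ.level (t + 1) = ρ.level t + 1 ∧ ρ.pos (t + 1) = ρ.pos t ∧
      (Even (ρ.level t) ∧ ρ.head t + 1 = u.length ∨
        ¬ Even (ρ.level t) ∧ ρ.head t = 0)) := by
  obtain ⟨k, hk, hv⟩ := hb.exists_visits hs (t := t) (by omega)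
  have hst := ρ.step (t := t) (by omega)
  have hp := ρ.pos_eq_or (t := t) (by omega)
  have he := ρ.even_level_iff hs.1 (t := t) (by omega)
  have hh := ρ.head_lt (t := t) (by omega)
  have hp1 := pos_pos (ρ := ρ) (t + 1) (by omega) (by omega)
  have hp2 := pos_lt hs hu (t := t + 1) (by omega)
  have hp3 := pos_lt hs hu (t := t) (by omega)
  have hlev : ρ.level t = k := by
    rcases Nat.eq_zero_or_pos t with rfl | h
    · have h1 := hv 1 le_rfl (by omega)
      have h2 : ρ.visits (0 + 1) 1 = 0 := by
        have := ρ.pos_zero hs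
        rw [visits_succ, if_neg (by omega)]
        simp [visits]
      have h3 : ρ.level 0 = 0 := by simp [level]
      omega
    · have h1 := hv (ρ.pos t) (pos_pos _ h (by omega)) hp3
      rw [visits_succ_pos, if_pos] at h1
      · omega
      · by_cases h2 : ρ.head t = ρ.pos t
        · exact Or.inl ⟨hk.2 h2, by omega⟩
        · exact Or.inr ⟨fun h3 => h2 (hk.1 h3), by omega⟩
  have hborder : ρ.pos (t + 1) = ρ.pos t → (ρ.head t = ρ.pos t → ρ.head t + 1 = u.length) ∧
      (ρ.head t ≠ ρ.pos t → ρ.head t = 0) := by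
    intro h
    rcases t with _ | r
    · have := ρ.pos_zero hs; omega
    · have hst' := ρ.step (t := r) (by omega)
      have hh' := ρ.head_lt (t := r) (by omega)
      have := hb r (by omega) (by
        intro h
        rcases hst' with h3 | h3 <;> rcases hst with h4 | h4
        · omega
        · rw [h3.1, h4.1] at h; cases h
        · rw [h3.1, h4.1] at h; cases h
        · omega)
      omega
  by_cases hpp : ρ.pos (t + 1) = ρ.pos t
  · right
    refine ⟨?_, hpp, ?_⟩
    · rw [level_eq_visits, hpp, visits_succ_pos]
    · rw [he]
      by_cases h : ρ.head t = ρ.pos t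
      · exact Or.inl ⟨h, (hborder hpp).1 h⟩
      · exact Or.inr ⟨h, (hborder hpp).2 h⟩
  · left
    constructor
    · rw [level_eq_visits, hv _ hp1 hp2, if_neg, hlev, add_zero]
      rw [hk]
      omega
    · rw [he]
      omega

/-- The last location has to be excluded: it is the only one at position `u.length`, and so its
level is `0`. -/
theorem ReversesOnlyAtBorders.level_le (hb : ρ.ReversesOnlyAtBorders) (hs : ρ.IsSuccessful)
    (hu : 2 ≤ u.length) {s t : ℕ} (hst : s ≤ t) (ht : t < ρ.len) : ρ.level s ≤ ρ.level t := by
  induction t, hst using Nat.le_induction with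
  | base => exact le_rfl
  | succ t hst ih =>
    have := ih (by omega)
    have := hb.step_level hs hu ht
    omega

theorem ReversesOnlyAtBorders.pos_eq (hb : ρ.ReversesOnlyAtBorders) (hs : ρ.IsSuccessful)
    (hu : 2 ≤ u.length) {s t : ℕ} (hst : s ≤ t) (ht : t < ρ.len) (hl : ρ.level s = ρ.level t) :
    Even (ρ.level s) ∧ ρ.pos t = ρ.pos s + (t - s) ∨
      ¬ Even (ρ.level s) ∧ ρ.pos s = ρ.pos t + (t - s) := by
  induction t, hst using Nat.le_induction with
  | base =>
    by_cases h : Even (ρ.level s)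
    · exact Or.inl ⟨h, by omega⟩
    · exact Or.inr ⟨h, by omega⟩
  | succ t hst ih =>
    have h1 := hb.level_le hs hu hst (by omega)
    have h2 := hb.step_level hs hu ht
    have h3 : ρ.level s = ρ.level t := by omega
    rcases ih (by omega) h3 with h4 | h4
    · rw [h3] at h4 ⊢
      refine Or.inl ⟨h4.1, ?_⟩
      rcases h2 with ⟨-, h2 | h2⟩ | h2
      · omega
      · exact absurd h4.1 h2.1
      · omega
    · rw [h3] at h4 ⊢
      refine Or.inr ⟨h4.1, ?_⟩
      rcases h2 with ⟨-, h2 | h2⟩ | h2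
      · exact absurd h2.1 h4.1
      · omega
      · omega

end Run

end TwoWayTransducer

namespace TwoWayTransducer

namespace Run

variable {Q A Γ : Type*} {T : TwoWayTransducer Q A Γ} {u : List A} {ρ : T.Run u}

/-! ### Loops of sweeping runs -/

theorem ReversesOnlyAtBorders.intercepted (hb : ρ.ReversesOnlyAtBorders) (hs : ρ.IsSuccessful)
    (hu : 2 ≤ u.length) {s e : ℕ} (hse : s < e) (he : e < ρ.len)
    (hl : ρ.level s = ρ.level e) :
    ρ.Intercepted (min (ρ.pos s) (ρ.pos e), max (ρ.pos s) (ρ.pos e)) s e := by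
  have hpos : ∀ t, s ≤ t → t ≤ e → ρ.level t = ρ.level s := fun t h1 h2 => by
    have := hb.level_le hs hu h1 (by omega)
    have := hb.level_le hs hu h2 he
    omega
  have hse' := hb.pos_eq hs hu hse.le he hl
  have es := ρ.even_level_iff hs.1 (t := s) (by omega)
  have ee := ρ.even_level_iff hs.1 (t := e) (by omega)
  have qe := ρ.pos_eq_or (t := e) he.le
  have qs := ρ.pos_eq_or (t := s) (by omega)
  rw [← hl] at ee
  refine ⟨hse, he.le, fun t h1 h2 => ?_, fun t h1 => ?_, fun _ => ?_⟩
  · have et := ρ.even_level_iff hs.1 (t := t) (by omega)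
    have qt := ρ.pos_eq_or (t := t) (by omega)
    have hp := hb.pos_eq hs hu h1 (by omega) (hpos t h1 h2.le).symm
    rw [hpos t h1 h2.le] at et
    dsimp only
    rcases hse' with h | h
    · have := et.1 h.1
      rcases hp with hp | hp
      · omega
      · exact absurd h.1 hp.1
    · have := mt et.2 h.1
      rcases hp with hp | hp
      · exact absurd hp.1 h.1
      · omega
  · subst h1
    have := ρ.step (t := t) (by omega)
    dsimp only
    rcases hse' with h | h
    · have := es.1 h.1
      omega
    · have := mt es.2 h.1
      omega
  · dsimp only
    rcases hse' with h | h
    · have := ee.1 h.1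
      omega
    · have := mt ee.2 h.1
      omega

theorem ReversesOnlyAtBorders.intercepted_level (hb : ρ.ReversesOnlyAtBorders)
    (hs : ρ.IsSuccessful) (hu : 2 ≤ u.length) {x₁ x₂ s e : ℕ} (h1 : 1 ≤ x₁)
    (h2 : x₂ + 1 ≤ u.length) (h : ρ.Intercepted (x₁, x₂) s e) :
    e < ρ.len ∧ ρ.level s = ρ.level e ∧
      (ρ.pos s = x₁ ∧ ρ.pos e = x₂ ∨ ρ.pos s = x₂ ∧ ρ.pos e = x₁) := by
  have hen := h.entry hs
  have hex := h.exit hs (by omega)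
  obtain ⟨hse, hel, hin, -, -⟩ := h
  dsimp only at hin
  have he : e < ρ.len := by
    rcases hel.eq_or_lt with rfl | h
    · have := hin (ρ.len - 1) (by omega) (by omega)
      have h4 := ρ.step (t := ρ.len - 1) (by omega)
      have := hs.2.2.1
      rw [show ρ.len - 1 + 1 = ρ.len by omega] at h4
      omega
    · exact h
  have hlev : ∀ t, s ≤ t → t ≤ e → ρ.level t = ρ.level s := by
    intro t ht
    induction t, ht using Nat.le_induction with
    | base => exact fun _ => rfl
    | succ t ht ih =>
      intro hte
      have := ih (by omega)
      have := hin t ht hte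
      have := hb.step_level hs hu (t := t) (by omega)
      omega
  have hl := hlev e hse.le le_rfl
  refine ⟨he, hl.symm, ?_⟩
  rw [hl] at hex
  have := Nat.not_even_iff_odd (n := ρ.level s)
  tauto

/-- Equal crossing sequences make the factor span a loop. If the factor is not output-minimal, a
strictly smaller loop still produces output on this level, and the argument is repeated inside it.
-/
theorem ReversesOnlyAtBorders.exists_sweepingAnchor (hb : ρ.ReversesOnlyAtBorders)
    (hs : ρ.IsSuccessful) (hu : 2 ≤ u.length) {s e : ℕ} (h0 : 0 < s) (hse : s < e)
    (he : e < ρ.len) (hl : ρ.level s = ρ.level e)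
    (hc : ρ.crossing (ρ.pos s) = ρ.crossing (ρ.pos e)) (hout : ρ.factorOut s e ≠ []) :
    ∃ t, s ≤ t ∧ t < e ∧ ρ.level t = ρ.level s ∧ ∃ L w, ρ.SweepingAnchor L t w := by
  obtain ⟨k, hk⟩ : ∃ k, e ≤ s + k := ⟨e, by omega⟩
  induction k generalizing s e with
  | zero => omega
  | succ k ih =>
    have hpp := hb.pos_eq hs hu hse.le he hl
    have hps := pos_pos (ρ := ρ) s h0 (by omega)
    have hps' := pos_lt hs hu (t := s) (by omega)
    have hpe := pos_pos (ρ := ρ) e (by omega) (by omega)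
    have hpe' := pos_lt hs hu he
    by_cases hm : ρ.OutputMinimal s e
    · refine ⟨s, le_rfl, hse, rfl, _, _, ⟨?_, ?_, ?_⟩, e, hb.intercepted hs hu hse he hl, hm,
        rfl, hout⟩
      · dsimp only; omega
      · dsimp only; omega
      · dsimp only
        rcases le_total (ρ.pos s) (ρ.pos e) with h | h
        · rw [min_eq_left h, max_eq_right h, hc]
        · rw [min_eq_right h, max_eq_left h, hc]
    · rw [OutputMinimal] at hm
      push Not at hm
      obtain ⟨⟨x₁, x₂⟩, ⟨hlt, hle, hcr⟩, h1, h2, h3, s', e', hI, hls, hne⟩ := hm hl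
      have h3' : ¬ (x₁ = min (ρ.pos s) (ρ.pos e) ∧ x₂ = max (ρ.pos s) (ρ.pos e)) := fun h =>
        h3 (by rw [← h.1, ← h.2])
      clear hm h3
      dsimp only at hlt hle hcr h1 h2
      obtain ⟨he', hle', hp'⟩ := hb.intercepted_level hs hu (by omega) (by omega) hI
      have hse' := hI.1
      have hpp' := hb.pos_eq hs hu hse'.le he' hle'
      have i1 : s ≤ s' := by
        by_contra hlt'
        have := hb.pos_eq hs hu (s := s') (t := s) (by omega) (by omega) hls
        rw [hls] at this hpp'
        rcases hpp with h | h
        · simp only [h.1, true_and, not_true_eq_false, false_and, or_false] at *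
          omega
        · simp only [h.1, true_and, not_false_eq_true, false_and, false_or] at *
          omega
      have i2 : e' ≤ e := by
        by_contra hlt'
        have := hb.pos_eq hs hu (s := e) (t := e') (by omega) (by omega) (by omega)
        rw [hls] at hpp'
        rw [← hl] at this
        rcases hpp with h | h
        · simp only [h.1, true_and, not_true_eq_false, false_and, or_false] at *
          omega
        · simp only [h.1, true_and, not_false_eq_true, false_and, false_or] at *
          omega
      have i3 : s = s' → e = e' → False := by
        rintro rfl rfl
        omega
      obtain ⟨t, j1, j2, j3, hA⟩ := ih (s := s') (e := e') (by omega) hse' he' hle'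
        (by rcases hp' with h | h <;> rw [h.1, h.2, hcr]) hne (by omega)
      exact ⟨t, by omega, by omega, by omega, hA⟩

/-! ### Counting crossing sequences -/

open Classical in
/-- The crossing sequences at the inner positions. -/
noncomputable def innerCrossings (ρ : T.Run u) : Finset (List Q) :=
  (Finset.Icc 1 (u.length - 1)).image ρ.crossing

theorem crossing_mem_innerCrossings {x : ℕ} (h1 : 1 ≤ x) (h2 : x + 1 ≤ u.length) :
    ρ.crossing x ∈ ρ.innerCrossings := by
  classical
  exact Finset.mem_image_of_mem _ (Finset.mem_Icc.2 ⟨h1, by omega⟩)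

/-- If there are at least two sweeps, then the constant sequences are not crossing sequences. -/
theorem ReversesOnlyAtBorders.card_innerCrossings_lt [Fintype Q] (hb : ρ.ReversesOnlyAtBorders)
    (hs : ρ.IsSuccessful) (hn : ρ.IsNormalized) (hu : 2 ≤ u.length) :
    ρ.innerCrossings.card ≤ Fintype.card Q ^ T.hmax ∧
      (2 ≤ ρ.width 1 → ρ.innerCrossings.card < Fintype.card Q ^ T.hmax) := by
  classical
  have hq : 0 < Fintype.card Q := Fintype.card_pos_iff.2 ⟨ρ.state 0⟩
  have hpow : Fintype.card Q ^ ρ.width 1 ≤ Fintype.card Q ^ T.hmax :=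
    Nat.pow_le_pow_right hq (ρ.width_le hs hn (x := 1) (by omega))
  set W : Finset (List Q) := (Finset.univ : Finset (List.Vector Q (ρ.width 1))).image
    List.Vector.toList with hW
  have hWc : W.card = Fintype.card Q ^ ρ.width 1 := by
    rw [hW, Finset.card_image_of_injective _ List.Vector.toList_injective, Finset.card_univ,
      card_vector]
  have hmem : ∀ w : List Q, w.length = ρ.width 1 → w ∈ W := fun w h =>
    Finset.mem_image.2 ⟨⟨w, h⟩, Finset.mem_univ _, rfl⟩
  have hsub : ρ.innerCrossings ⊆ W := by
    intro w hw
    obtain ⟨x, hx, rfl⟩ := Finset.mem_image.1 hw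
    rw [Finset.mem_Icc] at hx
    exact hmem _ (by rw [length_crossing, hb.width_eq hs hu hx.1 (by omega)])
  refine ⟨(Finset.card_le_card hsub).trans (hWc.le.trans hpow), fun h2 => ?_⟩
  refine lt_of_lt_of_le (Finset.card_lt_card ?_) (hWc.le.trans hpow)
  rw [Finset.ssubset_iff_of_subset hsub]
  -- The width is odd and at least `2`, so levels `0` and `2` exist; a constant crossing sequence
  -- would repeat a state on them, against normalization. The strict inequality makes room for one
  -- extra transition per level.
  refine ⟨List.replicate (ρ.width 1) (ρ.state 0), hmem _ (List.length_replicate ..), fun hw => ?_⟩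
  obtain ⟨x, hx, hxw⟩ := Finset.mem_image.1 hw
  rw [Finset.mem_Icc] at hx
  have hwx := hb.width_eq hs hu hx.1 (by omega)
  obtain ⟨m, hm⟩ := ρ.odd_width hs (x := x) (by omega)
  obtain ⟨t, ht, htx, htl⟩ := ρ.exists_visit (t := ρ.len + 1) (x := x) (y := 0)
    (by change _ < ρ.width x; omega)
  obtain ⟨t', ht', htx', htl'⟩ := ρ.exists_visit (t := ρ.len + 1) (x := x) (y := 2)
    (by change _ < ρ.width x; omega)
  have key : ∀ r, r < ρ.len + 1 → ρ.pos r = x → ρ.state r = ρ.state 0 := by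
    intro r hr hrx
    have h := ρ.crossing_getElem (t := r) (by omega)
    rw [hrx, hxw, List.getElem?_replicate] at h
    split_ifs at h
    exact (Option.some.inj h).symm
  have hlt : t < t' := by
    by_contra h
    have := ρ.level_le (s := t') (t := t) (by omega) (by omega)
    omega
  have := hn t t' hlt (by omega) (by omega) (by rw [key t ht htx, key t' ht' htx'])
  omega

/-- Without anchor points in between, a level produces few output. -/
theorem ReversesOnlyAtBorders.sum_output_le (hb : ρ.ReversesOnlyAtBorders) (hs : ρ.IsSuccessful)
    (hu : 2 ≤ u.length) {X V : Finset ℕ} (hX : ∀ t ∈ X, t < ρ.len)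
    (hV : ∀ t ∈ X, ρ.level t ∈ V)
    (hno : ∀ t₁ ∈ X, ∀ t₂ ∈ X, ∀ t, t₁ < t → t ≤ t₂ → ρ.level t = ρ.level t₁ →
      ρ.level t = ρ.level t₂ → ∀ L w, ¬ ρ.SweepingAnchor L t w) :
    ∑ t ∈ X, (ρ.rule t).output.length ≤
      V.card * (T.capacity * (ρ.innerCrossings.card + 1)) := by
  classical
  rw [← Finset.sum_fiberwise_of_maps_to hV, ← smul_eq_mul]
  apply Finset.sum_le_card_nsmul
  intro y _
  apply ρ.sum_output_le
  · intro t ht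
    exact hX t (Finset.mem_filter.1 ht).1
  set Y := (X.filter fun t => ρ.level t = y).filter fun t => (ρ.rule t).output ≠ [] with hY
  have hmem : ∀ t ∈ Y, t ∈ X ∧ ρ.level t = y ∧ (ρ.rule t).output ≠ [] := by
    intro t ht
    rw [hY, Finset.mem_filter, Finset.mem_filter] at ht
    tauto
  -- On each level, all contributing transitions except possibly the last are followed by a location
  -- on the same level. Two of these with equal crossing sequences after them would enclose an
  -- anchor point.
  rw [← Finset.card_filter_add_card_filter_not (s := Y)
    (fun t => t + 1 < ρ.len ∧ ρ.level (t + 1) = ρ.level t)]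
  apply add_le_add
  · by_contra hcard
    obtain ⟨t, ht, t', ht', hne, hcr⟩ := Finset.exists_ne_map_eq_of_card_lt_of_maps_to
      (not_le.1 hcard) (f := fun t => ρ.crossing (ρ.pos (t + 1)))
      (by
        intro t ht
        simp only [Finset.mem_coe, Finset.mem_filter] at ht
        exact crossing_mem_innerCrossings (pos_pos _ (by omega) (by omega))
          (pos_lt hs hu (by omega)))
    rw [Finset.mem_filter] at ht ht'
    have key : ∀ t ∈ Y, ∀ t' ∈ Y, t + 1 < ρ.len → t' + 1 < ρ.len →
        ρ.level (t + 1) = ρ.level t → ρ.level (t' + 1) = ρ.level t' → t < t' →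
        ρ.crossing (ρ.pos (t + 1)) = ρ.crossing (ρ.pos (t' + 1)) → False := by
      intro t ht t' ht' h1 h2 h3 h4 hlt hc
      obtain ⟨ht1, ht2, -⟩ := hmem t ht
      obtain ⟨ht1', ht2', ho⟩ := hmem t' ht'
      obtain ⟨r, hr1, hr2, hr3, L, w, hA⟩ := hb.exists_sweepingAnchor hs hu (s := t + 1)
        (e := t' + 1) (by omega) (by omega) h2 (by omega) hc
        (ρ.output_mem_factorOut_ne_nil (t := t') (by omega) (by omega) ho)
      exact hno t ht1 t' ht1' r (by omega) (by omega) (by omega) (by omega) L w hA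
    rcases lt_or_gt_of_ne hne with h | h
    · exact key t ht.1 t' ht'.1 ht.2.1 ht'.2.1 ht.2.2 ht'.2.2 h hcr
    · exact key t' ht'.1 t ht.1 ht'.2.1 ht.2.1 ht'.2.2 ht.2.2 h hcr.symm
  · rw [Finset.card_le_one]
    have key : ∀ t ∈ Y, ∀ t' ∈ Y, ¬ (t + 1 < ρ.len ∧ ρ.level (t + 1) = ρ.level t) → ¬ t < t' := by
      intro t ht t' ht' h1 h2
      have h3 := (hmem t ht).2.1
      have h4 := (hmem t' ht').2.1
      have h5 := hX t' (hmem t' ht').1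
      have h6 := hb.step_level hs hu (t := t) (by omega)
      have h7 := hb.level_le hs hu (s := t + 1) (t := t') (by omega) h5
      omega
    intro t ht t' ht'
    rw [Finset.mem_filter] at ht ht'
    have := key t ht.1 t' ht'.1 ht.2
    have := key t' ht'.1 t ht.1 ht'.2
    omega

end Run

end TwoWayTransducer

namespace TwoWayTransducer

theorem IsInput.two_le_length {Q A Γ : Type*} {T : TwoWayTransducer Q A Γ} {u : List A}
    (hu : T.IsInput u) : 2 ≤ u.length := by
  obtain ⟨w, -, rfl⟩ := hu
  simp

namespace Run

variable {Q A Γ : Type*} {T : TwoWayTransducer Q A Γ} {u : List A} {ρ : T.Run u}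

/-! ### The sweeping case -/

theorem properAnchors_sweepingAnchor : ρ.ProperAnchors ρ.SweepingAnchor := by
  rintro L t w ⟨-, e, h, -, -, hw⟩
  have := h.1
  have := h.2.1
  exact ⟨by omega, hw⟩

theorem SweepingAnchor.lt_len {L : ℕ × ℕ} {t : ℕ} {w : List Γ} (h : ρ.SweepingAnchor L t w) :
    t < ρ.len := by
  obtain ⟨-, e, h, -⟩ := h
  have := h.1
  have := h.2.1
  omega

/-- During a single sweep, positions only increase, so no inversion can occur. -/
theorem ReversesOnlyAtBorders.two_le_width (hb : ρ.ReversesOnlyAtBorders) (hs : ρ.IsSuccessful)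
    (hu : 2 ≤ u.length) {L₁ L₂ : ℕ × ℕ} {t₁ t₂ : ℕ} {w₁ w₂ : List Γ}
    (h : ρ.IsInversion ρ.SweepingAnchor L₁ t₁ w₁ L₂ t₂ w₂) : 2 ≤ ρ.width 1 := by
  obtain ⟨-, h2, hlt, hpos⟩ := h
  have ht := h2.lt_len
  have h3 := ρ.level_lt_width ht.le
  rw [hb.width_eq hs hu (pos_pos t₂ (by omega) ht.le) (pos_lt hs hu ht)] at h3
  by_contra hcon
  have h4 := hb.level_le hs hu hlt.le ht
  rcases hb.pos_eq hs hu hlt.le ht (by omega) with h5 | h5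
  · omega
  · exact h5.1 (by rw [show ρ.level t₁ = 0 by omega]; exact Even.zero)

theorem ReversesOnlyAtBorders.pos_between (hb : ρ.ReversesOnlyAtBorders) (hs : ρ.IsSuccessful)
    (hu : 2 ≤ u.length) {r s t : ℕ} (hrs : r ≤ s) (hst : s ≤ t) (ht : t < ρ.len)
    (h1 : ρ.level s = ρ.level r) (h2 : ρ.level s = ρ.level t) :
    ρ.pos r ≤ ρ.pos s ∧ ρ.pos s ≤ ρ.pos t ∨ ρ.pos t ≤ ρ.pos s ∧ ρ.pos s ≤ ρ.pos r := by
  have h3 := hb.pos_eq hs hu hrs (by omega) h1.symm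
  have h4 := hb.pos_eq hs hu hst ht h2
  rw [h1] at h4
  rcases h3 with h3 | h3 <;> rcases h4 with h4 | h4
  · omega
  · exact absurd h3.1 h4.1
  · exact absurd h4.1 h3.1
  · omega

theorem level_lt_hmax [Fintype Q] (hs : ρ.IsSuccessful) (hn : ρ.IsNormalized) {t : ℕ}
    (ht : t ≤ ρ.len) : ρ.level t < T.hmax :=
  (ρ.level_lt_width ht).trans_le (ρ.width_le hs hn (ρ.pos_le hs ht))

theorem BlockData.isSweepingBlock [Fintype Q] (hb : ρ.ReversesOnlyAtBorders)
    (hs : ρ.IsSuccessful) (hn : ρ.IsNormalized) (hu : 2 ≤ u.length)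
    (h2 : ρ.SatisfiesP2 ρ.SweepingAnchor T.sweepingBound) {K : Set ℕ} {a b s e : ℕ}
    (hK : ρ.IsInversionClass ρ.SweepingAnchor K)
    (hD : ρ.BlockData ρ.SweepingAnchor K a b s e) :
    ρ.IsSweepingBlock T.sweepingBound s e := by
  have hsa := hD.s_le
  have hab := hD.lt
  have hbe := hD.le_e
  have hel : e < ρ.len := by
    rcases hD.e_le.eq_or_lt with h | h
    · obtain ⟨c, -, hc, L, w, hA⟩ := hD.anchor_right
      have := pos_lt hs hu hA.lt_len
      have := ρ.pos_len hs
      rw [h] at hc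
      omega
    · exact h
  -- Position `0` is visited only at time `0`, which is covered by no inversion because its first
  -- anchor would have to lie to the right of another position.
  have hps : 1 ≤ ρ.pos s := by
    by_contra hcon
    obtain ⟨c, hcK, hc, L, w, hA⟩ := hD.anchor_left
    have hc0 : c = 0 := by
      by_contra h
      have := pos_pos (ρ := ρ) c (by omega) hA.lt_len.le
      omega
    obtain ⟨L₁, t₁, w₁, L₂, t₂, w₂, hI, h3, h4⟩ := hK.exists_isInversion hcK
    have := hI.2.2.2
    have := ρ.pos_zero hs
    rw [show t₁ = 0 by omega] at *
    omega
  have hbound : T.capacity * (ρ.innerCrossings.card + 1) ≤ T.sweepingBound := by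
    obtain ⟨L₁, t₁, w₁, L₂, t₂, w₂, hI, -⟩ := hK.exists_isInversion hD.least.1
    have := (hb.card_innerCrossings_lt hs hn hu).2 (hb.two_le_width hs hu hI)
    exact (Nat.mul_le_mul_left _ this).trans (Nat.le_succ _)
  refine ⟨hD.isForwardFactor, hD.almostPeriodic properAnchors_sweepingAnchor h2 hK (by omega)
    ?_ ?_, ?_⟩
  · have hlev : ∀ t, s ≤ t → t ≤ a → ρ.level t = ρ.level s ∨
        (Even (ρ.level s) ∧ ρ.level t = ρ.level s + 1) := by
      intro t ht
      induction t, ht using Nat.le_induction with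
      | base => exact fun _ => Or.inl rfl
      | succ t ht ih =>
        intro hta
        have h3 := ih (by omega)
        rcases hb.step_level hs hu (t := t) (by omega) with h4 | ⟨h4, h5, h6 | h6⟩
        · rwa [h4.1]
        · rcases h3 with h3 | h3
          · rw [h3] at h6
            exact Or.inr ⟨h6.1, by omega⟩
          · rw [h3.2, Nat.even_add_one] at h6
            exact absurd h3.1 h6.1
        · have := hD.left (t + 1) (by omega) hta
          have := ρ.pos_eq_or (t := t) (by omega)
          omega
    rw [length_factorOut]
    refine (hb.sum_output_le hs hu (V := {ρ.level s, ρ.level s + 1}) ?_ ?_ ?_).trans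
      (Nat.mul_le_mul Finset.card_le_two hbound)
    · intro t ht
      rw [Finset.mem_Ico] at ht
      omega
    · intro t ht
      rw [Finset.mem_Ico] at ht
      have := hlev t ht.1 ht.2.le
      rw [Finset.mem_insert, Finset.mem_singleton]
      tauto
    · intro t₁ h3 t₂ h4 t h5 h6 _ _ L w hA
      rw [Finset.mem_Ico] at h3 h4
      have := hD.before _ _ _ hA (by omega)
      have := hD.left t (by omega) (by omega)
      omega
  · have hlev : ∀ t, b ≤ t → t ≤ e → ρ.level t = ρ.level b ∨
        (¬ Even (ρ.level b) ∧ ρ.level t = ρ.level b + 1) := by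
      intro t ht
      induction t, ht using Nat.le_induction with
      | base => exact fun _ => Or.inl rfl
      | succ t ht ih =>
        intro hte
        have h3 := ih (by omega)
        rcases hb.step_level hs hu (t := t) (by omega) with h4 | ⟨h4, h5, h6 | h6⟩
        · rwa [h4.1]
        · have := hD.right t (by omega) (by omega)
          have := pos_lt hs hu hel
          have := ρ.pos_eq_or (t := t) (by omega)
          omega
        · rcases h3 with h3 | h3
          · rw [h3] at h6
            exact Or.inr ⟨h6.1, by omega⟩
          · rw [h3.2, Nat.even_add_one, not_not] at h6
            exact absurd h6.1 h3.1
    rw [length_factorOut]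
    refine (hb.sum_output_le hs hu (V := {ρ.level b, ρ.level b + 1}) ?_ ?_ ?_).trans
      (Nat.mul_le_mul Finset.card_le_two hbound)
    · intro t ht
      rw [Finset.mem_Ico] at ht
      omega
    · intro t ht
      rw [Finset.mem_Ico] at ht
      have := hlev t ht.1 ht.2.le
      rw [Finset.mem_insert, Finset.mem_singleton]
      tauto
    · intro t₁ h3 t₂ h4 t h5 h6 _ _ L w hA
      rw [Finset.mem_Ico] at h3 h4
      have := hD.after _ _ _ hA (by omega)
      have := hD.right t (by omega) (by omega)
      omega
  -- Levels increase along the run, so a location outside the rectangle is outside horizontally. The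
  -- left and the right side each contribute at most `T.hmax * T.sweepingBound`.
  · rw [length_outOn, mul_assoc, two_mul, ← Finset.sum_filter_add_sum_filter_not _
      fun t => ρ.pos t < ρ.pos s]
    have hZ : ∀ t ∈ (Finset.Icc s e).filter (fun t =>
        ¬ ((ρ.pos s ≤ ρ.pos t ∧ ρ.pos t ≤ ρ.pos e) ∧
          (ρ.level s ≤ ρ.level t ∧ ρ.level t ≤ ρ.level e))),
        s ≤ t ∧ t ≤ e ∧ (ρ.pos t < ρ.pos s ∨ ρ.pos e < ρ.pos t) := by
      intro t ht
      rw [Finset.mem_filter, Finset.mem_Icc] at ht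
      have := hb.level_le hs hu ht.1.1 (by omega)
      have := hb.level_le hs hu ht.1.2 hel
      omega
    apply add_le_add
    · refine (hb.sum_output_le hs hu (V := Finset.range T.hmax) ?_ ?_ ?_).trans
        (Nat.mul_le_mul (Finset.card_range _).le hbound)
      · intro t ht
        simp only [Finset.mem_filter, Finset.mem_range] at ht
        exact ht.1.1
      · intro t ht
        simp only [Finset.mem_filter (p := fun t => _ ∧ _), Finset.mem_filter,
          Finset.mem_range] at ht ⊢
        exact level_lt_hmax hs hn ht.1.1.le
      · intro t₁ h3 t₂ h4 t h5 h6 h7 h8 L w hA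
        rw [Finset.mem_filter, Finset.mem_filter] at h3 h4
        have k1 := hZ t₁ h3.1.2.1
        have k2 := hZ t₂ h4.1.2.1
        have k4 := hZ _ h4.1.2.2
        have k3 := hb.pos_between hs hu h5.le h6 (by omega) h7 h8
        have k5 := hD.inside _ _ _ hA
        have k6 := hD.after _ _ _ hA
        have k7 := hD.left t
        have := hD.pos_le
        omega
    · refine (hb.sum_output_le hs hu (V := Finset.range T.hmax) ?_ ?_ ?_).trans
        (Nat.mul_le_mul (Finset.card_range _).le hbound)
      · intro t ht
        simp only [Finset.mem_filter, Finset.mem_range] at ht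
        exact ht.1.1
      · intro t ht
        rw [Finset.mem_filter, Finset.mem_filter, Finset.mem_range] at ht
        rw [Finset.mem_range]
        exact level_lt_hmax hs hn ht.1.1.le
      · intro t₁ h3 t₂ h4 t h5 h6 h7 h8 L w hA
        rw [Finset.mem_filter, Finset.mem_filter] at h3 h4
        have k1 := hZ t₁ h3.1.2.1
        have k2 := hZ t₂ h4.1.2.1
        have k4 := hZ _ h4.1.2.2
        have k3 := hb.pos_between hs hu h5.le h6 (by omega) h7 h8
        have k5 := hD.inside _ _ _ hA
        have k6 := hD.before _ _ _ hA
        have k7 := hD.right t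
        have := hD.pos_le
        omega

theorem ReversesOnlyAtBorders.length_factorOut_le [Fintype Q] (hb : ρ.ReversesOnlyAtBorders)
    (hs : ρ.IsSuccessful) (hn : ρ.IsNormalized) (hu : 2 ≤ u.length) {s e : ℕ} (he : e ≤ ρ.len)
    (h : ∀ L t w, ρ.SweepingAnchor L t w → s < t → ¬ t < e) :
    (ρ.factorOut s e).length ≤ 2 * T.hmax * T.sweepingBound := by
  rw [length_factorOut]
  refine (hb.sum_output_le hs hu (V := Finset.range T.hmax) ?_ ?_ ?_).trans ?_
  · intro t ht
    rw [Finset.mem_Ico] at ht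
    omega
  · intro t ht
    rw [Finset.mem_Ico] at ht
    exact Finset.mem_range.2 (level_lt_hmax hs hn (by omega))
  · intro t₁ h3 t₂ h4 t h5 h6 _ _ L w hA
    rw [Finset.mem_Ico] at h3 h4
    exact h _ _ _ hA (by omega) (by omega)
  · have hq : 0 < Fintype.card Q := Fintype.card_pos_iff.2 ⟨ρ.state 0⟩
    have h1 : 0 < Fintype.card Q ^ T.hmax := Nat.pow_pos hq
    have h2 := (hb.card_innerCrossings_lt hs hn hu).1
    -- Possibly there is only one sweep, and then the strict bound on crossing sequences is not
    -- available; the factor `2` replaces it.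
    have h3 : T.capacity * (ρ.innerCrossings.card + 1) ≤ 2 * T.sweepingBound := by
      calc _ ≤ T.capacity * (2 * Fintype.card Q ^ T.hmax) := Nat.mul_le_mul_left _ (by omega)
        _ = 2 * (T.capacity * Fintype.card Q ^ T.hmax) := by ring
        _ ≤ _ := Nat.mul_le_mul_left _ (Nat.le_succ _)
    rw [Finset.card_range, mul_comm 2, mul_assoc]
    exact Nat.mul_le_mul_left _ h3

/-- On an odd level, two anchor points are always part of an inversion. -/
theorem ReversesOnlyAtBorders.length_factorOut_le_of_odd [Fintype Q]
    (hb : ρ.ReversesOnlyAtBorders) (hs : ρ.IsSuccessful) (hn : ρ.IsNormalized)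
    (hu : 2 ≤ u.length) {s e : ℕ} (he : e ≤ ρ.len)
    (h1 : ∀ L t w, ρ.SweepingAnchor L t w → s < t → t < e → ¬ Even (ρ.level t))
    (h2 : ∀ L₁ t₁ w₁ L₂ t₂ w₂, s ≤ t₁ → t₂ ≤ e →
      ¬ ρ.IsInversion ρ.SweepingAnchor L₁ t₁ w₁ L₂ t₂ w₂) :
    (ρ.factorOut s e).length ≤ 2 * T.hmax * T.sweepingBound := by
  classical
  by_cases hex : ∃ L t w, ρ.SweepingAnchor L t w ∧ s < t ∧ t < e
  swap
  · exact hb.length_factorOut_le hs hn hu he fun L t w hA h3 h4 => hex ⟨L, t, w, hA, h3, h4⟩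
  -- An anchor point on an odd level witnesses a second sweep, so the strict bound on crossing
  -- sequences applies.
  have hbound : T.capacity * (ρ.innerCrossings.card + 1) ≤ T.sweepingBound := by
    obtain ⟨L, t, w, hA, h3, h4⟩ := hex
    have h5 := h1 _ _ _ hA h3 h4
    have h6 := ρ.level_lt_width (t := t) (by omega)
    rw [hb.width_eq hs hu (pos_pos t (by omega) (by omega)) (pos_lt hs hu hA.lt_len)] at h6
    have h7 : ρ.level t ≠ 0 := fun h => h5 (h ▸ Even.zero)
    have := (hb.card_innerCrossings_lt hs hn hu).2 (by omega)
    exact (Nat.mul_le_mul_left _ this).trans (Nat.le_succ _)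
  have hmem : ∀ t ∈ Finset.Ico s e, t < ρ.len ∧ ρ.level t ∈ Finset.range T.hmax := by
    intro t ht
    rw [Finset.mem_Ico] at ht
    exact ⟨by omega, Finset.mem_range.2 (level_lt_hmax hs hn (by omega))⟩
  -- Transitions are split according to whether an anchor point on their level precedes them. A
  -- further anchor point within the first part would complete an inversion, and within the second
  -- part there is none by definition.
  rw [length_factorOut, mul_assoc, two_mul, ← Finset.sum_filter_add_sum_filter_not _
    fun t => ∃ r, s < r ∧ r ≤ t ∧ ρ.level r = ρ.level t ∧ ∃ L w, ρ.SweepingAnchor L r w]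
  apply add_le_add
  · refine (hb.sum_output_le hs hu (V := Finset.range T.hmax)
      (fun t ht => (hmem t (Finset.mem_filter.1 ht).1).1)
      (fun t ht => (hmem t (Finset.mem_filter.1 ht).1).2) ?_).trans
      (Nat.mul_le_mul (Finset.card_range _).le hbound)
    intro t₁ h3 t₂ h4 t h5 h6 h7 h8 L w hA
    rw [Finset.mem_filter, Finset.mem_Ico] at h3 h4
    obtain ⟨⟨h9, -⟩, r, h10, h11, h12, L', w', hA'⟩ := h3
    refine h2 _ _ _ _ _ _ h10.le (by omega) ⟨hA', hA, by omega, ?_⟩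
    have h13 := h1 _ _ _ hA (by omega) (by omega)
    rcases hb.pos_eq hs hu (s := r) (t := t) (by omega) hA.lt_len (by omega) with h | h
    · rw [h12, ← h7] at h
      exact absurd h.1 h13
    · omega
  · refine (hb.sum_output_le hs hu (V := Finset.range T.hmax)
      (fun t ht => (hmem t (Finset.mem_filter.1 ht).1).1)
      (fun t ht => (hmem t (Finset.mem_filter.1 ht).1).2) ?_).trans
      (Nat.mul_le_mul (Finset.card_range _).le hbound)
    intro t₁ h3 t₂ h4 t h5 h6 h7 h8 L w hA
    rw [Finset.mem_filter, Finset.mem_Ico] at h3 h4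
    exact h4.2 ⟨t, by omega, h6, h8, L, w, hA⟩

/-- A factor without inversions is a diagonal: cut it at its anchor points on even levels. -/
theorem IsForwardFactor.isSweepingDiagonal [Fintype Q] (hb : ρ.ReversesOnlyAtBorders)
    (hs : ρ.IsSuccessful) (hn : ρ.IsNormalized) (hu : 2 ≤ u.length) {s e : ℕ}
    (hF : ρ.IsForwardFactor s e)
    (h1 : ∀ L t w, ρ.SweepingAnchor L t w → s < t → t < e →
      ρ.pos s ≤ ρ.pos t ∧ ρ.pos t ≤ ρ.pos e)
    (h2 : ∀ L₁ t₁ w₁ L₂ t₂ w₂, s ≤ t₁ → t₂ ≤ e →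
      ¬ ρ.IsInversion ρ.SweepingAnchor L₁ t₁ w₁ L₂ t₂ w₂) :
    ρ.IsSweepingDiagonal T.sweepingBound s e := by
  classical
  obtain ⟨k, hk⟩ : ∃ k, e ≤ s + k := ⟨e, by omega⟩
  induction k generalizing s with
  | zero =>
    refine ⟨hF, 0, fun i => if i = 0 then s else e, rfl, rfl, ?_, by omega, ?_⟩
    · intro i hi
      obtain rfl : i = 0 := by omega
      exact hF.1
    · intro i hi
      obtain rfl : i = 0 := by omega
      exact ⟨hb.length_factorOut_le hs hn hu hF.2.1
        fun L t w _ (h3 : s < t) (h4 : t < e) => by omega, hF.2.2⟩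
  | succ k ih =>
    by_cases hex : ∃ t, s < t ∧ t < e ∧ Even (ρ.level t) ∧ ∃ L w, ρ.SweepingAnchor L t w
    swap
    · refine ⟨hF, 0, fun i => if i = 0 then s else e, rfl, rfl, ?_, by omega, ?_⟩
      · intro i hi
        obtain rfl : i = 0 := by omega
        exact hF.1
      · intro i hi
        obtain rfl : i = 0 := by omega
        exact ⟨hb.length_factorOut_le_of_odd hs hn hu hF.2.1
          (fun L t w hA h3 h4 h5 => hex ⟨t, h3, h4, h5, L, w, hA⟩) h2, hF.2.2⟩
    obtain ⟨hst, hte, hev, L, w, hA⟩ := Nat.find_spec hex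
    have hmin := fun t' => Nat.find_min hex (m := t')
    generalize Nat.find hex = t at *
    have hpt := h1 L t w hA hst hte
    have hlen := hA.lt_len
    -- The cut is made at the first anchor point `t` on an even level. Later anchor points are not
    -- to the left of `t`, as this would be an inversion, so the induction hypothesis applies from
    -- `t` on.
    obtain ⟨-, n, ℓ, hℓ0, hℓn, hmono, hfl, hout⟩ := ih (s := t) ⟨hte.le, hF.2.1, hpt.2⟩
      (by
        intro L' t' w' hA' h3 h4
        refine ⟨?_, (h1 L' t' w' hA' (by omega) h4).2⟩
        by_contra h5
        exact h2 _ _ _ _ _ _ hst.le h4.le ⟨hA, hA', h3, by omega⟩)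
      (fun L₁ t₁ w₁ L₂ t₂ w₂ h3 => h2 L₁ t₁ w₁ L₂ t₂ w₂ (by omega)) (by omega)
    refine ⟨hF, n + 1, fun i => match i with | 0 => s | 1 => t | i + 2 => ℓ i, rfl, hℓn, ?_, ?_, ?_⟩
    · rintro (_ | _ | i) hi
      · exact hst.le
      · exact hℓ0.ge
      · exact hmono i (by omega)
    · rintro (_ | i) hi
      -- Floors consisting of a single location suffice, because the output between consecutive cuts
      -- is already small.
      · change ρ.IsFloor t (ℓ 0)
        rw [hℓ0]
        refine ⟨⟨le_rfl, hlen.le, le_rfl⟩, hev, fun r h3 h4 => ?_⟩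
        rw [le_antisymm h4 h3]
      · exact hfl i (by omega)
    · rintro (_ | i) hi
      · refine ⟨hb.length_factorOut_le_of_odd hs hn hu hlen.le (fun L t' w hA h3 h4 h5 => ?_)
          fun L₁ t₁ w₁ L₂ t₂ w₂ h3 h4 => h2 L₁ t₁ w₁ L₂ t₂ w₂ h3 (h4.trans hte.le), hpt.1⟩
        exact hmin t' h4 ⟨h3, lt_trans h4 hte, h5, L, w, hA⟩
      · exact hout i (by omega)

end Run

end TwoWayTransducer

/-! ### Assembly of the two cases -/

theorem proposition5p2 {Q A Γ : Type*} [Fintype Q] (T : TwoWayTransducer Q A Γ)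
    (u : List A) (hu : T.IsInput u) (ρ : T.Run u)
    (hsucc : ρ.IsSuccessful) (hnorm : ρ.IsNormalized) :
    -- the sweeping case
    (T.IsSweeping → ρ.SatisfiesP2 ρ.SweepingAnchor T.sweepingBound →
      (∀ K, ρ.IsInversionClass ρ.SweepingAnchor K →
        ∃ s e, ρ.IsBlockOf ρ.SweepingAnchor K s e ∧
          ρ.IsSweepingBlock T.sweepingBound s e) ∧
      ∃ (k : ℕ) (τ : ℕ → ℕ),
        ρ.IsDecomposition (ρ.IsSweepingDiagonal T.sweepingBound)
          (ρ.IsSweepingBlock T.sweepingBound) k τ ∧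
        (∀ s e, ρ.IsInversionBlock ρ.SweepingAnchor s e →
          ∃ i < k, τ i = s ∧ τ (i + 1) = e) ∧
        ∀ i < k, ρ.IsInversionBlock ρ.SweepingAnchor (τ i) (τ (i + 1)) ∨
          (ρ.AvoidsInversionBlocks ρ.SweepingAnchor (τ i) (τ (i + 1)) ∧
            ρ.IsSweepingDiagonal T.sweepingBound (τ i) (τ (i + 1)))) ∧
    -- the two-way case
    (ρ.SatisfiesP2 ρ.TwoWayAnchor T.twoWayBound →
      (∀ K, ρ.IsInversionClass ρ.TwoWayAnchor K →
        ∃ s e, ρ.IsBlockOf ρ.TwoWayAnchor K s e ∧ ρ.IsTwoWayBlock T.twoWayBound s e) ∧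
      (∀ s e, ρ.IsForwardFactor s e → ρ.AvoidsInversionBlocks ρ.TwoWayAnchor s e →
        ρ.IsTwoWayDiagonal T.twoWayBound s e) ∧
      ∃ (k : ℕ) (τ : ℕ → ℕ),
        ρ.IsDecomposition (ρ.IsTwoWayDiagonal T.twoWayBound)
          (ρ.IsTwoWayBlock T.twoWayBound) k τ ∧
        (∀ s e, ρ.IsInversionBlock ρ.TwoWayAnchor s e →
          ∃ i < k, τ i = s ∧ τ (i + 1) = e) ∧
        ∀ i < k, ρ.IsInversionBlock ρ.TwoWayAnchor (τ i) (τ (i + 1)) ∨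
          (ρ.AvoidsInversionBlocks ρ.TwoWayAnchor (τ i) (τ (i + 1)) ∧
            ρ.IsTwoWayDiagonal T.twoWayBound (τ i) (τ (i + 1)))) := by
  have hu2 := hu.two_le_length
  constructor
  · intro hsw h2
    have hb := hsw u hu ρ hsucc
    have hblock : ∀ s e, ρ.IsInversionBlock ρ.SweepingAnchor s e →
        ρ.IsSweepingBlock T.sweepingBound s e := by
      rintro s e ⟨K, hK, hB⟩
      obtain ⟨a, b, hD⟩ := hB.data hK TwoWayTransducer.Run.properAnchors_sweepingAnchor
      exact hD.isSweepingBlock hb hsucc hnorm hu2 h2 hK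
    refine ⟨fun K hK => ?_, ?_⟩
    · obtain ⟨s, e, hB⟩ :=
        hK.exists_isBlockOf TwoWayTransducer.Run.properAnchors_sweepingAnchor hsucc
      exact ⟨s, e, hB, hblock s e ⟨K, hK, hB⟩⟩
    · exact TwoWayTransducer.Run.exists_isDecomposition
        TwoWayTransducer.Run.properAnchors_sweepingAnchor hsucc hblock fun s e hG =>
          hG.forward.isSweepingDiagonal hb hsucc hnorm hu2 hG.anchors
            fun _ _ _ _ _ _ h3 h4 => hG.avoids.not_isInversion
              TwoWayTransducer.Run.properAnchors_sweepingAnchor hsucc h3 h4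
  · intro h2
    have hblock : ∀ s e, ρ.IsInversionBlock ρ.TwoWayAnchor s e →
        ρ.IsTwoWayBlock T.twoWayBound s e := by
      rintro s e ⟨K, hK, hB⟩
      obtain ⟨a, b, hD⟩ := hB.data hK TwoWayTransducer.Run.properAnchors_twoWayAnchor
      exact hD.isTwoWayBlock hsucc hnorm h2 hK
    refine ⟨fun K hK => ?_, fun s e hF hA => hF.isTwoWayDiagonal hsucc hnorm hA, ?_⟩
    · obtain ⟨s, e, hB⟩ :=
        hK.exists_isBlockOf TwoWayTransducer.Run.properAnchors_twoWayAnchor hsucc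
      exact ⟨s, e, hB, hblock s e ⟨K, hK, hB⟩⟩
    · exact TwoWayTransducer.Run.exists_isDecomposition
        TwoWayTransducer.Run.properAnchors_twoWayAnchor hsucc hblock fun s e hG =>
          hG.forward.isTwoWayDiagonal hsucc hnorm hG.avoids
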